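/- Let $M$ be a smooth manifold of dimension $2n+1$ with a $K$-contact structure $(\eta,\xi,\Phi)$. That is: $\eta$ is a smooth $1$-form with $\eta\wedge(d\eta)^n$ nowhere zero; $\xi$ is its Reeb field, $\eta(\xi)=1$, $\iota_\xi d\eta=0$; and $\Phi$ is a smooth endomorphism of $TM$ with $\Phi^2=-\mathrm{id}+\xi\otimes\eta$, $\mathfrak L_\xi\Phi=0$, $d\eta(\Phi X,\Phi Y)=d\eta(X,Y)$ for all tangent vectors $X,Y$, and $d\eta(Z,\Phi Z)>0$ for all $0\neq Z\in\ker\eta$. Let $g(X,Y)=d\eta(X,\Phi Y)+\eta(X)\eta(Y)$ be the associated Riemannian metric and $\ast$ its Hodge star for the orientation given by $\eta\wedge(d\eta)^n$. A smooth $p$-form $\alpha$ is basic if $\iota_\xi\alpha=0$ and $\mathfrak L_\xi\alpha=0$; write $\Omega_B^p$ for the space of basic $p$-forms. For $\alpha\in\Omega^p_B$ put $$d_B\alpha=d\alpha,\qquad (\Phi\alpha)(X_1,\dots,X_p)=(-1)^p\alpha(\Phi X_1,\dots,\Phi X_p),\qquad d^c_B\alpha=(-1)^p\,\Phi\, d\,\Phi\alpha,$$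 $$\bar\ast\alpha=\ast(\eta\wedge\alpha),\qquad \delta_B=-\bar\ast\, d_B\,\bar\ast,\qquad \delta^c_B=-\bar\ast\, d^c_B\,\bar\ast,$$ $$L\alpha=\alpha\wedge d\eta,\qquad \Lambda\alpha=\bar\ast^{-1}L\,\bar\ast\alpha=(-1)^p\,\bar\ast L\,\bar\ast\alpha,$$ so that $\Lambda$ is the pointwise adjoint of $L$. Then, with no integrability assumption on $\Phi$, the Kähler identities hold on $\Omega_B^*=\bigoplus_p\Omega_B^p$: $$[L,\delta^c_B]=-d_B,\qquad [L,\delta_B]=d^c_B,\qquad [\Lambda,d^c_B]=\delta_B,\qquad [\Lambda,d_B]=-\delta^c_B,$$ where $[A,B]=AB-BA$. -/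

import Mathlib

open scoped Manifold ContDiff Topology

noncomputable section

namespace KContact

/-! ### Exterior algebra of a real topological vector space -/

section Linear

variable {V : Type*} [AddCommGroup V] [Module ℝ V] [TopologicalSpace V]

/-- The tensor product `(v₁, …, v_{p+q}) ↦ α(v₁, …, v_p) β(v_{p+1}, …, v_{p+q})` of two forms. -/
def tensorForm {p q : ℕ} (α : V [⋀^Fin p]→L[ℝ] ℝ) (β : V [⋀^Fin q]→L[ℝ] ℝ) :
    ContinuousMultilinearMap ℝ (fun _ : Fin (p + q) => V) ℝ where
  toFun v := α (fun i => v (Fin.castAdd q i)) * β (fun j => v (Fin.natAdd p j))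
  map_update_add' v i x y := by
    have h := ((LinearMap.mul' ℝ ℝ).compMultilinearMap
      ((MultilinearMap.domCoprod α.toMultilinearMap β.toMultilinearMap).domDomCongr
        finSumFinEquiv)).map_update_add v i x y
    simp only [LinearMap.compMultilinearMap_apply, MultilinearMap.domDomCongr_apply,
      MultilinearMap.domCoprod_apply, LinearMap.mul'_apply, finSumFinEquiv_apply_left,
      finSumFinEquiv_apply_right] at h
    exact h
  map_update_smul' v i c x := by
    have h := ((LinearMap.mul' ℝ ℝ).compMultilinearMap
      ((MultilinearMap.domCoprod α.toMultilinearMap β.toMultilinearMap).domDomCongr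
        finSumFinEquiv)).map_update_smul v i c x
    simp only [LinearMap.compMultilinearMap_apply, MultilinearMap.domDomCongr_apply,
      MultilinearMap.domCoprod_apply, LinearMap.mul'_apply, finSumFinEquiv_apply_left,
      finSumFinEquiv_apply_right] at h
    exact h
  cont := (α.cont.comp (by fun_prop)).mul (β.cont.comp (by fun_prop))

/-- The wedge product, normalized so that `(θ₁ ∧ θ₂)(v, w) = θ₁(v) θ₂(w) - θ₁(w) θ₂(v)` on
`1`-forms. -/
def wedge {p q : ℕ} (α : V [⋀^Fin p]→L[ℝ] ℝ) (β : V [⋀^Fin q]→L[ℝ] ℝ) :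
    V [⋀^Fin (p + q)]→L[ℝ] ℝ :=
  ((p.factorial * q.factorial : ℝ)⁻¹) •
    ContinuousMultilinearMap.alternatization (tensorForm α β)

/-- The `k`-th exterior power of a `2`-form. -/
def wedgePow (β : V [⋀^Fin 2]→L[ℝ] ℝ) : (k : ℕ) → V [⋀^Fin (2 * k)]→L[ℝ] ℝ
  | 0 => ContinuousAlternatingMap.constOfIsEmpty ℝ V (Fin 0) 1
  | k + 1 => wedge (wedgePow β k) β

theorem append_cast_update {V : Type*} {r q m : ℕ} (h : r + q = m) (u : Fin r → V) (v : Fin q → V)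
    (i : Fin q) (x : V) :
    (fun k : Fin m => Fin.append u (Function.update v i x) (Fin.cast h.symm k)) =
      Function.update (fun k : Fin m => Fin.append u v (Fin.cast h.symm k))
        (Fin.cast h (Fin.natAdd r i)) x := by
  subst h
  funext k
  refine Fin.addCases (fun a => ?_) (fun b => ?_) k
  · have : Fin.castAdd q a ≠ Fin.natAdd r i := by
      intro hh
      have := congrArg Fin.val hh
      simp at this
      omega
    simp [Function.update_of_ne this]
  · by_cases hb : b = i
    · subst hb
      simp
    · have : Fin.natAdd r b ≠ Fin.natAdd r i := by
        intro hh
        exact hb (by simpa using hh)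
      simp [Function.update_of_ne this, Function.update_of_ne hb]

/-- The form `v ↦ β(u₁, …, u_r, v₁, …, v_q)`. -/
def contractLeft {r q m : ℕ} (h : r + q = m) (u : Fin r → V) (β : V [⋀^Fin m]→L[ℝ] ℝ) :
    V [⋀^Fin q]→L[ℝ] ℝ where
  toFun v := β (fun k => Fin.append u v (Fin.cast h.symm k))
  map_update_add' v i x y := by
    have hi := Subsingleton.elim ‹DecidableEq (Fin q)› (instDecidableEqFin q)
    subst hi
    rw [append_cast_update h, append_cast_update h, append_cast_update h,
      β.map_update_add]
  map_update_smul' v i c x := by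
    have hi := Subsingleton.elim ‹DecidableEq (Fin q)› (instDecidableEqFin q)
    subst hi
    rw [append_cast_update h, append_cast_update h, β.map_update_smul]
  map_eq_zero_of_eq' v i j hv hij := by
    refine β.map_eq_zero_of_eq (i := Fin.cast h (Fin.natAdd r i))
      (j := Fin.cast h (Fin.natAdd r j)) _ ?_ ?_
    · simpa using hv
    · intro hh
      exact hij (by simpa using hh)
  cont := by
    refine β.cont.comp (continuous_pi fun k => ?_)
    refine Fin.addCases (fun a => ?_) (fun b => ?_) (Fin.cast h.symm k)
    · simpa using continuous_const
    · simpa using continuous_apply b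

/-- The Hodge star of an `r`-form, computed in an orthonormal frame `e` with volume form `vol`:
`(*α)(v) = (1 / r!) ∑ α(e_{i₁}, …, e_{i_r}) vol(e_{i₁}, …, e_{i_r}, v₁, …, v_q)`, the sum being
over all `i₁, …, i_r`. -/
def hodgeOfFrame {r q m : ℕ} (h : r + q = m) (e : Fin m → V) (vol : V [⋀^Fin m]→L[ℝ] ℝ)
    (α : V [⋀^Fin r]→L[ℝ] ℝ) : V [⋀^Fin q]→L[ℝ] ℝ :=
  ((r.factorial : ℝ)⁻¹) •
    ∑ i : Fin r → Fin m, α (fun k => e (i k)) • contractLeft h (fun k => e (i k)) vol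

end Linear

/-- A positive definite symmetric bilinear form has an orthonormal frame. -/
theorem exists_frame {V : Type*} [AddCommGroup V] [Module ℝ V] [FiniteDimensional ℝ V] {m : ℕ}
    (hm : Module.finrank ℝ V = m) (B : V →ₗ[ℝ] V →ₗ[ℝ] ℝ) (hs : ∀ v w, B v w = B w v)
    (hp : ∀ v, v ≠ 0 → 0 < B v v) :
    ∃ e : Fin m → V, ∀ i j, B (e i) (e j) = if i = j then 1 else 0 := by
  let c : InnerProductSpace.Core ℝ V :=
    { inner := fun v w => B v w
      conj_inner_symm := fun v w => hs w v
      re_inner_nonneg := fun v => by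
        by_cases hv : v = 0
        · simp [hv]
        · exact (hp v hv).le
      add_left := fun u v w => by simp
      smul_left := fun u v r => by simp
      definite := fun v hv => by
        by_contra h
        exact (hp v h).ne' hv }
  let _ : NormedAddCommGroup V := c.toNormedAddCommGroup
  let _ : InnerProductSpace ℝ V := InnerProductSpace.ofCore c.toCore
  let b := (stdOrthonormalBasis ℝ V).reindex (finCongr hm)
  exact ⟨b, fun i j => orthonormal_iff_ite.mp b.orthonormal i j⟩

/-! ### Differential forms on a manifold -/

section Forms

variable {E : Type*} [NormedAddCommGroup E] [NormedSpace ℝ E]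
  {M : Type*} [TopologicalSpace M] [ChartedSpace E M]

/-- A (not necessarily smooth) vector field on `M`. -/
abbrev VField (E : Type*) [NormedAddCommGroup E] [NormedSpace ℝ E] (M : Type*)
    [TopologicalSpace M] [ChartedSpace E M] : Type _ :=
  ∀ x : M, TangentSpace 𝓘(ℝ, E) x

/-- A (not necessarily smooth) differential `p`-form on `M`. -/
abbrev Form (E : Type*) [NormedAddCommGroup E] [NormedSpace ℝ E] (M : Type*)
    [TopologicalSpace M] [ChartedSpace E M] (p : ℕ) : Type _ :=
  ∀ x : M, (TangentSpace 𝓘(ℝ, E) x) [⋀^Fin p]→L[ℝ] ℝ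

/-- The vector field `X` is smooth near the point `x`. -/
def VField.SmoothAt [IsManifold 𝓘(ℝ, E) ∞ M] (X : VField E M) (x : M) : Prop :=
  ContMDiffAt 𝓘(ℝ, E) 𝓘(ℝ, E).tangent ∞
    (fun y => (⟨y, X y⟩ : TangentBundle 𝓘(ℝ, E) M)) x

/-- The expression of a form in the preferred chart at `x₀`, i.e. its pullback under the inverse
of that chart. -/
def Form.inChart {p : ℕ} (α : Form E M p) (x₀ : M) : E → E [⋀^Fin p]→L[ℝ] ℝ := fun y =>
  ContinuousAlternatingMap.compContinuousLinearMap
    (α ((extChartAt 𝓘(ℝ, E) x₀).symm y))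
    (mfderiv 𝓘(ℝ, E) 𝓘(ℝ, E) (extChartAt 𝓘(ℝ, E) x₀).symm y)

/-- A form is smooth if its expressions in charts are. -/
def Form.Smooth {p : ℕ} (α : Form E M p) : Prop :=
  ∀ x₀ : M, ContDiffOn ℝ ∞ (α.inChart x₀) (extChartAt 𝓘(ℝ, E) x₀).target

/-- The exterior derivative: at `x`, differentiate in the preferred chart at `x` and pull back. -/
def extD {p : ℕ} (α : Form E M p) : Form E M (p + 1) := fun x =>
  ContinuousAlternatingMap.compContinuousLinearMap
    (extDeriv (α.inChart x) (extChartAt 𝓘(ℝ, E) x x))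
    (mfderiv 𝓘(ℝ, E) 𝓘(ℝ, E) (extChartAt 𝓘(ℝ, E) x) x)

/-- The derivative of a function at `x` in the direction of a tangent vector. -/
def dirDeriv (f : M → ℝ) (x : M) (v : TangentSpace 𝓘(ℝ, E) x) : ℝ :=
  mfderiv 𝓘(ℝ, E) 𝓘(ℝ, ℝ) f x v

/-- Smooth forms `α` with `ι_ξ α = 0` and `𝔏_ξ α = 0`. The Lie derivative is expressed by
`(𝔏_ξ α)(X₁, …, X_p) = ξ(α(X₁, …, X_p)) - ∑ᵢ α(X₁, …, [ξ, Xᵢ], …, X_p)`. -/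
structure IsBasic [IsManifold 𝓘(ℝ, E) ∞ M] (ξ : VField E M) {p : ℕ} (α : Form E M p) :
    Prop where
  smooth : α.Smooth
  interior_eq_zero : ∀ (x : M) (v : Fin p → TangentSpace 𝓘(ℝ, E) x),
    (∃ i, v i = ξ x) → α x v = 0
  lie_eq_zero : ∀ (x : M) (X : Fin p → VField E M), (∀ i, (X i).SmoothAt x) →
    dirDeriv (fun y => α y (fun i => X i y)) x (ξ x) -
      ∑ i, α x (Function.update (fun j => X j x) i
        (VectorField.mlieBracket 𝓘(ℝ, E) ξ (X i) x)) = 0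

/-- Inhomogeneous forms: one form in each degree. Forms of degree larger than the dimension
vanish, so this is the total space of the de Rham algebra. -/
abbrev Forms (E : Type*) [NormedAddCommGroup E] [NormedSpace ℝ E] (M : Type*)
    [TopologicalSpace M] [ChartedSpace E M] : Type _ :=
  ∀ p : ℕ, Form E M p

/-- The exterior derivative on inhomogeneous forms. -/
def d (α : Forms E M) : Forms E M
  | 0 => 0
  | p + 1 => extD (α p)

end Forms

/-! ### `K`-contact structures -/

/-- The model space of manifolds of dimension `2n + 1`. -/
abbrev Model (n : ℕ) : Type := EuclideanSpace ℝ (Fin (2 * n + 1))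

/-- A `K`-contact structure `(η, ξ, Φ)` on a manifold of dimension `2n + 1`. -/
structure KContactStructure (n : ℕ) (M : Type*) [TopologicalSpace M] [ChartedSpace (Model n) M]
    [IsManifold 𝓘(ℝ, Model n) ∞ M] where
  η : Form (Model n) M 1
  ξ : VField (Model n) M
  Φ : ∀ x : M, TangentSpace 𝓘(ℝ, Model n) x →L[ℝ] TangentSpace 𝓘(ℝ, Model n) x
  η_smooth : η.Smooth
  ξ_smooth : ∀ x, ξ.SmoothAt x
  Φ_smooth : ContMDiff 𝓘(ℝ, Model n) (𝓘(ℝ, Model n).prod 𝓘(ℝ, Model n →L[ℝ] Model n)) ∞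
    (fun x => Bundle.TotalSpace.mk' (Model n →L[ℝ] Model n)
      (E := fun x : M => TangentSpace 𝓘(ℝ, Model n) x →L[ℝ] TangentSpace 𝓘(ℝ, Model n) x)
      x (Φ x))
  /-- `η ∧ (dη)ⁿ` vanishes nowhere. -/
  contact : ∀ x, wedge (η x) (wedgePow (extD η x) n) ≠ 0
  /-- `ξ` is the Reeb field. -/
  η_ξ : ∀ x, η x ![ξ x] = 1
  dη_ξ : ∀ x (X : TangentSpace 𝓘(ℝ, Model n) x), extD η x ![ξ x, X] = 0
  Φ_sq : ∀ x (X : TangentSpace 𝓘(ℝ, Model n) x), Φ x (Φ x X) = -X + η x ![X] • ξ x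
  /-- `𝔏_ξ Φ = 0`, i.e. `[ξ, ΦX] = Φ[ξ, X]`. -/
  lie_Φ : ∀ (x : M) (X : VField (Model n) M), X.SmoothAt x →
    VectorField.mlieBracket 𝓘(ℝ, Model n) ξ (fun y => Φ y (X y)) x -
      Φ x (VectorField.mlieBracket 𝓘(ℝ, Model n) ξ X x) = 0
  dη_Φ : ∀ x (X Y : TangentSpace 𝓘(ℝ, Model n) x),
    extD η x ![Φ x X, Φ x Y] = extD η x ![X, Y]
  dη_pos : ∀ x (Z : TangentSpace 𝓘(ℝ, Model n) x), η x ![Z] = 0 → Z ≠ 0 →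
    0 < extD η x ![Z, Φ x Z]

namespace KContactStructure

variable {n : ℕ} {M : Type*} [TopologicalSpace M] [ChartedSpace (Model n) M]
  [IsManifold 𝓘(ℝ, Model n) ∞ M] (K : KContactStructure n M)

/-- The metric `g(X, Y) = dη(X, ΦY) + η(X) η(Y)`. -/
def metric (x : M) (X Y : TangentSpace 𝓘(ℝ, Model n) x) : ℝ :=
  extD K.η x ![X, K.Φ x Y] + K.η x ![X] * K.η x ![Y]

/-- The nowhere vanishing form `η ∧ (dη)ⁿ`, which orients `M`. -/
def contactVolume (x : M) :
    (TangentSpace 𝓘(ℝ, Model n) x) [⋀^Fin (1 + 2 * n)]→L[ℝ] ℝ :=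
  wedge (K.η x) (wedgePow (extD K.η x) n)

theorem form1_add {V : Type*} [AddCommGroup V] [Module ℝ V] [TopologicalSpace V]
    (θ : V [⋀^Fin 1]→L[ℝ] ℝ) (a b : V) : θ ![a + b] = θ ![a] + θ ![b] := by
  have e : ∀ t, Function.update ![a] 0 t = ![t] := fun t => by
    funext i; fin_cases i; rfl
  have h := θ.map_update_add ![a] 0 a b
  rwa [e, e, e] at h

theorem form1_smul {V : Type*} [AddCommGroup V] [Module ℝ V] [TopologicalSpace V]
    (θ : V [⋀^Fin 1]→L[ℝ] ℝ) (c : ℝ) (a : V) : θ ![c • a] = c * θ ![a] := by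
  have e : ∀ t, Function.update ![a] 0 t = ![t] := fun t => by
    funext i; fin_cases i; rfl
  have h := θ.map_update_smul ![a] 0 c a
  rwa [e, e] at h

theorem form2_add_left {V : Type*} [AddCommGroup V] [Module ℝ V] [TopologicalSpace V]
    (θ : V [⋀^Fin 2]→L[ℝ] ℝ) (a b c : V) : θ ![a + b, c] = θ ![a, c] + θ ![b, c] := by
  have e : ∀ t, Function.update ![a, c] 0 t = ![t, c] := fun t => by
    funext i; fin_cases i <;> rfl
  have h := θ.map_update_add ![a, c] 0 a b
  rwa [e, e, e] at h

theorem form2_smul_left {V : Type*} [AddCommGroup V] [Module ℝ V] [TopologicalSpace V]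
    (θ : V [⋀^Fin 2]→L[ℝ] ℝ) (r : ℝ) (a c : V) : θ ![r • a, c] = r * θ ![a, c] := by
  have e : ∀ t, Function.update ![a, c] 0 t = ![t, c] := fun t => by
    funext i; fin_cases i <;> rfl
  have h := θ.map_update_smul ![a, c] 0 r a
  rwa [e, e] at h

theorem form2_swap {V : Type*} [AddCommGroup V] [Module ℝ V] [TopologicalSpace V]
    (θ : V [⋀^Fin 2]→L[ℝ] ℝ) (a b : V) : θ ![a, b] = -θ ![b, a] := by
  have h := θ.toAlternatingMap.map_swap ![b, a] (i := 0) (j := 1) (by decide)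
  have e : (![b, a] ∘ ⇑(Equiv.swap (0 : Fin 2) 1)) = ![a, b] := by
    funext i; fin_cases i <;> simp
  rw [e] at h
  exact h

theorem form2_add_right {V : Type*} [AddCommGroup V] [Module ℝ V] [TopologicalSpace V]
    (θ : V [⋀^Fin 2]→L[ℝ] ℝ) (a b c : V) : θ ![a, b + c] = θ ![a, b] + θ ![a, c] := by
  rw [form2_swap, form2_add_left, form2_swap θ b a, form2_swap θ c a]; ring

theorem form2_smul_right {V : Type*} [AddCommGroup V] [Module ℝ V] [TopologicalSpace V]
    (θ : V [⋀^Fin 2]→L[ℝ] ℝ) (r : ℝ) (a c : V) : θ ![a, r • c] = r * θ ![a, c] := by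
  rw [form2_swap, form2_smul_left, form2_swap θ c a]; ring

theorem Φ_ξ (x : M) : K.Φ x (K.ξ x) = 0 := by
  have h1 : K.Φ x (K.Φ x (K.ξ x)) = 0 := by
    rw [K.Φ_sq, K.η_ξ, one_smul, neg_add_cancel]
  have h2 : -K.Φ x (K.ξ x) + K.η x ![K.Φ x (K.ξ x)] • K.ξ x = 0 := by
    rw [← K.Φ_sq, h1, map_zero]
  have h3 : K.Φ x (K.ξ x) = K.η x ![K.Φ x (K.ξ x)] • K.ξ x := (neg_add_eq_zero.mp h2)
  set c := K.η x ![K.Φ x (K.ξ x)] with hc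
  have h4 : (c * c) • K.ξ x = 0 := by
    have := h1
    rw [h3, map_smul, h3, smul_smul] at this
    exact this
  have h5 : c * c = 0 := by
    have := congrArg (fun v => K.η x ![v]) h4
    simp only [form1_smul, K.η_ξ, mul_one] at this
    rw [this]
    have h0 := form1_smul (K.η x) 0 (K.ξ x)
    simpa using h0
  rw [h3, mul_self_eq_zero.mp h5, zero_smul]

theorem η_Φ (x : M) (X : TangentSpace 𝓘(ℝ, Model n) x) : K.η x ![K.Φ x X] = 0 := by
  have h := K.Φ_sq x (K.Φ x X)
  rw [K.Φ_sq x X, map_add, map_neg, map_smul, K.Φ_ξ, smul_zero] at h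
  have h' : K.η x ![K.Φ x X] • K.ξ x = 0 := by
    simpa using h
  have := congrArg (fun v => K.η x ![v]) h'
  simp only [form1_smul, K.η_ξ, mul_one] at this
  rw [this]
  have h0 := form1_smul (K.η x) 0 (K.ξ x)
  simpa using h0

theorem metric_symm (x : M) (X Y : TangentSpace 𝓘(ℝ, Model n) x) :
    K.metric x X Y = K.metric x Y X := by
  unfold metric
  have h : extD K.η x ![X, K.Φ x Y] = extD K.η x ![Y, K.Φ x X] := by
    rw [← K.dη_Φ x X (K.Φ x Y), K.Φ_sq, form2_add_right, form2_smul_right,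
      form2_swap _ (K.Φ x X) (K.ξ x), K.dη_ξ]
    have := form2_smul_right (extD K.η x) (-1) (K.Φ x X) Y
    rw [neg_one_smul] at this
    rw [this, form2_swap _ (K.Φ x X) Y]
    ring
  rw [h]
  exact congrArg _ (mul_comm _ _)

theorem metric_pos (x : M) (X : TangentSpace 𝓘(ℝ, Model n) x) (hX : X ≠ 0) :
    0 < K.metric x X X := by
  set c := K.η x ![X] with hc
  set Z := X + (-c) • K.ξ x with hZ
  have hη : K.η x ![Z] = 0 := by
    rw [hZ, form1_add, form1_smul, K.η_ξ]; ring
  have hΦ : K.Φ x Z = K.Φ x X := by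
    rw [hZ, map_add, map_smul, K.Φ_ξ, smul_zero, add_zero]
  have hd : extD K.η x ![Z, K.Φ x Z] = extD K.η x ![X, K.Φ x X] := by
    rw [hΦ, hZ, form2_add_left, form2_smul_left, K.dη_ξ]; ring
  have hm : K.metric x X X = extD K.η x ![Z, K.Φ x Z] + c * c := by
    rw [hd]; rfl
  rw [hm]
  by_cases h0 : Z = 0
  · have hc0 : c ≠ 0 := by
      intro h
      apply hX
      rw [hZ, h] at h0
      simpa using h0
    have : extD K.η x ![Z, K.Φ x Z] = 0 := by
      rw [h0]
      have := form2_smul_left (extD K.η x) 0 0 (K.Φ x 0)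
      simpa using this
    rw [this, zero_add]
    exact mul_self_pos.mpr hc0
  · exact add_pos_of_pos_of_nonneg (K.dη_pos x Z hη h0) (mul_self_nonneg c)

theorem exists_orthonormalFrame (x : M) :
    ∃ e : Fin (1 + 2 * n) → TangentSpace 𝓘(ℝ, Model n) x,
      ∀ i j, K.metric x (e i) (e j) = if i = j then 1 else 0 := by
  have hm : Module.finrank ℝ (TangentSpace 𝓘(ℝ, Model n) x) = 1 + 2 * n := by
    change Module.finrank ℝ (EuclideanSpace ℝ (Fin (2 * n + 1))) = _
    rw [finrank_euclideanSpace, Fintype.card_fin, add_comm]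
  have : FiniteDimensional ℝ (TangentSpace 𝓘(ℝ, Model n) x) :=
    inferInstanceAs (FiniteDimensional ℝ (EuclideanSpace ℝ (Fin (2 * n + 1))))
  refine exists_frame hm
    (LinearMap.mk₂ ℝ (K.metric x) ?_ ?_ ?_ ?_) (K.metric_symm x) (K.metric_pos x)
  · intro a b c
    simp only [metric, form1_add]
    rw [form2_add_left]; ring
  · intro r a c
    simp only [metric, form1_smul, smul_eq_mul]
    rw [form2_smul_left]; ring
  · intro a b c
    simp only [metric, map_add, form1_add]
    rw [form2_add_right]; ring
  · intro r a c
    simp only [metric, map_smul, form1_smul, smul_eq_mul]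
    rw [form2_smul_right]; ring

/-- A `g`-orthonormal frame of the tangent space at `x`. -/
def frame (x : M) : Fin (1 + 2 * n) → TangentSpace 𝓘(ℝ, Model n) x :=
  Classical.choose (K.exists_orthonormalFrame x)

/-- The Riemannian volume form of `g` for the orientation given by `η ∧ (dη)ⁿ`: the positive
multiple of `η ∧ (dη)ⁿ` that takes the values `±1` on orthonormal frames. -/
def volumeForm (x : M) : (TangentSpace 𝓘(ℝ, Model n) x) [⋀^Fin (1 + 2 * n)]→L[ℝ] ℝ :=
  |K.contactVolume x (K.frame x)|⁻¹ • K.contactVolume x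

/-- The Riemannian Hodge star of `g`, from `r`-forms to `q`-forms with `r + q = 2n + 1`. -/
def hodge {r q : ℕ} (h : r + q = 1 + 2 * n) (α : Form (Model n) M r) : Form (Model n) M q :=
  fun x => hodgeOfFrame h (K.frame x) (K.volumeForm x) (α x)

/-- The transverse Hodge star `*̄ α = *(η ∧ α)`. -/
def star (α : Forms (Model n) M) : Forms (Model n) M := fun q =>
  if h : q ≤ 2 * n then
    K.hodge (r := 1 + (2 * n - q)) (by omega) (fun x => wedge (K.η x) (α (2 * n - q) x))
  else 0

/-- The action `(Φα)(X₁, …, X_p) = (-1)^p α(ΦX₁, …, ΦX_p)`. -/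
def act (α : Forms (Model n) M) : Forms (Model n) M := fun p x =>
  (-1 : ℝ) ^ p • (α p x).compContinuousLinearMap (K.Φ x)

/-- The sign operator, equal to `(-1)^p` on `p`-forms. -/
def sgn (α : Forms (Model n) M) : Forms (Model n) M := fun p => (-1 : ℝ) ^ p • α p

/-- The twisted exterior derivative `d^c = (-1)^p Φ d Φ` on `p`-forms. -/
def dc (α : Forms (Model n) M) : Forms (Model n) M := K.act (d (K.act (sgn α)))

/-- `δ_B = -*̄ d *̄`. -/
def δ (α : Forms (Model n) M) : Forms (Model n) M := -K.star (d (K.star α))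

/-- `δ^c_B = -*̄ d^c *̄`. -/
def δc (α : Forms (Model n) M) : Forms (Model n) M := -K.star (K.dc (K.star α))

/-- `L α = α ∧ dη`. -/
def L (α : Forms (Model n) M) : Forms (Model n) M
  | 0 => 0
  | 1 => 0
  | p + 2 => fun x => wedge (α p x) (extD K.η x)

/-- The adjoint `Λ = *̄⁻¹ L *̄` of `L`, that is `(-1)^p *̄ L *̄` on `p`-forms. -/
def Λ (α : Forms (Model n) M) : Forms (Model n) M := K.star (K.L (K.star (sgn α)))

end KContactStructure

end KContact

end

/-!
The operators `L` and `Λ` generate an action of `sl₂` on horizontal forms, and the transverse Hodge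
star is, up to the action of `Φ` and to signs that depend on the degree, the Weyl element
`w = exp(Λ) exp(-L) exp(Λ)` of that action. The Kähler identities follow by looking at how `w`
acts on the exterior derivative.

On a single tangent space (`ContactModule`) one has `[L, Λ] = p - n` on horizontal `p`-forms
(`ContactModule.L_Λ`), and `w` turns exterior into interior multiplication (`ContactModule.w_wOp`).
So does the Hodge star `*̄`, by a direct computation in a frame (`ContactModule.starOp_wOp`). Since
horizontal forms are generated by `1` under exterior multiplication (`ContactModule.Hor_le`), the
two agree up to `Φ` and signs as soon as they agree on `1`; this is `ContactModule.starOp_eq`: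
`*̄ = (-1)ⁿ Ψ w σ`, where `Ψ` is the pullback by `Φ` and `σ = (-1)^(p(p-1)/2)`.

Globally, `d` commutes with `L` because `dη` is closed, and it raises the degree by one. Hence it is
a vector of weight one annihilated by `ad L`, and as `Λ` is nilpotent, `d` and `[Λ, d]` span a
two-dimensional representation of `sl₂` (`commute_of_weight_one`). The Weyl element therefore
conjugates `d` into `[Λ, d]` (`weylElement_mul`). Together with `*̄ = (-1)ⁿ Ψ w σ` this
gives `*̄ d^c *̄ = [Λ, d]`, that is `[Λ, d] = -δ^c`, and the other identities follow from it by
conjugation with `Ψ` and by taking brackets with `L` (`kaehler_identities_of_relations`). No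
integrability of `Φ` enters.

For this argument all operators have to act on basic forms. Basic forms are the smooth forms with
`ι_ξ α = 0` and `ι_ξ dα = 0`, by Cartan's formula (`extD_vecCons_of_horizontal`). The Lie derivative
`ι_ξ d` along `ξ` commutes with `L` and with the degree, hence, being of weight zero, with `Λ`
(`KContactStructure.horΛ_lieReeb`); it commutes with `Ψ` by the condition `𝔏_ξ Φ = 0`. Smoothness
of `Λα` is seen by expressing `Λ` in a smooth local frame (`KContactStructure.smooth_Λ`), and
smoothness of `*̄α` from the formula for `*̄`.
-/

open scoped Manifold ContDiff Topology

noncomputable section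

namespace KContact

/-! ### Alternating sums over permutations -/

section AltSum

variable {V : Type*}

/-- The signed sum of a function of `m` vectors over all permutations of its arguments. -/
def altSum {m : ℕ} (F : (Fin m → V) → ℝ) (v : Fin m → V) : ℝ :=
  ∑ s : Equiv.Perm (Fin m), ((Equiv.Perm.sign s : ℤ) : ℝ) * F (v ∘ s)

theorem altSum_comp_perm {m : ℕ} (F : (Fin m → V) → ℝ) (t : Equiv.Perm (Fin m)) (v : Fin m → V) :
    altSum (fun u => F (u ∘ t)) v = ((Equiv.Perm.sign t : ℤ) : ℝ) * altSum F v := by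
  unfold altSum
  rw [Finset.mul_sum]
  refine Fintype.sum_equiv (Equiv.mulRight t) _ _ fun s => ?_
  have h : (((Equiv.Perm.sign t : ℤˣ) : ℤ) : ℝ) * ((Equiv.Perm.sign t : ℤ) : ℝ) = 1 := by
    have := Int.units_mul_self (Equiv.Perm.sign t)
    rw [← Int.cast_mul, ← Units.val_mul, this]
    simp
  simp only [Equiv.coe_mulRight, Equiv.Perm.sign_mul, Units.val_mul, Int.cast_mul]
  rw [Equiv.Perm.coe_mul, ← Function.comp_assoc]
  linear_combination (-((Equiv.Perm.sign s : ℤ) : ℝ) * F ((v ∘ s) ∘ t)) * h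

theorem altSum_sum {m : ℕ} {κ : Type*} (s : Finset κ) (F : κ → (Fin m → V) → ℝ) (v : Fin m → V) :
    altSum (fun u => ∑ k ∈ s, F k u) v = ∑ k ∈ s, altSum (F k) v := by
  unfold altSum
  rw [Finset.sum_comm]
  exact Finset.sum_congr rfl fun _ _ => by rw [Finset.mul_sum]

theorem altSum_const_mul {m : ℕ} (c : ℝ) (F : (Fin m → V) → ℝ) (v : Fin m → V) :
    altSum (fun u => c * F u) v = c * altSum F v := by
  unfold altSum
  rw [Finset.mul_sum]
  exact Finset.sum_congr rfl fun _ _ => by ring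

variable [AddCommGroup V] [Module ℝ V]

theorem altSum_alternating {m : ℕ} (α : V [⋀^Fin m]→ₗ[ℝ] ℝ) (v : Fin m → V) :
    altSum α v = m.factorial * α v := by
  unfold altSum
  have h : ∀ s : Equiv.Perm (Fin m),
      ((Equiv.Perm.sign s : ℤ) : ℝ) * α (v ∘ s) = α v := fun s => by
    rw [α.map_perm, Units.smul_def, zsmul_eq_mul, ← mul_assoc, ← Int.cast_mul, ← Units.val_mul,
      Int.units_mul_self]
    simp
  rw [Finset.sum_congr rfl fun s _ => h s]
  simp [Fintype.card_perm]

/-- The alternating form `θ ∧ α` for a linear functional `θ`. -/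
def wedgeLin {m : ℕ} (θ : V →ₗ[ℝ] ℝ) (α : V [⋀^Fin m]→ₗ[ℝ] ℝ) : V [⋀^Fin (m + 1)]→ₗ[ℝ] ℝ :=
  AlternatingMap.alternatizeUncurryFin (θ.smulRight α)

theorem wedgeLin_apply {m : ℕ} (θ : V →ₗ[ℝ] ℝ) (α : V [⋀^Fin m]→ₗ[ℝ] ℝ) (v : Fin (m + 1) → V) :
    wedgeLin θ α v = ∑ i : Fin (m + 1), (-1) ^ (i : ℕ) * (θ (v i) * α (Fin.removeNth i v)) := by
  simp [wedgeLin, AlternatingMap.alternatizeUncurryFin_apply]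

/-- Moving the `i`-th of `m + 1` vectors to the front is a permutation of sign `(-1)^i`, so
`θ ∧ α` is a signed sum of `m + 1` rearrangements of `θ ⊗ α`. -/
theorem altSum_functional_mul_alternating {m : ℕ} (θ : V →ₗ[ℝ] ℝ) (α : V [⋀^Fin m]→ₗ[ℝ] ℝ)
    (v : Fin (m + 1) → V) :
    altSum (fun u => θ (u 0) * α (Fin.tail u)) v = m.factorial * wedgeLin θ α v := by
  have h : ∀ u : Fin (m + 1) → V, wedgeLin θ α u = ∑ i : Fin (m + 1),
      (-1) ^ (i : ℕ) * (fun w : Fin (m + 1) → V => θ (w 0) * α (Fin.tail w))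
        (u ∘ i.cycleRange.symm) := by
    intro u
    rw [wedgeLin_apply]
    refine Finset.sum_congr rfl fun i _ => ?_
    have h0 : (u ∘ i.cycleRange.symm) 0 = u i := by simp
    have h1 : Fin.tail (u ∘ i.cycleRange.symm) = Fin.removeNth i u := by
      funext j
      simp [Fin.tail, Fin.removeNth]
    simp only [h0, h1]
  have h2 := altSum_alternating (wedgeLin θ α) v
  have h3 : altSum (wedgeLin θ α) v =
      (m + 1) * altSum (fun u => θ (u 0) * α (Fin.tail u)) v := by
    rw [show (⇑(wedgeLin θ α)) = _ from funext h, altSum_sum]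
    simp only [altSum_const_mul]
    rw [Finset.sum_congr rfl fun i _ => by
      rw [altSum_comp_perm (fun w : Fin (m + 1) → V => θ (w 0) * α (Fin.tail w))]]
    have : ∀ i : Fin (m + 1), ((-1 : ℝ) ^ (i : ℕ)) *
        (((Equiv.Perm.sign i.cycleRange.symm : ℤ) : ℝ) *
          altSum (fun u => θ (u 0) * α (Fin.tail u)) v) =
        altSum (fun u => θ (u 0) * α (Fin.tail u)) v := by
      intro i
      rw [Equiv.Perm.sign_symm, Fin.sign_cycleRange, ← mul_assoc]
      push_cast
      rw [← pow_add, Even.neg_one_pow ⟨_, rfl⟩, one_mul]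
    rw [Finset.sum_congr rfl fun i _ => this i]
    simp
  rw [h3, Nat.factorial_succ] at h2
  have h4 : ((m : ℝ) + 1) ≠ 0 := by positivity
  push_cast at h2
  apply mul_left_cancel₀ h4
  rw [h2]; ring

/-- Moving a functional through a partial alternation: `θ ∧ (Alt F) = Alt (θ ⊗ F)`. -/
theorem altSum_functional_mul {m : ℕ} (θ : V →ₗ[ℝ] ℝ) (F : (Fin m → V) → ℝ)
    (α : V [⋀^Fin m]→ₗ[ℝ] ℝ) (h : ∀ u, altSum F u = α u) (v : Fin (m + 1) → V) :
    altSum (fun u => θ (u 0) * F (Fin.tail u)) v = wedgeLin θ α v := by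
  have h1 := altSum_functional_mul_alternating θ α v
  -- Permutations of the last `m` arguments extend to permutations of all `m + 1` that fix `0`.
  have h2 : altSum (fun u => θ (u 0) * α (Fin.tail u)) v =
      m.factorial * altSum (fun u => θ (u 0) * F (Fin.tail u)) v := by
    have e : (fun u : Fin (m + 1) → V => θ (u 0) * α (Fin.tail u)) = fun u =>
        ∑ t : Equiv.Perm (Fin m), ((Equiv.Perm.sign t : ℤ) : ℝ) *
          (fun w : Fin (m + 1) → V => θ (w 0) * F (Fin.tail w))
            (u ∘ Equiv.Perm.decomposeFin.symm (0, t)) := by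
      funext u
      rw [← h, altSum, Finset.mul_sum]
      refine Finset.sum_congr rfl fun t _ => ?_
      have e0 : (u ∘ Equiv.Perm.decomposeFin.symm (0, t)) 0 = u 0 := by simp
      have e1 : Fin.tail (u ∘ Equiv.Perm.decomposeFin.symm (0, t)) = Fin.tail u ∘ t := by
        funext j
        simp [Fin.tail]
      simp only [e0, e1]
      ring
    rw [e, altSum_sum]
    simp only [altSum_const_mul]
    rw [Finset.sum_congr rfl fun i _ => by
      rw [altSum_comp_perm (fun w : Fin (m + 1) → V => θ (w 0) * F (Fin.tail w))]]
    have : ∀ t : Equiv.Perm (Fin m), ((Equiv.Perm.sign t : ℤ) : ℝ) *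
        (((Equiv.Perm.sign (Equiv.Perm.decomposeFin.symm (0, t)) : ℤ) : ℝ) *
          altSum (fun u => θ (u 0) * F (Fin.tail u)) v) =
        altSum (fun u => θ (u 0) * F (Fin.tail u)) v := by
      intro t
      rw [Equiv.Perm.decomposeFin.symm_sign, if_pos rfl, one_mul, ← mul_assoc, ← Int.cast_mul,
        ← Units.val_mul, Int.units_mul_self]
      simp
    rw [Finset.sum_congr rfl fun i _ => this i]
    simp [Fintype.card_perm]
  rw [h2] at h1
  exact mul_left_cancel₀ (by positivity) h1

end AltSum

/-! ### Contractions and exterior multiplication by `1`-forms -/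

section Linear

variable {V : Type*} [AddCommGroup V] [Module ℝ V] [TopologicalSpace V]

open KContactStructure

/-- The linear functional underlying a `1`-form. -/
def toFunctional (θ : V [⋀^Fin 1]→L[ℝ] ℝ) : V →ₗ[ℝ] ℝ where
  toFun v := θ ![v]
  map_add' := form1_add θ
  map_smul' := form1_smul θ

@[simp] theorem toFunctional_apply (θ : V [⋀^Fin 1]→L[ℝ] ℝ) (v : V) :
    toFunctional θ v = θ ![v] := rfl

/-- The interior product `ι_X α = α(X, ·)`. -/
def interior {p : ℕ} (X : V) (α : V [⋀^Fin (p + 1)]→L[ℝ] ℝ) : V [⋀^Fin p]→L[ℝ] ℝ :=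
  { α.toAlternatingMap.curryLeft X with
    cont := α.cont.comp (continuous_pi fun i => Fin.cases continuous_const
      (fun j => continuous_apply j) i) }

@[simp] theorem interior_apply {p : ℕ} (X : V) (α : V [⋀^Fin (p + 1)]→L[ℝ] ℝ) (v : Fin p → V) :
    interior X α v = α (Matrix.vecCons X v) := rfl

/-- Exterior multiplication `θ ∧ α` by a `1`-form on the left. -/
def wedgeOne {p : ℕ} (θ : V [⋀^Fin 1]→L[ℝ] ℝ) (α : V [⋀^Fin p]→L[ℝ] ℝ) :
    V [⋀^Fin (p + 1)]→L[ℝ] ℝ :=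
  { wedgeLin (toFunctional θ) α.toAlternatingMap with
    cont := by
      change Continuous (wedgeLin (toFunctional θ) α.toAlternatingMap)
      simp only [funext (wedgeLin_apply (toFunctional θ) α.toAlternatingMap), toFunctional_apply]
      refine continuous_finsetSum _ fun i _ => continuous_const.mul ((θ.cont.comp ?_).mul
        (α.cont.comp ?_))
      · refine continuous_pi fun j => ?_
        rw [Subsingleton.elim j 0]
        exact continuous_apply i
      · exact continuous_pi fun j => continuous_apply _ }

theorem wedgeOne_apply {p : ℕ} (θ : V [⋀^Fin 1]→L[ℝ] ℝ) (α : V [⋀^Fin p]→L[ℝ] ℝ)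
    (v : Fin (p + 1) → V) :
    wedgeOne θ α v =
      ∑ i : Fin (p + 1), (-1) ^ (i : ℕ) * (θ ![v i] * α (Fin.removeNth i v)) :=
  wedgeLin_apply _ _ v

theorem wedge_apply {p q : ℕ} (α : V [⋀^Fin p]→L[ℝ] ℝ) (β : V [⋀^Fin q]→L[ℝ] ℝ)
    (v : Fin (p + q) → V) :
    wedge α β v = ((p.factorial * q.factorial : ℝ)⁻¹) *
      altSum (fun u => α (fun i => u (Fin.castAdd q i)) * β (fun j => u (Fin.natAdd p j))) v := by
  unfold wedge altSum
  rw [ContinuousAlternatingMap.smul_apply, smul_eq_mul,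
    ContinuousMultilinearMap.alternatization_apply_apply]
  congr 1
  refine Finset.sum_congr rfl fun s _ => ?_
  rw [Units.smul_def, zsmul_eq_mul]
  rfl

theorem wedge_oneForm_left {p : ℕ} (θ : V [⋀^Fin 1]→L[ℝ] ℝ) (α : V [⋀^Fin p]→L[ℝ] ℝ)
    (v : Fin (1 + p) → V) :
    wedge θ α v = wedgeOne θ α (v ∘ Fin.cast (Nat.add_comm p 1)) := by
  rw [wedge_apply]
  have h : ∀ {m : ℕ} (hm : p + 1 = m) (F : (Fin m → V) → ℝ) (u : Fin m → V),
      altSum F u = altSum (fun w : Fin (p + 1) → V => F (w ∘ Fin.cast hm.symm))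
        (u ∘ Fin.cast hm) := by
    intro m hm F u
    subst hm
    rfl
  rw [h (Nat.add_comm p 1)]
  have e : (fun w : Fin (p + 1) → V =>
      (fun u : Fin (1 + p) → V => θ (fun i => u (Fin.castAdd p i)) *
        α (fun j => u (Fin.natAdd 1 j))) (w ∘ Fin.cast (Nat.add_comm p 1).symm)) =
      fun w => toFunctional θ (w 0) * α.toAlternatingMap (Fin.tail w) := by
    funext w
    have e1 : (fun i : Fin 1 => (w ∘ Fin.cast (Nat.add_comm p 1).symm) (Fin.castAdd p i)) =
        ![w 0] := by
      funext i
      rw [Subsingleton.elim i 0]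
      rfl
    have e2 : (fun j : Fin p => (w ∘ Fin.cast (Nat.add_comm p 1).symm) (Fin.natAdd 1 j)) =
        Fin.tail w := by
      funext j
      refine congrArg w ?_
      ext
      simp
    simp only [e1, e2]
    rfl
  rw [e, altSum_functional_mul_alternating]
  have : (p.factorial : ℝ) ≠ 0 := by positivity
  simp only [Nat.factorial_one, Nat.cast_one, one_mul]
  rw [← mul_assoc, inv_mul_cancel₀ this, one_mul]
  rfl

/-- Right multiplication by a `2`-form, in terms of left multiplications by `1`-forms, using a
resolution `v = ∑ₖ θₖ(v) eₖ` of the identity. -/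
theorem wedge_twoForm_right {p : ℕ} {κ : Type*} [Fintype κ] (e : κ → V)
    (θ : κ → V [⋀^Fin 1]→L[ℝ] ℝ) (he : ∀ v, v = ∑ k, θ k ![v] • e k)
    (α : V [⋀^Fin p]→L[ℝ] ℝ) (Ω : V [⋀^Fin 2]→L[ℝ] ℝ) :
    wedge α Ω = (2 : ℝ)⁻¹ • ∑ k, wedgeOne (θ k) (wedgeOne (interior (e k) Ω) α) := by
  ext v
  rw [wedge_apply]
  have hω : ∀ a b, Ω ![a, b] = ∑ k, θ k ![a] * Ω ![e k, b] := by
    intro a b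
    have : toFunctional (interior b Ω) a = ∑ k, θ k ![a] * toFunctional (interior b Ω) (e k) := by
      conv_lhs => rw [he a]
      simp
    have s : ∀ x y : V, toFunctional (interior x Ω) y = Ω ![x, y] := fun _ _ => rfl
    simp only [s] at this
    rw [form2_swap, this, ← Finset.sum_neg_distrib]
    exact Finset.sum_congr rfl fun k _ => by rw [form2_swap Ω (e k) b]; ring
  -- The last two arguments are moved to the front by the square of a cycle, which is even.
  have hrot : (fun u : Fin (p + 2) → V => α (fun i => u (Fin.castAdd 2 i)) *
      Ω (fun j => u (Fin.natAdd p j))) = fun u =>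
      (fun w : Fin (p + 2) → V => ∑ k, toFunctional (θ k) (w 0) *
        (toFunctional (interior (e k) Ω) (Fin.tail w 0) *
          α.toAlternatingMap (Fin.tail (Fin.tail w))))
      (u ∘ ((finRotate (p + 2)).symm ^ 2 : Equiv.Perm (Fin (p + 2)))) := by
    funext u
    have hr : ∀ i j : Fin (p + 2), finRotate (p + 2) (finRotate (p + 2) j) = i →
        ((finRotate (p + 2)).symm ^ 2 : Equiv.Perm (Fin (p + 2))) i = j := by
      rintro i j rfl
      simp [pow_two]
    have l0 : finRotate (p + 2) (Fin.last (p + 1)) = 0 := finRotate_last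
    have l1 : ∀ k (hk : k < p + 1), finRotate (p + 2) ⟨k, by omega⟩ = ⟨k + 1, by omega⟩ :=
      fun k hk => finRotate_of_lt hk
    have r0 : (((finRotate (p + 2)).symm ^ 2 : Equiv.Perm (Fin (p + 2)))) 0 =
        Fin.natAdd p (0 : Fin 2) :=
      hr _ _ ((congrArg _ (l1 p (by omega))).trans l0)
    have r1 : (((finRotate (p + 2)).symm ^ 2 : Equiv.Perm (Fin (p + 2)))) 1 =
        Fin.natAdd p (1 : Fin 2) :=
      hr _ _ ((congrArg _ l0).trans (l1 0 (by omega)))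
    have r2 : ∀ i : Fin p, (((finRotate (p + 2)).symm ^ 2 : Equiv.Perm (Fin (p + 2))))
        i.succ.succ = Fin.castAdd 2 i := fun i =>
      hr _ _ ((congrArg _ (l1 i (by omega))).trans (l1 (i + 1) (by omega)))
    have t : Fin.tail (Fin.tail
        (u ∘ ((finRotate (p + 2)).symm ^ 2 : Equiv.Perm (Fin (p + 2))))) =
        fun i => u (Fin.castAdd 2 i) := by
      funext i
      exact congrArg u (r2 i)
    have hω' : Ω (fun j => u (Fin.natAdd p j)) =
        ∑ k, θ k ![u (Fin.natAdd p 0)] * Ω ![e k, u (Fin.natAdd p 1)] := by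
      rw [← hω]
      congr 1
      funext j
      fin_cases j <;> rfl
    have a0 : (u ∘ ((finRotate (p + 2)).symm ^ 2 : Equiv.Perm (Fin (p + 2)))) 0 =
        u (Fin.natAdd p 0) := congrArg u r0
    have a1 : Fin.tail (u ∘ ((finRotate (p + 2)).symm ^ 2 : Equiv.Perm (Fin (p + 2)))) 0 =
        u (Fin.natAdd p 1) := congrArg u r1
    simp only [a0, a1, t]
    rw [hω', Finset.mul_sum]
    refine Finset.sum_congr rfl fun k _ => ?_
    simp only [toFunctional_apply, interior_apply]
    rw [mul_left_comm, mul_comm (α _)]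
    rfl
  rw [hrot, altSum_comp_perm (fun w : Fin (p + 2) → V => ∑ k, toFunctional (θ k) (w 0) *
    (toFunctional (interior (e k) Ω) (Fin.tail w 0) *
      α.toAlternatingMap (Fin.tail (Fin.tail w)))), altSum_sum, map_pow, Equiv.Perm.sign_symm]
  have hs : ((((Equiv.Perm.sign (finRotate (p + 2))) ^ 2 : ℤˣ) : ℤ) : ℝ) = 1 := by
    rw [Int.units_sq]
    simp
  rw [hs, one_mul]
  have h1 : ∀ k, altSum (fun w : Fin (p + 2) → V => toFunctional (θ k) (w 0) *
        (toFunctional (interior (e k) Ω) (Fin.tail w 0) *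
          α.toAlternatingMap (Fin.tail (Fin.tail w)))) v =
      p.factorial * wedgeOne (θ k) (wedgeOne (interior (e k) Ω) α) v := by
    intro k
    rw [altSum_functional_mul (toFunctional (θ k))
      (fun w : Fin (p + 1) → V => toFunctional (interior (e k) Ω) (w 0) *
          α.toAlternatingMap (Fin.tail w))
      ((p.factorial : ℝ) • wedgeLin (toFunctional (interior (e k) Ω)) α.toAlternatingMap)
      (fun u => by rw [altSum_functional_mul_alternating]; rfl), wedgeLin_apply, wedgeOne_apply,
      Finset.mul_sum]
    refine Finset.sum_congr rfl fun i _ => ?_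
    rw [AlternatingMap.smul_apply, smul_eq_mul]
    change _ = _ * (_ * (_ * wedgeLin (toFunctional (interior (e k) Ω)) α.toAlternatingMap _))
    rw [toFunctional_apply]
    ring
  rw [Finset.sum_congr rfl fun k _ => h1 k, ContinuousAlternatingMap.smul_apply,
    ContinuousAlternatingMap.sum_apply, ← Finset.mul_sum, smul_eq_mul, ← mul_assoc]
  congr 1
  have : (p.factorial : ℝ) ≠ 0 := by positivity
  simp only [Nat.factorial_two, Nat.cast_ofNat]
  field_simp

end Linear

theorem wedge_compContinuousLinearMap {V W : Type*} [AddCommGroup V] [Module ℝ V]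
    [TopologicalSpace V] [AddCommGroup W] [Module ℝ W] [TopologicalSpace W] {p q : ℕ}
    (A : V →L[ℝ] W) (α : W [⋀^Fin p]→L[ℝ] ℝ) (β : W [⋀^Fin q]→L[ℝ] ℝ) :
    (wedge α β).compContinuousLinearMap A =
      wedge (α.compContinuousLinearMap A) (β.compContinuousLinearMap A) := by
  ext v
  rw [ContinuousAlternatingMap.compContinuousLinearMap_apply, wedge_apply, wedge_apply]
  rfl

/-! ### Operators on the exterior algebra of a vector space -/

section Operators

open KContactStructure

variable {V : Type*} [AddCommGroup V] [Module ℝ V] [TopologicalSpace V]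

/-- Inhomogeneous alternating forms on `V`: one form in each degree. -/
def ExtAlg (V : Type*) [AddCommGroup V] [Module ℝ V] [TopologicalSpace V] : Type _ :=
  ∀ p : ℕ, V [⋀^Fin p]→L[ℝ] ℝ

instance : AddCommGroup (ExtAlg V) :=
  inferInstanceAs (AddCommGroup (∀ p : ℕ, V [⋀^Fin p]→L[ℝ] ℝ))

instance : Module ℝ (ExtAlg V) := inferInstanceAs (Module ℝ (∀ p : ℕ, V [⋀^Fin p]→L[ℝ] ℝ))

namespace ExtAlg

@[ext] theorem ext {α β : ExtAlg V} (h : ∀ p, α p = β p) : α = β := funext h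

@[simp] theorem add_apply (α β : ExtAlg V) (p : ℕ) : (α + β) p = α p + β p := rfl

@[simp] theorem sub_apply (α β : ExtAlg V) (p : ℕ) : (α - β) p = α p - β p := rfl

@[simp] theorem neg_apply (α : ExtAlg V) (p : ℕ) : (-α) p = -α p := rfl

@[simp] theorem zero_apply (p : ℕ) : (0 : ExtAlg V) p = 0 := rfl

@[simp] theorem smul_apply (c : ℝ) (α : ExtAlg V) (p : ℕ) : (c • α) p = c • α p := rfl

@[simp] theorem sum_apply {κ : Type*} (s : Finset κ) (α : κ → ExtAlg V) (p : ℕ) :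
    (∑ k ∈ s, α k) p = ∑ k ∈ s, α k p :=
  Finset.sum_apply p s α

end ExtAlg

/-- The interior product `ι_X` as an operator; it drops the degree `0` component. -/
def iOp : V →ₗ[ℝ] Module.End ℝ (ExtAlg V) where
  toFun X :=
    { toFun := fun α p => interior X (α (p + 1))
      map_add' := fun _ _ => rfl
      map_smul' := fun _ _ => rfl }
  map_add' X Y := by
    refine LinearMap.ext fun α => ExtAlg.ext fun p => ?_
    ext v
    exact congrArg (fun γ => γ v) ((α (p + 1)).toAlternatingMap.curryLeft.map_add X Y)
  map_smul' c X := by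
    refine LinearMap.ext fun α => ExtAlg.ext fun p => ?_
    ext v
    exact congrArg (fun γ => γ v) ((α (p + 1)).toAlternatingMap.curryLeft.map_smul c X)

theorem iOp_apply (X : V) (α : ExtAlg V) (p : ℕ) : iOp X α p = interior X (α (p + 1)) := rfl

theorem wedgeOne_add_right {p : ℕ} (θ : V [⋀^Fin 1]→L[ℝ] ℝ) (α β : V [⋀^Fin p]→L[ℝ] ℝ) :
    wedgeOne θ (α + β) = wedgeOne θ α + wedgeOne θ β := by
  ext v
  simp only [wedgeOne_apply, ContinuousAlternatingMap.add_apply, ← Finset.sum_add_distrib]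
  exact Finset.sum_congr rfl fun i _ => by ring

theorem wedgeOne_smul_right {p : ℕ} (θ : V [⋀^Fin 1]→L[ℝ] ℝ) (c : ℝ) (α : V [⋀^Fin p]→L[ℝ] ℝ) :
    wedgeOne θ (c • α) = c • wedgeOne θ α := by
  ext v
  simp only [wedgeOne_apply, ContinuousAlternatingMap.smul_apply, smul_eq_mul, Finset.mul_sum]
  exact Finset.sum_congr rfl fun i _ => by ring

theorem wedgeOne_add_left {p : ℕ} (θ ψ : V [⋀^Fin 1]→L[ℝ] ℝ) (α : V [⋀^Fin p]→L[ℝ] ℝ) :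
    wedgeOne (θ + ψ) α = wedgeOne θ α + wedgeOne ψ α := by
  ext v
  simp only [wedgeOne_apply, ContinuousAlternatingMap.add_apply, ← Finset.sum_add_distrib]
  exact Finset.sum_congr rfl fun i _ => by ring

theorem wedgeOne_smul_left {p : ℕ} (c : ℝ) (θ : V [⋀^Fin 1]→L[ℝ] ℝ) (α : V [⋀^Fin p]→L[ℝ] ℝ) :
    wedgeOne (c • θ) α = c • wedgeOne θ α := by
  ext v
  simp only [wedgeOne_apply, ContinuousAlternatingMap.smul_apply, smul_eq_mul, Finset.mul_sum]
  exact Finset.sum_congr rfl fun i _ => by ring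

theorem wedge_add_left {p q : ℕ} (α β : V [⋀^Fin p]→L[ℝ] ℝ) (γ : V [⋀^Fin q]→L[ℝ] ℝ) :
    wedge (α + β) γ = wedge α γ + wedge β γ := by
  ext v
  simp only [wedge_apply, ContinuousAlternatingMap.add_apply, add_mul, altSum,
    mul_add, Finset.sum_add_distrib]

theorem wedge_smul_left {p q : ℕ} (c : ℝ) (α : V [⋀^Fin p]→L[ℝ] ℝ) (γ : V [⋀^Fin q]→L[ℝ] ℝ) :
    wedge (c • α) γ = c • wedge α γ := by
  ext v
  simp only [wedge_apply, ContinuousAlternatingMap.smul_apply, smul_eq_mul, mul_assoc,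
    altSum_const_mul]
  ring

/-- Exterior multiplication `θ ∧ ·` by a `1`-form on the left, on inhomogeneous forms. -/
def wedgeOneForm (θ : V [⋀^Fin 1]→L[ℝ] ℝ) (α : ExtAlg V) : ExtAlg V
  | 0 => 0
  | p + 1 => wedgeOne θ (α p)

/-- Exterior multiplication `θ ∧ ·` by a `1`-form on the left, as an operator. -/
def wOp : (V [⋀^Fin 1]→L[ℝ] ℝ) →ₗ[ℝ] Module.End ℝ (ExtAlg V) where
  toFun θ :=
    { toFun := wedgeOneForm θ
      map_add' := fun α β => ExtAlg.ext fun p => by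
        cases p with
        | zero => exact (add_zero 0).symm
        | succ p => exact wedgeOne_add_right θ (α p) (β p)
      map_smul' := fun c α => ExtAlg.ext fun p => by
        cases p with
        | zero => exact (smul_zero c).symm
        | succ p => exact wedgeOne_smul_right θ c (α p) }
  map_add' θ ψ := LinearMap.ext fun α => ExtAlg.ext fun p => by
    cases p with
    | zero => exact (add_zero 0).symm
    | succ p => exact wedgeOne_add_left θ ψ (α p)
  map_smul' c θ := LinearMap.ext fun α => ExtAlg.ext fun p => by
    cases p with
    | zero => exact (smul_zero c).symm
    | succ p => exact wedgeOne_smul_left c θ (α p)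

theorem wOp_apply_zero (θ : V [⋀^Fin 1]→L[ℝ] ℝ) (α : ExtAlg V) : wOp θ α 0 = 0 := rfl

theorem wOp_apply_succ (θ : V [⋀^Fin 1]→L[ℝ] ℝ) (α : ExtAlg V) (p : ℕ) :
    wOp θ α (p + 1) = wedgeOne θ (α p) := rfl

/-- The operator that multiplies the degree `p` component by `c p`. -/
def gradeOp (c : ℕ → ℝ) : Module.End ℝ (ExtAlg V) where
  toFun α p := c p • α p
  map_add' α β := ExtAlg.ext fun p => smul_add (c p) (α p) (β p)
  map_smul' r α := ExtAlg.ext fun p => smul_comm (c p) r (α p)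

theorem gradeOp_apply (c : ℕ → ℝ) (α : ExtAlg V) (p : ℕ) : gradeOp c α p = c p • α p := rfl

/-- Exterior multiplication `· ∧ Ω` by a `2`-form on the right, on inhomogeneous forms. -/
def wedgeTwoForm (Ω : V [⋀^Fin 2]→L[ℝ] ℝ) (α : ExtAlg V) : ExtAlg V
  | 0 => 0
  | 1 => 0
  | p + 2 => wedge (α p) Ω

/-- The operator `α ↦ α ∧ Ω` for a `2`-form `Ω`. -/
def lOp (Ω : V [⋀^Fin 2]→L[ℝ] ℝ) : Module.End ℝ (ExtAlg V) where
  toFun := wedgeTwoForm Ω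
  map_add' α β := ExtAlg.ext fun p => by
    match p with
    | 0 => exact (add_zero 0).symm
    | 1 => exact (add_zero 0).symm
    | p + 2 => exact wedge_add_left (α p) (β p) Ω
  map_smul' c α := ExtAlg.ext fun p => by
    match p with
    | 0 => exact (smul_zero c).symm
    | 1 => exact (smul_zero c).symm
    | p + 2 => exact wedge_smul_left c (α p) Ω

theorem lOp_apply_zero (Ω : V [⋀^Fin 2]→L[ℝ] ℝ) (α : ExtAlg V) : lOp Ω α 0 = 0 := rfl

theorem lOp_apply_one (Ω : V [⋀^Fin 2]→L[ℝ] ℝ) (α : ExtAlg V) : lOp Ω α 1 = 0 := rfl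

theorem lOp_apply_add_two (Ω : V [⋀^Fin 2]→L[ℝ] ℝ) (α : ExtAlg V) (p : ℕ) :
    lOp Ω α (p + 2) = wedge (α p) Ω := rfl

/-- The pullback of forms under an endomorphism of `V`. -/
def pullOp (A : V →L[ℝ] V) : Module.End ℝ (ExtAlg V) where
  toFun α p := (α p).compContinuousLinearMap A
  map_add' _ _ := rfl
  map_smul' _ _ := rfl

theorem pullOp_apply (A : V →L[ℝ] V) (α : ExtAlg V) (p : ℕ) :
    pullOp A α p = (α p).compContinuousLinearMap A := rfl

/-- The constant `1`, as an inhomogeneous form concentrated in degree `0`. -/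
def unitForm : ExtAlg V
  | 0 => ContinuousAlternatingMap.constOfIsEmpty ℝ V (Fin 0) 1
  | _ + 1 => 0

/-! ### Commutation relations -/

theorem gradeOp_mul (c d : ℕ → ℝ) :
    (gradeOp c * gradeOp d : Module.End ℝ (ExtAlg V)) = gradeOp (c * d) := by
  ext α p v
  simp [gradeOp_apply, mul_assoc]

theorem gradeOp_one : (gradeOp 1 : Module.End ℝ (ExtAlg V)) = 1 := by
  ext α p v
  simp [gradeOp_apply]

theorem iOp_gradeOp (X : V) (c : ℕ → ℝ) :
    iOp X * gradeOp c = gradeOp (fun p => c (p + 1)) * iOp X := by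
  rfl

theorem gradeOp_wOp (θ : V [⋀^Fin 1]→L[ℝ] ℝ) (c : ℕ → ℝ) :
    gradeOp c * wOp θ = wOp θ * gradeOp (fun p => c (p + 1)) := by
  refine LinearMap.ext fun α => ExtAlg.ext fun p => ?_
  cases p with
  | zero => simp [gradeOp_apply, wOp_apply_zero]
  | succ p =>
    ext v
    simp only [Module.End.mul_apply, gradeOp_apply, wOp_apply_succ,
      ContinuousAlternatingMap.smul_apply, wedgeOne_apply, smul_eq_mul, Finset.mul_sum]
    exact Finset.sum_congr rfl fun i _ => by ring

theorem gradeOp_lOp (Ω : V [⋀^Fin 2]→L[ℝ] ℝ) (c : ℕ → ℝ) :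
    gradeOp c * lOp Ω = lOp Ω * gradeOp (fun p => c (p + 2)) := by
  refine LinearMap.ext fun α => ExtAlg.ext fun p => ?_
  match p with
  | 0 => simp [gradeOp_apply, lOp_apply_zero]
  | 1 => simp [gradeOp_apply, lOp_apply_one]
  | p + 2 =>
    simp only [Module.End.mul_apply, gradeOp_apply, lOp_apply_add_two, wedge_smul_left]

theorem pullOp_gradeOp (A : V →L[ℝ] V) (c : ℕ → ℝ) :
    pullOp A * gradeOp c = gradeOp c * pullOp A := rfl

theorem iOp_pullOp (A : V →L[ℝ] V) (X : V) : iOp X * pullOp A = pullOp A * iOp (A X) := by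
  refine LinearMap.ext fun α => ExtAlg.ext fun p => ?_
  ext v
  refine congrArg (α (p + 1)) (funext fun i => ?_)
  cases i using Fin.cases <;> rfl

theorem pullOp_wOp (A : V →L[ℝ] V) (θ : V [⋀^Fin 1]→L[ℝ] ℝ) :
    pullOp A * wOp θ = wOp (θ.compContinuousLinearMap A) * pullOp A := by
  refine LinearMap.ext fun α => ExtAlg.ext fun p => ?_
  cases p with
  | zero => rfl
  | succ p =>
    ext v
    simp only [Module.End.mul_apply, pullOp_apply, wOp_apply_succ,
      ContinuousAlternatingMap.compContinuousLinearMap_apply, wedgeOne_apply]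
    refine Finset.sum_congr rfl fun i _ => ?_
    congr 3
    funext j
    rw [Subsingleton.elim j 0]
    rfl

theorem iOp_iOp (X Y : V) : iOp X * iOp Y = -(iOp Y * iOp X) := by
  refine LinearMap.ext fun α => ExtAlg.ext fun p => ?_
  ext v
  have h := (α (p + 1 + 1)).toAlternatingMap.map_swap (Matrix.vecCons X (Matrix.vecCons Y v))
    (i := 0) (j := 1) (by simp)
  have e : Matrix.vecCons X (Matrix.vecCons Y v) ∘ ⇑(Equiv.swap (0 : Fin (p + 1 + 1)) 1) =
      Matrix.vecCons Y (Matrix.vecCons X v) := by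
    funext i
    refine Fin.cases ?_ (fun j => Fin.cases ?_ (fun k => ?_) j) i
    · rw [Function.comp_apply, Equiv.swap_apply_left]
      rfl
    · rw [Function.comp_apply, Fin.succ_zero_eq_one, Equiv.swap_apply_right]
      rfl
    · rw [Function.comp_apply, Equiv.swap_apply_of_ne_of_ne]
      · rfl
      · exact Fin.succ_ne_zero _
      · rw [← Fin.succ_zero_eq_one]
        exact fun h => Fin.succ_ne_zero _ (Fin.succ_injective _ h)
  rw [e] at h
  exact h

theorem iOp_wOp (X : V) (θ : V [⋀^Fin 1]→L[ℝ] ℝ) :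
    iOp X * wOp θ = θ ![X] • 1 - wOp θ * iOp X := by
  refine LinearMap.ext fun α => ExtAlg.ext fun p => ?_
  cases p with
  | zero =>
    ext v
    simp only [Module.End.mul_apply, LinearMap.sub_apply, LinearMap.smul_apply, iOp_apply,
      wOp_apply_succ, interior_apply, wedgeOne_apply, ExtAlg.sub_apply, wOp_apply_zero, sub_zero,
      ExtAlg.smul_apply, Module.End.one_apply, ContinuousAlternatingMap.smul_apply]
    rw [Fin.sum_univ_one, Subsingleton.elim (Fin.removeNth 0 (Matrix.vecCons X v)) v]
    simp
  | succ p =>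
    ext v
    simp only [Module.End.mul_apply, LinearMap.sub_apply, LinearMap.smul_apply, iOp_apply,
      wOp_apply_succ, interior_apply, wedgeOne_apply, ExtAlg.sub_apply,
      ExtAlg.smul_apply, Module.End.one_apply, ContinuousAlternatingMap.smul_apply,
      ContinuousAlternatingMap.sub_apply]
    rw [Fin.sum_univ_succ, sub_eq_add_neg, ← Finset.sum_neg_distrib]
    congr 1
    · rw [Fin.val_zero, pow_zero, one_mul, smul_eq_mul]
      rfl
    · refine Finset.sum_congr rfl fun i _ => ?_
      have h : Fin.removeNth i.succ (Matrix.vecCons X v) =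
          Matrix.vecCons X (Fin.removeNth i v) := by
        funext j
        cases j using Fin.cases <;> simp [Fin.removeNth]
      rw [h]
      simp [pow_succ]

/-- An operator that vanishes in degree `0` and commutes, up to a scalar, with all contractions
is zero: forms of positive degree are determined by their contractions. -/
theorem eq_zero_of_contractions (Q : Module.End ℝ (ExtAlg V)) (c : ℝ)
    (h0 : ∀ α, Q α 0 = 0) (h : ∀ X, iOp X * Q = c • (Q * iOp X)) : Q = 0 := by
  have key : ∀ p α, Q α p = 0 := by
    intro p
    induction p with
    | zero => exact h0
    | succ p ih =>
      intro α
      ext v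
      have e : v = Matrix.vecCons (v 0) (Fin.tail v) := (Fin.cons_self_tail v).symm
      have h1 := congrArg (fun T => T α p (Fin.tail v)) (h (v 0))
      simp only [Module.End.mul_apply, LinearMap.smul_apply, ExtAlg.smul_apply, ih, smul_zero] at h1
      rw [e]
      exact h1
  exact LinearMap.ext fun α => ExtAlg.ext fun p => key p α

theorem wOp_wOp (θ ψ : V [⋀^Fin 1]→L[ℝ] ℝ) : wOp θ * wOp ψ = -(wOp ψ * wOp θ) := by
  have h := eq_zero_of_contractions (wOp θ * wOp ψ + wOp ψ * wOp θ) 1 (fun α => by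
      simp [wOp_apply_zero]) fun X => by
    rw [one_smul, mul_add, ← mul_assoc, ← mul_assoc, iOp_wOp, iOp_wOp, sub_mul, sub_mul,
      mul_assoc, mul_assoc, iOp_wOp, iOp_wOp]
    simp only [mul_sub, smul_mul_assoc, mul_smul_comm, one_mul, mul_one, add_mul, mul_assoc]
    abel
  exact eq_neg_of_add_eq_zero_left h

section Frame

variable {κ : Type*} [Fintype κ] (e : κ → V) (θ : κ → V [⋀^Fin 1]→L[ℝ] ℝ)
  (he : ∀ v, v = ∑ k, θ k ![v] • e k)
include he

theorem lOp_eq_sum (Ω : V [⋀^Fin 2]→L[ℝ] ℝ) :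
    lOp Ω = (2 : ℝ)⁻¹ • ∑ k, wOp (θ k) * wOp (interior (e k) Ω) := by
  refine LinearMap.ext fun α => ExtAlg.ext fun p => ?_
  match p with
  | 0 => simp [lOp_apply_zero, wOp_apply_zero, LinearMap.sum_apply, ExtAlg.sum_apply]
  | 1 =>
    simp only [lOp_apply_one, LinearMap.smul_apply, LinearMap.sum_apply, ExtAlg.smul_apply,
      ExtAlg.sum_apply, Module.End.mul_apply, wOp_apply_succ, wOp_apply_zero]
    have h : ∀ ψ : V [⋀^Fin 1]→L[ℝ] ℝ, wedgeOne ψ (0 : V [⋀^Fin 0]→L[ℝ] ℝ) = 0 := by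
      intro ψ
      ext v
      simp [wedgeOne_apply]
    simp [h]
  | p + 2 =>
    rw [lOp_apply_add_two, wedge_twoForm_right e θ he]
    simp only [LinearMap.smul_apply, LinearMap.sum_apply, ExtAlg.smul_apply,
      ExtAlg.sum_apply, Module.End.mul_apply, wOp_apply_succ]

theorem oneForm_eq_sum (ψ : V [⋀^Fin 1]→L[ℝ] ℝ) : ψ = ∑ k, ψ ![e k] • θ k := by
  ext v
  have e0 : v = ![v 0] := by
    funext i
    rw [Subsingleton.elim i 0]
    rfl
  have h : toFunctional ψ (v 0) = ∑ k, toFunctional ψ (e k) * θ k ![v 0] := by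
    conv_lhs => rw [he (v 0)]
    simp [mul_comm]
  rw [e0, ContinuousAlternatingMap.sum_apply]
  exact h

theorem iOp_lOp (X : V) (Ω : V [⋀^Fin 2]→L[ℝ] ℝ) :
    iOp X * lOp Ω = lOp Ω * iOp X + wOp (interior X Ω) := by
  have h1 : ∑ k, θ k ![X] • wOp (interior (e k) Ω) = wOp (interior X Ω) := by
    simp only [← map_smul]
    rw [← map_sum]
    congr 1
    ext v
    rw [ContinuousAlternatingMap.sum_apply]
    have e0 : v = ![v 0] := by
      funext i
      rw [Subsingleton.elim i 0]
      rfl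
    have h : toFunctional (interior (v 0) Ω) X =
        ∑ k, θ k ![X] * toFunctional (interior (v 0) Ω) (e k) := by
      conv_lhs => rw [he X]
      simp
    have s : ∀ x y : V, toFunctional (interior x Ω) y = Ω ![x, y] := fun _ _ => rfl
    simp only [s] at h
    rw [e0]
    change ∑ k, θ k ![X] * Ω ![e k, v 0] = Ω ![X, v 0]
    rw [form2_swap Ω X, h, ← Finset.sum_neg_distrib]
    exact Finset.sum_congr rfl fun k _ => by rw [form2_swap Ω (e k)]; ring
  have h2 : ∑ k, interior (e k) Ω ![X] • wOp (θ k) = -wOp (interior X Ω) := by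
    conv_rhs => rw [oneForm_eq_sum e θ he (interior X Ω), map_sum, ← Finset.sum_neg_distrib]
    refine Finset.sum_congr rfl fun k _ => ?_
    rw [map_smul, ← neg_smul]
    congr 1
    exact form2_swap Ω (e k) X
  rw [lOp_eq_sum e θ he Ω, mul_smul_comm, Finset.mul_sum, smul_mul_assoc, Finset.sum_mul]
  have h3 : ∀ k, iOp X * (wOp (θ k) * wOp (interior (e k) Ω)) =
      θ k ![X] • wOp (interior (e k) Ω) - interior (e k) Ω ![X] • wOp (θ k) +
        wOp (θ k) * wOp (interior (e k) Ω) * iOp X := by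
    intro k
    rw [← mul_assoc, iOp_wOp, sub_mul, mul_assoc, iOp_wOp]
    simp only [mul_sub, smul_mul_assoc, mul_smul_comm, one_mul, mul_one, mul_assoc]
    abel
  rw [Finset.sum_congr rfl fun k _ => h3 k, Finset.sum_add_distrib, Finset.sum_sub_distrib, h1, h2,
    smul_add, sub_neg_eq_add, ← two_smul ℝ, smul_smul, inv_mul_cancel₀ two_ne_zero, one_smul,
    add_comm]

theorem lOp_wOp (Ω : V [⋀^Fin 2]→L[ℝ] ℝ) (ψ : V [⋀^Fin 1]→L[ℝ] ℝ) :
    lOp Ω * wOp ψ = wOp ψ * lOp Ω := by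
  have h : ∀ k, wOp (θ k) * wOp (interior (e k) Ω) * wOp ψ =
      wOp ψ * (wOp (θ k) * wOp (interior (e k) Ω)) := by
    intro k
    rw [mul_assoc, wOp_wOp _ ψ, mul_neg, ← mul_assoc, wOp_wOp _ ψ, neg_mul, neg_neg, mul_assoc]
  rw [lOp_eq_sum e θ he Ω, smul_mul_assoc, Finset.sum_mul, mul_smul_comm, Finset.mul_sum,
    Finset.sum_congr rfl fun k _ => h k]

/-- Euler's formula: `∑ₖ θₖ ∧ ι_{eₖ} α = p α` on `p`-forms. -/
theorem sum_wOp_iOp : ∑ k, wOp (θ k) * iOp (e k) = gradeOp (fun p => (p : ℝ)) := by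
  rw [← sub_eq_zero]
  refine eq_zero_of_contractions _ 1 (fun α => ?_) fun X => ?_
  · simp [LinearMap.sum_apply, ExtAlg.sum_apply, wOp_apply_zero, gradeOp_apply]
  · have h : ∀ k, iOp X * (wOp (θ k) * iOp (e k)) =
        iOp (θ k ![X] • e k) + wOp (θ k) * iOp (e k) * iOp X := by
      intro k
      rw [← mul_assoc, iOp_wOp, sub_mul, mul_assoc, iOp_iOp, map_smul]
      simp [mul_assoc]
    have hg : iOp X * gradeOp (fun p => (p : ℝ)) =
        gradeOp (fun p => (p : ℝ)) * iOp X + iOp X := by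
      rw [iOp_gradeOp]
      ext α p v
      simp only [Module.End.mul_apply, gradeOp_apply, LinearMap.add_apply, ExtAlg.add_apply,
        ContinuousAlternatingMap.smul_apply, ContinuousAlternatingMap.add_apply, smul_eq_mul]
      push_cast
      ring
    rw [one_smul, mul_sub, Finset.mul_sum, Finset.sum_congr rfl fun k _ => h k,
      Finset.sum_add_distrib, ← map_sum, ← he X, hg, sub_mul, Finset.sum_mul]
    abel

end Frame

end Operators

/-! ### `sl₂`-triples in associative algebras -/

section SlTwo

variable {R : Type*} [Ring R] [Algebra ℝ R]

/-- The exponential series truncated after the term of degree `N`. -/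
def truncExp (N : ℕ) (a : R) : R := ∑ k ∈ Finset.range (N + 1), ((k.factorial : ℝ)⁻¹) • a ^ k

/-- If `y = [a, x]` commutes with `a`, then `exp(a) x exp(-a) = x + y`. The hypothesis `a ^ N = 0`
makes the truncated series equal to the exponential. -/
theorem truncExp_mul {N : ℕ} {a x y : R} (hN : a ^ N = 0) (hx : a * x = x * a + y)
    (hy : a * y = y * a) : truncExp N a * x = (x + y) * truncExp N a := by
  have hyk : ∀ k : ℕ, a ^ k * y = y * a ^ k := fun k => (show Commute a y from hy).pow_left k
  have hk : ∀ k : ℕ, a ^ (k + 1) * x = x * a ^ (k + 1) + ((k : ℝ) + 1) • (y * a ^ k) := by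
    intro k
    induction k with
    | zero => simp [hx]
    | succ k ih =>
      rw [pow_succ a (k + 1), mul_assoc, hx, mul_add, ← mul_assoc, ih, hyk, add_mul,
        smul_mul_assoc, mul_assoc, mul_assoc, ← pow_succ a k, add_assoc]
      congr 1
      push_cast
      module
  have h1 : truncExp N a = 1 + ∑ k ∈ Finset.range N, (((k + 1).factorial : ℝ)⁻¹) • a ^ (k + 1) := by
    rw [truncExp, Finset.sum_range_succ']
    simp [add_comm]
  have h2 : truncExp N a = ∑ k ∈ Finset.range N, ((k.factorial : ℝ)⁻¹) • a ^ k := by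
    rw [truncExp, Finset.sum_range_succ, hN, smul_zero, add_zero]
  have h3 : ∀ k : ℕ, (((k + 1).factorial : ℝ)⁻¹) • a ^ (k + 1) * x =
      x * ((((k + 1).factorial : ℝ)⁻¹) • a ^ (k + 1)) +
        y * (((k.factorial : ℝ)⁻¹) • a ^ k) := by
    intro k
    rw [smul_mul_assoc, hk, smul_add, mul_smul_comm, mul_smul_comm, smul_smul]
    congr 2
    rw [Nat.factorial_succ]
    have : ((k : ℝ) + 1) ≠ 0 := by positivity
    have : (k.factorial : ℝ) ≠ 0 := by positivity
    push_cast
    field_simp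
  rw [add_mul x y]
  conv_lhs => rw [h1]
  -- The top term of the series vanishes, which absorbs the shift of the index in the `y`-sum.
  conv_rhs => rw [h2]; lhs; rw [← h2, h1]
  rw [add_mul, mul_add, Finset.sum_mul, Finset.sum_congr rfl fun k _ => h3 k,
    Finset.sum_add_distrib, Finset.mul_sum, Finset.mul_sum]
  rw [one_mul, mul_one, add_assoc]

/-- The Weyl element `exp(e) exp(-f) exp(e)`. -/
def weylElement (N : ℕ) (e f : R) : R := truncExp N e * truncExp N (-f) * truncExp N e

section

variable {N : ℕ} {e f x y : R} (he : e ^ N = 0) (hf : f ^ N = 0)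
  (hfx : f * x = x * f) (hex : e * x = x * e + y) (hfy : f * y = y * f + x) (hey : e * y = y * e)
include he hf hfx hex hfy hey

/-- Conjugation by the Weyl element exchanges the two weight vectors `x` and `y` of a
two-dimensional representation. -/
theorem weylElement_mul : weylElement N e f * x = y * weylElement N e f := by
  have hf' : (-f) ^ N = 0 := by rw [neg_pow, hf, mul_zero]
  have h1 := truncExp_mul he hex hey
  have h2 : truncExp N (-f) * (x + y) = (x + y + -x) * truncExp N (-f) :=
    truncExp_mul hf' (by simp only [neg_mul, mul_add, add_mul, mul_neg, hfx, hfy]; abel)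
      (by simp only [neg_mul, mul_neg, hfx])
  have h3 := truncExp_mul (y := 0) he (x := y) (by rw [hey, add_zero]) (by simp)
  rw [weylElement, mul_assoc, h1, ← mul_assoc, mul_assoc (truncExp N e), h2,
    show x + y + -x = y by abel, ← mul_assoc (truncExp N e), h3, add_zero]
  simp only [mul_assoc]

theorem weylElement_mul' : weylElement N e f * y = -(x * weylElement N e f) := by
  have hf' : (-f) ^ N = 0 := by rw [neg_pow, hf, mul_zero]
  have h1 := truncExp_mul (y := 0) he (x := y) (by rw [hey, add_zero]) (by simp)
  have h2 : truncExp N (-f) * y = (y + -x) * truncExp N (-f) :=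
    truncExp_mul hf' (by simp only [neg_mul, mul_neg, hfy]; abel)
      (by simp only [neg_mul, mul_neg, hfx])
  have h3 : truncExp N e * (y + -x) = (y + -x + -y) * truncExp N e :=
    truncExp_mul he (by simp only [mul_add, add_mul, mul_neg, neg_mul, hex, hey]; abel)
      (by simp only [neg_mul, mul_neg, hey])
  rw [weylElement, mul_assoc, h1, add_zero, ← mul_assoc, mul_assoc (truncExp N e), h2,
    ← mul_assoc (truncExp N e), h3, show y + -x + -y = -x by abel]
  simp only [mul_assoc, neg_mul]

end

theorem weylElement_commute {N : ℕ} {e f x : R} (he : e * x = x * e) (hf : f * x = x * f) :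
    weylElement N e f * x = x * weylElement N e f := by
  have h : ∀ a : R, a * x = x * a → Commute (truncExp N a) x := fun a ha => by
    unfold truncExp
    exact Commute.sum_left _ _ _ fun k _ =>
      ((show Commute a x from ha).pow_left k).smul_left _
  have h1 := h e he
  have h2 := h (-f) (by simp only [neg_mul, mul_neg, hf])
  exact (h1.mul_left h2).mul_left h1

section Ad

attribute [local instance] LieRing.ofAssociativeRing

/-- If `x` is killed by `ad e` and has weight `k` for an `sl₂`-triple whose lowering element `f`
is nilpotent, then `ad(f)^(k+1) x = 0`. -/
theorem ad_pow_eq_zero {e f x : R} (k : ℕ) (hex : ⁅e, x⁆ = 0) (hhx : ⁅⁅e, f⁆, x⁆ = (k : ℝ) • x)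
    (hhf : ⁅⁅e, f⁆, f⁆ = (-2 : ℝ) • f) (hf : IsNilpotent f) :
    ((LieAlgebra.ad ℝ R f) ^ (k + 1)) x = 0 := by
  set T : ℕ → R := fun j => ((LieAlgebra.ad ℝ R f) ^ j) x with hT
  have hs : ∀ j, T (j + 1) = ⁅f, T j⁆ := fun j => by
    simp only [hT, pow_succ', Module.End.mul_apply, LieAlgebra.ad_apply]
  have hw : ∀ j, ⁅⁅e, f⁆, T j⁆ = ((k : ℝ) - 2 * j) • T j := by
    intro j
    induction j with
    | zero => simpa [hT] using hhx
    | succ j ih =>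
      rw [hs, leibniz_lie, ih, hhf, smul_lie, lie_smul, ← add_smul]
      congr 1
      push_cast
      ring
  have he : ∀ j, ⁅e, T (j + 1)⁆ = (((j : ℝ) + 1) * (k - j)) • T j := by
    intro j
    induction j with
    | zero =>
      rw [hs, leibniz_lie, hw, show T 0 = x by simp [hT], hex, lie_zero, add_zero]
      simp
    | succ j ih =>
      rw [hs, leibniz_lie, hw, ih, lie_smul, ← hs, ← add_smul]
      congr 1
      push_cast
      ring
  -- Nilpotency of `f` ends the string, and `he` pulls its vanishing back down to `k + 1`.
  obtain ⟨m, hm⟩ : ∃ m, T m = 0 := by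
    obtain ⟨m, hm⟩ := LieAlgebra.ad_nilpotent_of_nilpotent (R := ℝ) hf
    exact ⟨m, by simp only [hT]; rw [hm]; rfl⟩
  have hdown : ∀ d, T (k + 1 + d) = 0 → T (k + 1) = 0 := by
    intro d
    induction d with
    | zero => exact id
    | succ d ih =>
      intro h
      refine ih ?_
      have h1 := he (k + 1 + d)
      rw [show k + 1 + d + 1 = k + 1 + (d + 1) by ring, h, lie_zero] at h1
      refine (smul_eq_zero.mp h1.symm).resolve_left (mul_ne_zero (by positivity) ?_)
      push_cast
      have : (0 : ℝ) ≤ d := by positivity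
      linarith
  refine hdown m ?_
  have hzero : ∀ i, T (m + i) = 0 := by
    intro i
    induction i with
    | zero => exact hm
    | succ i ih => rw [← add_assoc, hs, ih, lie_zero]
  rw [add_comm]
  exact hzero _

variable {e f h x : R} (hf : IsNilpotent f) (hef : e * f - f * e = h)
  (hhf : h * f - f * h = (-2 : ℝ) • f) (hex : e * x = x * e)
include hf hef hhf hex

/-- A vector of weight `0` killed by the raising operator is invariant. -/
theorem commute_of_weight_zero (hx : h * x = x * h) : f * x = x * f := by
  have := ad_pow_eq_zero (e := e) (f := f) (x := x) 0
    (by rw [Ring.lie_def, hex, sub_self])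
    (by simp only [Ring.lie_def, hef]; rw [hx]; simp)
    (by simp only [Ring.lie_def, hef, hhf]) hf
  rw [zero_add, pow_one, LieAlgebra.ad_apply, Ring.lie_def] at this
  exact sub_eq_zero.mp this

/-- A vector of weight `1` killed by the raising operator spans, together with its image under
the lowering operator, a two-dimensional representation. -/
theorem commute_of_weight_one (hx : h * x - x * h = x) :
    f * (f * x - x * f) = (f * x - x * f) * f := by
  have := ad_pow_eq_zero (e := e) (f := f) (x := x) 1
    (by rw [Ring.lie_def, hex, sub_self])
    (by simp only [Ring.lie_def, hef]; rw [hx]; simp)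
    (by simp only [Ring.lie_def, hef, hhf]) hf
  rw [pow_succ, pow_one, Module.End.mul_apply, LieAlgebra.ad_apply, LieAlgebra.ad_apply,
    Ring.lie_def, Ring.lie_def] at this
  exact sub_eq_zero.mp this

end Ad

section Intertwine

variable {U U' : Type*} [AddCommGroup U] [Module ℝ U] [AddCommGroup U'] [Module ℝ U']
  (j : U →ₗ[ℝ] U')

theorem truncExp_intertwine {a : Module.End ℝ U} {b : Module.End ℝ U'}
    (h : ∀ u, j (a u) = b (j u)) (N : ℕ) (u : U) :
    j (truncExp N a u) = truncExp N b (j u) := by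
  have hk : ∀ (k : ℕ) (u : U), j ((a ^ k) u) = (b ^ k) (j u) := by
    intro k
    induction k with
    | zero => intro u; rfl
    | succ k ih => intro u; rw [pow_succ, pow_succ, Module.End.mul_apply, ih, h]; rfl
  simp only [truncExp, LinearMap.sum_apply, LinearMap.smul_apply, map_sum, map_smul, hk]

theorem weylElement_intertwine {a c : Module.End ℝ U} {b d : Module.End ℝ U'}
    (hab : ∀ u, j (a u) = b (j u)) (hcd : ∀ u, j (c u) = d (j u)) (N : ℕ) (u : U) :
    j (weylElement N a c u) = weylElement N b d (j u) := by
  have hcd' : ∀ u, j ((-c) u) = (-d) (j u) := fun u => by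
    rw [LinearMap.neg_apply, LinearMap.neg_apply, map_neg, hcd]
  simp only [weylElement, Module.End.mul_apply, truncExp_intertwine j hab,
    truncExp_intertwine j hcd']

end Intertwine

end SlTwo

/-! ### Linear algebra of a tangent space of a `K`-contact manifold -/

/-- The data that a `K`-contact structure induces on a tangent space, together with an orthonormal
frame `e` of the metric `g(X, Y) = Ω(X, ΦY) + η(X) η(Y)`, where `Ω = dη`. -/
structure ContactModule (n : ℕ) (V : Type*) [AddCommGroup V] [Module ℝ V]
    [TopologicalSpace V] where
  η : V [⋀^Fin 1]→L[ℝ] ℝ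
  ξ : V
  Ω : V [⋀^Fin 2]→L[ℝ] ℝ
  Φ : V →L[ℝ] V
  e : Fin (1 + 2 * n) → V
  η_ξ : η ![ξ] = 1
  Ω_ξ : ∀ X, Ω ![ξ, X] = 0
  Φ_sq : ∀ X, Φ (Φ X) = -X + η ![X] • ξ
  Φ_ξ : Φ ξ = 0
  η_Φ : ∀ X, η ![Φ X] = 0
  Ω_Φ : ∀ X Y, Ω ![Φ X, Φ Y] = Ω ![X, Y]
  orthonormal : ∀ i j, Ω ![e i, Φ (e j)] + η ![e i] * η ![e j] = if i = j then 1 else 0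
  complete : ∀ v, v = ∑ k, (Ω ![e k, Φ v] + η ![e k] * η ![v]) • e k

namespace ContactModule

open KContactStructure

variable {n : ℕ} {V : Type*} [AddCommGroup V] [Module ℝ V] [TopologicalSpace V]
  (D : ContactModule n V)

/-- The `1`-form `g(X, ·)`. -/
def flat (X : V) : V [⋀^Fin 1]→L[ℝ] ℝ := D.η ![X] • D.η - interior (D.Φ X) D.Ω

theorem form1_neg (θ : V [⋀^Fin 1]→L[ℝ] ℝ) (a : V) : θ ![-a] = -θ ![a] := by
  have := form1_smul θ (-1) a
  rwa [neg_one_smul, neg_one_mul] at this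

theorem form2_neg_right (β : V [⋀^Fin 2]→L[ℝ] ℝ) (a b : V) : β ![a, -b] = -β ![a, b] := by
  have := form2_smul_right β (-1) a b
  rwa [neg_one_smul, neg_one_mul] at this

theorem Ω_Φ_right (X Y : V) : D.Ω ![X, D.Φ Y] = -D.Ω ![D.Φ X, Y] := by
  rw [← D.Ω_Φ X, D.Φ_sq, form2_add_right, form2_neg_right, form2_smul_right,
    form2_swap _ _ D.ξ, D.Ω_ξ]
  ring

theorem flat_apply (X Y : V) : D.flat X ![Y] = D.Ω ![X, D.Φ Y] + D.η ![X] * D.η ![Y] := by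
  rw [Ω_Φ_right]
  change D.η ![X] * D.η ![Y] - D.Ω ![D.Φ X, Y] = _
  ring

theorem flat_symm (X Y : V) : D.flat X ![Y] = D.flat Y ![X] := by
  rw [flat_apply, flat_apply, Ω_Φ_right, form2_swap, neg_neg, mul_comm]

theorem flat_e (i j) : D.flat (D.e i) ![D.e j] = if i = j then 1 else 0 := by
  rw [flat_apply, D.orthonormal]

theorem frame (v : V) : v = ∑ k, D.flat (D.e k) ![v] • D.e k := by
  simp only [flat_apply]
  exact D.complete v

theorem interior_Ω (X : V) : interior X D.Ω = D.flat (D.Φ X) := by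
  ext v
  obtain ⟨y, rfl⟩ : ∃ y, v = ![y] := ⟨v 0, by
    funext i
    rw [Subsingleton.elim i 0]
    rfl⟩
  rw [flat_apply, D.η_Φ, D.Ω_Φ]
  change D.Ω ![X, y] = _
  ring

/-- The musical isomorphism `X ↦ g(X, ·)` as a linear map. -/
def flatLin : V →ₗ[ℝ] V [⋀^Fin 1]→L[ℝ] ℝ where
  toFun := D.flat
  map_add' X Y := by
    ext v
    obtain ⟨y, rfl⟩ : ∃ y, v = ![y] := ⟨v 0, by
      funext i
      rw [Subsingleton.elim i 0]
      rfl⟩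
    rw [ContinuousAlternatingMap.add_apply]
    simp only [flat_apply, form1_add, form2_add_left]
    ring
  map_smul' c X := by
    ext v
    obtain ⟨y, rfl⟩ : ∃ y, v = ![y] := ⟨v 0, by
      funext i
      rw [Subsingleton.elim i 0]
      rfl⟩
    rw [ContinuousAlternatingMap.smul_apply]
    simp only [flat_apply, form1_smul, form2_smul_left, RingHom.id_apply, smul_eq_mul]
    ring

theorem flatLin_apply (X : V) : D.flatLin X = D.flat X := rfl

theorem flat_ξ : D.flat D.ξ = D.η := by
  rw [flat, D.η_ξ, one_smul, D.Φ_ξ]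
  have : interior (0 : V) D.Ω = 0 := by
    ext v
    exact D.Ω.map_coord_zero 0 rfl
  rw [this, sub_zero]

theorem flat_Φ_left (X Y : V) : D.flat (D.Φ X) ![Y] = D.Ω ![X, Y] := by
  rw [flat_apply, D.Ω_Φ, D.η_Φ]
  ring

theorem flat_Φ_right (X Y : V) : D.flat X ![D.Φ Y] = -D.Ω ![X, Y] := by
  rw [flat_symm, flat_Φ_left, form2_swap]

theorem flat_ΦΦ (X : V) : D.flat (D.Φ (D.Φ X)) = -D.flat X + D.η ![X] • D.η := by
  rw [D.Φ_sq, ← flatLin_apply, map_add, map_neg, map_smul, flatLin_apply, flatLin_apply, flat_ξ]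

/-- `Φ` is skew-symmetric, so it moves across the sum defining a trace at the cost of a sign. -/
theorem sum_Φ_left {N : Type*} [AddCommGroup N] [Module ℝ N] (B : V →ₗ[ℝ] V →ₗ[ℝ] N) :
    ∑ k, B (D.Φ (D.e k)) (D.e k) = -∑ k, B (D.e k) (D.Φ (D.e k)) := by
  have h1 : ∀ k, B (D.Φ (D.e k)) (D.e k) =
      ∑ j, (-D.Ω ![D.e j, D.e k]) • B (D.e j) (D.e k) := by
    intro k
    conv_lhs => rw [D.frame (D.Φ (D.e k))]
    simp only [map_sum, map_smul, LinearMap.sum_apply, LinearMap.smul_apply, flat_Φ_right]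
  have h2 : ∀ j, B (D.e j) (D.Φ (D.e j)) =
      ∑ k, (D.Ω ![D.e j, D.e k]) • B (D.e j) (D.e k) := by
    intro j
    conv_lhs => rw [D.frame (D.Φ (D.e j))]
    simp only [map_sum, map_smul, flat_Φ_right]
    exact Finset.sum_congr rfl fun k _ => by rw [form2_swap, neg_neg]
  rw [Finset.sum_congr rfl fun k _ => h1 k, Finset.sum_congr rfl fun k _ => h2 k,
    Finset.sum_comm, ← Finset.sum_neg_distrib]
  refine Finset.sum_congr rfl fun j _ => ?_
  rw [← Finset.sum_neg_distrib]
  exact Finset.sum_congr rfl fun k _ => neg_smul _ _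

/-- The Lefschetz operator `α ↦ α ∧ Ω`. -/
def L : Module.End ℝ (ExtAlg V) := lOp D.Ω

/-- The dual Lefschetz operator `α ↦ ½ ∑ₖ α(eₖ, Φ eₖ, ·)`. -/
def Λ : Module.End ℝ (ExtAlg V) := (2 : ℝ)⁻¹ • ∑ k, iOp (D.Φ (D.e k)) * iOp (D.e k)

theorem L_eq : D.L = (2 : ℝ)⁻¹ • ∑ k, wOp (D.flat (D.e k)) * wOp (D.flat (D.Φ (D.e k))) := by
  rw [L, lOp_eq_sum D.e _ D.frame]
  simp only [interior_Ω]

theorem iOp_L (X : V) : iOp X * D.L = D.L * iOp X + wOp (D.flat (D.Φ X)) := by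
  rw [L, iOp_lOp D.e _ D.frame, interior_Ω]

theorem L_wOp (θ : V [⋀^Fin 1]→L[ℝ] ℝ) : D.L * wOp θ = wOp θ * D.L :=
  lOp_wOp D.e _ D.frame _ _

theorem Λ_iOp (X : V) : D.Λ * iOp X = iOp X * D.Λ := by
  have h : ∀ k, iOp (D.Φ (D.e k)) * iOp (D.e k) * iOp X =
      iOp X * (iOp (D.Φ (D.e k)) * iOp (D.e k)) := by
    intro k
    rw [mul_assoc, iOp_iOp _ X, mul_neg, ← mul_assoc, iOp_iOp _ X, neg_mul, neg_neg, mul_assoc]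
  rw [Λ, smul_mul_assoc, Finset.sum_mul, mul_smul_comm, Finset.mul_sum,
    Finset.sum_congr rfl fun k _ => h k]

theorem Λ_wOp (X : V) : D.Λ * wOp (D.flat X) = wOp (D.flat X) * D.Λ + iOp (D.Φ X) := by
  have h : ∀ k, iOp (D.Φ (D.e k)) * iOp (D.e k) * wOp (D.flat X) =
      wOp (D.flat X) * (iOp (D.Φ (D.e k)) * iOp (D.e k)) +
        (iOp (D.Φ (D.flat (D.e k) ![X] • D.e k)) + iOp (D.flat (D.e k) ![D.Φ X] • D.e k)) := by
    intro k
    have h1 : D.flat X ![D.Φ (D.e k)] = -D.flat (D.e k) ![D.Φ X] := by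
      rw [flat_Φ_right, flat_Φ_right, form2_swap]
    rw [mul_assoc, iOp_wOp, mul_sub, ← mul_assoc _ (wOp (D.flat X)), iOp_wOp, h1,
      D.flat_symm X]
    simp only [map_smul, mul_smul_comm, mul_one, sub_mul, smul_mul_assoc, one_mul, neg_smul,
      neg_mul, mul_assoc]
    abel
  rw [Λ, smul_mul_assoc, Finset.sum_mul, mul_smul_comm, Finset.mul_sum,
    Finset.sum_congr rfl fun k _ => h k, Finset.sum_add_distrib, Finset.sum_add_distrib,
    ← map_sum, ← map_sum, ← map_sum, ← D.frame X, ← D.frame (D.Φ X), ← two_smul ℝ, smul_add,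
    smul_smul, inv_mul_cancel₀ two_ne_zero, one_smul]

theorem sum_wOp_flat_iOp :
    ∑ k, wOp (D.flat (D.e k)) * iOp (D.e k) = gradeOp (fun p => (p : ℝ)) :=
  sum_wOp_iOp D.e _ D.frame

theorem sum_η_sq : ∑ k, D.η ![D.e k] * D.η ![D.e k] = 1 := by
  have h : toFunctional D.η D.ξ = ∑ k, D.flat (D.e k) ![D.ξ] * toFunctional D.η (D.e k) := by
    conv_lhs => rw [D.frame D.ξ]
    simp
  simp only [toFunctional_apply, D.flat_symm _ D.ξ, flat_ξ, D.η_ξ] at h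
  exact h.symm

/-- The bilinear map `(X, Y) ↦ g(X, ·) ∧ ι_Y`. -/
def flatInterior : V →ₗ[ℝ] V →ₗ[ℝ] Module.End ℝ (ExtAlg V) :=
  (LinearMap.mul ℝ (Module.End ℝ (ExtAlg V))).compl₁₂ (wOp ∘ₗ D.flatLin) iOp

theorem flatInterior_apply (X Y : V) : D.flatInterior X Y = wOp (D.flat X) * iOp Y := rfl

theorem sum_flatInterior_ξ (X : V) (hX : X = D.ξ) :
    ∑ k, D.η ![D.e k] • D.flatInterior (D.e k) X = D.flatInterior D.ξ X := by
  subst hX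
  have h := congrArg (fun Y => D.flatInterior Y D.ξ) (D.frame D.ξ)
  simp only [map_sum, map_smul, LinearMap.sum_apply, LinearMap.smul_apply, D.flat_symm _ D.ξ,
    flat_ξ] at h
  exact h.symm

theorem sum_flatInterior_ξ' :
    ∑ k, D.η ![D.e k] • D.flatInterior D.ξ (D.e k) = D.flatInterior D.ξ D.ξ := by
  have h := congrArg (fun Y => D.flatInterior D.ξ Y) (D.frame D.ξ)
  simp only [map_sum, map_smul, D.flat_symm _ D.ξ, flat_ξ] at h
  exact h.symm

/-- The `sl₂`-relation. On horizontal forms the last term vanishes, and `[L, Λ]` is multiplication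
by `p - n`. -/
theorem L_Λ : D.L * D.Λ - D.Λ * D.L =
    gradeOp (fun p => (p : ℝ) - n) - wOp D.η * iOp D.ξ := by
  have h : ∀ k, D.L * (iOp (D.Φ (D.e k)) * iOp (D.e k)) =
      iOp (D.Φ (D.e k)) * iOp (D.e k) * D.L +
      ((D.flatInterior (D.e k) (D.e k) - D.η ![D.e k] • D.flatInterior D.ξ (D.e k)) +
      D.flatInterior (D.Φ (D.e k)) (D.Φ (D.e k)) -
        (1 - D.η ![D.e k] * D.η ![D.e k]) • (1 : Module.End ℝ (ExtAlg V))) := by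
    intro k
    have h1 : D.flat (D.Φ (D.e k)) ![D.Φ (D.e k)] = 1 - D.η ![D.e k] * D.η ![D.e k] := by
      have := D.flat_e k k
      rw [if_pos rfl, flat_apply] at this
      rw [flat_Φ_left]
      linarith
    have h2 : ∀ X, D.L * iOp X = iOp X * D.L - wOp (D.flat (D.Φ X)) := fun X => by
      rw [iOp_L]; abel
    have h3 : iOp (D.Φ (D.e k)) * (D.L * iOp (D.e k)) =
        iOp (D.Φ (D.e k)) * (iOp (D.e k) * D.L) -
        ((1 - D.η ![D.e k] * D.η ![D.e k]) • 1 -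
          wOp (D.flat (D.Φ (D.e k))) * iOp (D.Φ (D.e k))) := by
      rw [h2 (D.e k), mul_sub, iOp_wOp, h1]
    rw [← mul_assoc, h2, sub_mul, mul_assoc, h3, flat_ΦΦ, map_add, map_neg, map_smul]
    simp only [flatInterior_apply, flat_ξ, mul_assoc, add_mul, neg_mul, smul_mul_assoc]
    abel
  have h4 : ∑ k, D.flatInterior (D.Φ (D.e k)) (D.Φ (D.e k)) =
      gradeOp (fun p => (p : ℝ)) - wOp D.η * iOp D.ξ := by
    have := D.sum_Φ_left (D.flatInterior.compl₂ (D.Φ : V →ₗ[ℝ] V))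
    simp only [LinearMap.compl₂_apply, ContinuousLinearMap.coe_coe, D.Φ_sq, map_add, map_neg,
      map_smul, Finset.sum_add_distrib, Finset.sum_neg_distrib, D.sum_flatInterior_ξ _ rfl,
      neg_add, neg_neg] at this
    rw [this, ← sum_wOp_flat_iOp]
    simp only [flatInterior_apply, flat_ξ]
    abel
  have h5 : ∑ k : Fin (1 + 2 * n), (1 - D.η ![D.e k] * D.η ![D.e k]) = 2 * n := by
    rw [Finset.sum_sub_distrib, sum_η_sq]
    simp
  rw [Λ, mul_smul_comm, Finset.mul_sum, Finset.sum_congr rfl fun k _ => h k,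
    Finset.sum_add_distrib, Finset.sum_sub_distrib, Finset.sum_add_distrib,
    Finset.sum_sub_distrib, h4, ← Finset.sum_smul, h5, sum_flatInterior_ξ']
  simp only [flatInterior_apply, sum_wOp_flat_iOp, flat_ξ]
  rw [← Finset.sum_mul, smul_mul_assoc]
  have h6 : (gradeOp (fun p => (p : ℝ) - n) : Module.End ℝ (ExtAlg V)) =
      gradeOp (fun p => (p : ℝ)) - (n : ℝ) • 1 := by
    refine LinearMap.ext fun α => ExtAlg.ext fun p => ?_
    simp only [gradeOp_apply, LinearMap.sub_apply, ExtAlg.sub_apply, LinearMap.smul_apply,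
      ExtAlg.smul_apply, Module.End.one_apply]
    exact sub_smul (p : ℝ) (n : ℝ) (α p)
  rw [h6]
  module

/-! ### Horizontal forms -/

/-- The subspace of horizontal forms, those with `ι_ξ α = 0`. -/
def Hor : Submodule ℝ (ExtAlg V) := LinearMap.ker (iOp D.ξ)

theorem mem_Hor {α : ExtAlg V} : α ∈ D.Hor ↔ iOp D.ξ α = 0 := LinearMap.mem_ker

theorem L_mem_Hor {α : ExtAlg V} (h : α ∈ D.Hor) : D.L α ∈ D.Hor := by
  rw [mem_Hor] at *
  have h1 := congrArg (fun T => T α) (D.iOp_L D.ξ)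
  simp only [Module.End.mul_apply, LinearMap.add_apply, h, map_zero, D.Φ_ξ, zero_add] at h1
  rw [h1, ← flatLin_apply, map_zero, map_zero, LinearMap.zero_apply]

theorem Λ_mem_Hor {α : ExtAlg V} (h : α ∈ D.Hor) : D.Λ α ∈ D.Hor := by
  rw [mem_Hor] at *
  have h1 := congrArg (fun T => T α) (D.Λ_iOp D.ξ)
  simp only [Module.End.mul_apply, h, map_zero] at h1
  exact h1.symm

theorem gradeOp_mem_Hor {α : ExtAlg V} (h : α ∈ D.Hor) (c : ℕ → ℝ) : gradeOp c α ∈ D.Hor := by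
  rw [mem_Hor] at *
  rw [← Module.End.mul_apply, iOp_gradeOp, Module.End.mul_apply, h, map_zero]

theorem iOp_mem_Hor {α : ExtAlg V} (h : α ∈ D.Hor) (X : V) : iOp X α ∈ D.Hor := by
  rw [mem_Hor] at *
  rw [← Module.End.mul_apply, iOp_iOp, LinearMap.neg_apply, Module.End.mul_apply, h, map_zero,
    neg_zero]

theorem pullOp_mem_Hor (α : ExtAlg V) : pullOp D.Φ α ∈ D.Hor := by
  rw [mem_Hor, ← Module.End.mul_apply, iOp_pullOp, D.Φ_ξ, map_zero, mul_zero,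
    LinearMap.zero_apply]

theorem unitForm_mem_Hor : (unitForm : ExtAlg V) ∈ D.Hor := rfl

theorem iOp_unitForm (X : V) : iOp X (unitForm : ExtAlg V) = 0 := rfl

theorem gradeOp_unitForm (c : ℕ → ℝ) : gradeOp c (unitForm : ExtAlg V) = c 0 • unitForm := by
  refine ExtAlg.ext fun p => ?_
  cases p with
  | zero => rfl
  | succ p =>
    have h : (unitForm : ExtAlg V) (p + 1) = 0 := rfl
    rw [gradeOp_apply, ExtAlg.smul_apply, h, smul_zero, smul_zero]

theorem pullOp_unitForm (A : V →L[ℝ] V) : pullOp A (unitForm : ExtAlg V) = unitForm := by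
  refine ExtAlg.ext fun p => ?_
  cases p with
  | zero => rfl
  | succ p => rfl

/-! ### Vanishing in large degrees -/

include D in
theorem form_eq_zero {p : ℕ} (hp : 2 * n + 1 < p) (α : V [⋀^Fin p]→L[ℝ] ℝ) : α = 0 := by
  ext v
  refine α.toAlternatingMap.map_linearDependent v fun hv => ?_
  have hs : Submodule.span ℝ (Set.range D.e) = ⊤ := by
    rw [eq_top_iff]
    intro v _
    rw [D.frame v]
    exact Submodule.sum_mem _ fun k _ =>
      Submodule.smul_mem _ _ (Submodule.subset_span (Set.mem_range_self k))
  have hfin : Module.Finite ℝ V :=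
    ⟨⟨(Set.finite_range D.e).toFinset, by simpa using hs⟩⟩
  have h1 := hv.fintype_card_le_finrank
  have h2 : Module.finrank ℝ V ≤ 1 + 2 * n := by
    have := finrank_range_le_card (R := ℝ) D.e
    rw [Set.finrank, hs, finrank_top] at this
    simpa using this
  simp only [Fintype.card_fin] at h1
  omega

/-- As `α = ι_ξ(η ∧ α)` for a horizontal form, its degree is at most `2n`. -/
theorem apply_eq_zero_of_mem_Hor {α : ExtAlg V} (h : α ∈ D.Hor) {p : ℕ} (hp : 2 * n < p) :
    α p = 0 := by
  rw [mem_Hor] at h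
  have h1 := congrArg (fun T => T α p) (iOp_wOp D.ξ D.η)
  simp only [Module.End.mul_apply, LinearMap.sub_apply,
    Module.End.one_apply, h, map_zero, sub_zero, D.η_ξ, one_smul] at h1
  rw [← h1, iOp_apply, D.form_eq_zero (by omega) (wOp D.η α (p + 1))]
  rfl

theorem L_pow_apply (k : ℕ) (α : ExtAlg V) : ∀ p, p < 2 * k → (D.L ^ k) α p = 0 := by
  induction k with
  | zero => intro p hp; omega
  | succ k ih =>
    intro p hp
    rw [pow_succ', Module.End.mul_apply]
    match p with
    | 0 => rfl
    | 1 => rfl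
    | p + 2 =>
      rw [L, lOp_apply_add_two]
      have := ih p (by omega)
      rw [L] at this
      rw [this]
      simpa using wedge_smul_left (0 : ℝ) (0 : V [⋀^Fin p]→L[ℝ] ℝ) D.Ω

theorem Λ_apply (α : ExtAlg V) (p : ℕ) :
    D.Λ α p = (2 : ℝ)⁻¹ • ∑ k, interior (D.Φ (D.e k)) (interior (D.e k) (α (p + 2))) := by
  simp only [Λ, LinearMap.smul_apply, ExtAlg.smul_apply, LinearMap.sum_apply, ExtAlg.sum_apply,
    Module.End.mul_apply, iOp_apply]

theorem Λ_pow_apply (k : ℕ) (α : ExtAlg V) :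
    ∀ p, (∀ q, p + 2 * k ≤ q → α q = 0) → (D.Λ ^ k) α p = 0 := by
  induction k with
  | zero => intro p h; exact h p (by omega)
  | succ k ih =>
    intro p h
    rw [pow_succ', Module.End.mul_apply, Λ_apply, ih (p + 2) fun q hq => h q (by omega)]
    have h0 : ∀ X Y : V, interior Y (interior X (0 : V [⋀^Fin (p + 2)]→L[ℝ] ℝ)) = 0 :=
      fun X Y => rfl
    simp [h0]

theorem L_nilpotent : D.L ^ (n + 1) = 0 := by
  refine LinearMap.ext fun α => ExtAlg.ext fun p => ?_
  by_cases hp : p < 2 * (n + 1)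
  · exact D.L_pow_apply _ _ _ hp
  · exact D.form_eq_zero (by omega) _

theorem Λ_nilpotent : D.Λ ^ (n + 1) = 0 :=
  LinearMap.ext fun α => ExtAlg.ext fun p =>
    D.Λ_pow_apply _ _ _ fun q hq => D.form_eq_zero (by omega) _

theorem Λ_unitForm : D.Λ (unitForm : ExtAlg V) = 0 :=
  ExtAlg.ext fun p => by
    rw [Λ_apply]
    have h0 : ∀ X Y : V, interior Y (interior X ((unitForm : ExtAlg V) (p + 2))) = 0 :=
      fun X Y => rfl
    simp [h0]

theorem Λ_gradeOp (c : ℕ → ℝ) : D.Λ * gradeOp c = gradeOp (fun p => c (p + 2)) * D.Λ := by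
  have h : ∀ X Y : V, iOp X * iOp Y * gradeOp c =
      gradeOp (fun p => c (p + 2)) * (iOp X * iOp Y) := by
    intro X Y
    rw [mul_assoc, iOp_gradeOp, ← mul_assoc, iOp_gradeOp, mul_assoc]
  rw [Λ, smul_mul_assoc, Finset.sum_mul, mul_smul_comm, Finset.mul_sum]
  simp only [h]

theorem L_Λ_apply {α : ExtAlg V} (hα : α ∈ D.Hor) :
    D.L (D.Λ α) - D.Λ (D.L α) = gradeOp (fun p => (p : ℝ) - n) α := by
  have h := congrArg (fun T => T α) D.L_Λ
  simp only [LinearMap.sub_apply, Module.End.mul_apply, D.mem_Hor.mp hα, map_zero, sub_zero] at h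
  exact h

theorem gradeOp_Λ_apply (α : ExtAlg V) :
    gradeOp (fun p => (p : ℝ) - n) (D.Λ α) - D.Λ (gradeOp (fun p => (p : ℝ) - n) α) =
      (-2 : ℝ) • D.Λ α := by
  rw [← Module.End.mul_apply D.Λ, D.Λ_gradeOp, Module.End.mul_apply]
  refine ExtAlg.ext fun p => ?_
  rw [ExtAlg.sub_apply, gradeOp_apply, gradeOp_apply, ExtAlg.smul_apply]
  push_cast
  module

/-! ### Horizontal forms are generated by `1` -/

/-- The component of a vector orthogonal to `ξ`. -/
def horProj (X : V) : V := X - D.η ![X] • D.ξ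

theorem η_horProj (X : V) : D.η ![D.horProj X] = 0 := by
  rw [horProj, sub_eq_add_neg, form1_add, form1_neg, form1_smul, D.η_ξ]
  ring

theorem flat_horProj (X : V) : D.flat (D.horProj X) = D.flat X - D.η ![X] • D.η := by
  rw [horProj, ← flatLin_apply, map_sub, map_smul, flatLin_apply, flatLin_apply, flat_ξ]

/-- Euler's formula for horizontal forms. -/
theorem gradeOp_eq_of_mem_Hor {α : ExtAlg V} (h : α ∈ D.Hor) :
    gradeOp (fun p => (p : ℝ)) α = ∑ k, wOp (D.flat (D.horProj (D.e k))) (iOp (D.e k) α) := by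
  have h1 : ∀ k, wOp (D.flat (D.horProj (D.e k))) (iOp (D.e k) α) =
      (wOp (D.flat (D.e k)) * iOp (D.e k)) α -
        (D.η ![D.e k] • D.flatInterior D.ξ (D.e k)) α := by
    intro k
    rw [flat_horProj, map_sub, map_smul, flatInterior_apply, flat_ξ]
    rfl
  rw [Finset.sum_congr rfl fun k _ => h1 k, Finset.sum_sub_distrib, ← LinearMap.sum_apply,
    ← LinearMap.sum_apply, sum_wOp_flat_iOp, sum_flatInterior_ξ', flatInterior_apply,
    Module.End.mul_apply, (D.mem_Hor.mp h), map_zero, sub_zero]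

/-- A subspace that contains `1` and is stable under exterior multiplication by `g(X, ·)` for `X`
orthogonal to `ξ` contains all horizontal forms. -/
theorem Hor_le {N : Submodule ℝ (ExtAlg V)} (h1 : unitForm ∈ N)
    (hw : ∀ X, D.η ![X] = 0 → ∀ α ∈ N, wOp (D.flat X) α ∈ N) : D.Hor ≤ N := by
  have key : ∀ p, ∀ α ∈ D.Hor, gradeOp (Pi.single p 1) α ∈ N := by
    intro p
    induction p with
    | zero =>
      intro α _
      have : gradeOp (Pi.single 0 1) α = α 0 ![] • unitForm := by
        refine ExtAlg.ext fun q => ?_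
        cases q with
        | zero =>
          ext v
          rw [gradeOp_apply, Pi.single_eq_same, one_smul, Subsingleton.elim v ![]]
          exact (mul_one _).symm
        | succ q =>
          rw [gradeOp_apply, Pi.single_eq_of_ne (Nat.succ_ne_zero q), zero_smul]
          exact (smul_zero (α 0 ![])).symm
      rw [this]
      exact N.smul_mem _ h1
    | succ p ih =>
      intro α hα
      have h2 := D.gradeOp_eq_of_mem_Hor (D.gradeOp_mem_Hor hα (Pi.single (p + 1) 1))
      have h3 : ∀ X, iOp X (gradeOp (Pi.single (p + 1) 1) α) =
          gradeOp (Pi.single p 1) (iOp X α) := by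
        intro X
        rw [← Module.End.mul_apply, iOp_gradeOp, Module.End.mul_apply]
        congr 2
        funext q
        by_cases hq : q = p
        · subst hq; simp
        · rw [Pi.single_eq_of_ne hq, Pi.single_eq_of_ne (by omega)]
      have h4 : gradeOp (fun p => (p : ℝ)) (gradeOp (Pi.single (p + 1) 1) α) =
          ((p : ℝ) + 1) • gradeOp (Pi.single (p + 1) 1) α := by
        refine ExtAlg.ext fun q => ?_
        simp only [gradeOp_apply, ExtAlg.smul_apply]
        by_cases hq : q = p + 1
        · subst hq; push_cast; rfl
        · rw [Pi.single_eq_of_ne hq, zero_smul, smul_zero, smul_zero]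
      rw [h4] at h2
      have h5 : gradeOp (Pi.single (p + 1) 1) α = ((p : ℝ) + 1)⁻¹ •
          ((p : ℝ) + 1) • gradeOp (Pi.single (p + 1) 1) α := by
        rw [smul_smul, inv_mul_cancel₀ (by positivity), one_smul]
      rw [h5, h2]
      refine N.smul_mem _ (N.sum_mem fun k _ => hw _ (D.η_horProj _) _ ?_)
      rw [h3]
      exact ih _ (D.iOp_mem_Hor hα _)
  intro α hα
  have : α = ∑ p ∈ Finset.range (2 * n + 1), gradeOp (Pi.single p 1) α := by
    refine ExtAlg.ext fun q => ?_
    rw [ExtAlg.sum_apply]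
    by_cases hq : q < 2 * n + 1
    · rw [Finset.sum_eq_single_of_mem q (Finset.mem_range.mpr hq)]
      · rw [gradeOp_apply, Pi.single_eq_same, one_smul]
      · intro p _ hpq
        rw [gradeOp_apply, Pi.single_eq_of_ne hpq.symm, zero_smul]
    · rw [D.apply_eq_zero_of_mem_Hor hα (by omega), Finset.sum_eq_zero]
      intro p hp
      rw [gradeOp_apply, Pi.single_eq_of_ne, zero_smul]
      have := Finset.mem_range.mp hp
      omega
  rw [this]
  exact N.sum_mem fun p _ => key p α hα

/-- A horizontal form annihilated by exterior multiplication by all `g(X, ·)` with `X` orthogonal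
to `ξ` is of top degree `2n`. -/
theorem apply_eq_zero_of_wOp_eq_zero {β : ExtAlg V} (hβ : β ∈ D.Hor)
    (h : ∀ X, D.η ![X] = 0 → wOp (D.flat X) β = 0) {p : ℕ} (hp : p ≠ 2 * n) : β p = 0 := by
  have h1 : ∀ k, wOp (D.flat (D.e k)) β = D.η ![D.e k] • wOp D.η β := by
    intro k
    have := h _ (D.η_horProj (D.e k))
    rwa [flat_horProj, map_sub, map_smul, LinearMap.sub_apply, LinearMap.smul_apply,
      sub_eq_zero] at this
  -- The sum `∑ₖ ι_{eₖ}(eₖ ∧ β)` is `β` by hypothesis and `(2n + 1 - p) β` by Euler's formula.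
  have h2 : ∑ k, iOp (D.e k) (wOp (D.flat (D.e k)) β) = β := by
    have e1 : ∀ k, iOp (D.e k) (wOp (D.flat (D.e k)) β) =
        iOp (D.flat (D.e k) ![D.ξ] • D.e k) (wOp D.η β) := by
      intro k
      rw [h1, map_smul, map_smul, LinearMap.smul_apply, D.flat_symm _ D.ξ, flat_ξ]
    rw [Finset.sum_congr rfl fun k _ => e1 k, ← LinearMap.sum_apply, ← map_sum, ← D.frame D.ξ,
      ← Module.End.mul_apply, iOp_wOp, LinearMap.sub_apply, Module.End.mul_apply,
      D.mem_Hor.mp hβ, map_zero, sub_zero, D.η_ξ, one_smul, Module.End.one_apply]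
  have h3 : ∑ k, iOp (D.e k) (wOp (D.flat (D.e k)) β) =
      (1 + 2 * n : ℝ) • β - gradeOp (fun p => (p : ℝ)) β := by
    have e1 : ∀ k, iOp (D.e k) (wOp (D.flat (D.e k)) β) =
        β - (wOp (D.flat (D.e k)) * iOp (D.e k)) β := by
      intro k
      rw [← Module.End.mul_apply, iOp_wOp, flat_e, if_pos rfl, one_smul]
      rfl
    rw [Finset.sum_congr rfl fun k _ => e1 k, Finset.sum_sub_distrib, ← LinearMap.sum_apply,
      sum_wOp_flat_iOp, Finset.sum_const, Finset.card_univ, Fintype.card_fin,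
      ← Nat.cast_smul_eq_nsmul ℝ]
    push_cast
    rfl
  have h4 := congrArg (fun γ : ExtAlg V => γ p) (h2.symm.trans h3)
  simp only [ExtAlg.sub_apply, ExtAlg.smul_apply, gradeOp_apply] at h4
  have h5 : ((2 : ℝ) * n - p) • β p = 0 := by
    have : ((2 : ℝ) * n - p) • β p = (1 + 2 * n : ℝ) • β p - (p : ℝ) • β p - β p := by module
    rw [this, ← h4, sub_self]
  refine (smul_eq_zero.mp h5).resolve_left fun h6 => hp ?_
  have : (p : ℝ) = ((2 * n : ℕ) : ℝ) := by push_cast; linarith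
  exact_mod_cast this

/-! ### Pullback by `Φ` -/

/-- The action `α ↦ α(Φ·, …, Φ·)`. -/
def Ψ : Module.End ℝ (ExtAlg V) := pullOp D.Φ

theorem Ψ_gradeOp (c : ℕ → ℝ) : D.Ψ * gradeOp c = gradeOp c * D.Ψ := pullOp_gradeOp _ _

theorem iOp_Ψ (X : V) : iOp X * D.Ψ = D.Ψ * iOp (D.Φ X) := iOp_pullOp _ _

theorem Ψ_wOp {X : V} (hX : D.η ![X] = 0) :
    D.Ψ * wOp (D.flat (D.Φ X)) = wOp (D.flat X) * D.Ψ := by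
  rw [Ψ, pullOp_wOp]
  congr 2
  ext v
  obtain ⟨y, rfl⟩ : ∃ y, v = ![y] := ⟨v 0, by
    funext i
    rw [Subsingleton.elim i 0]
    rfl⟩
  have : ContinuousAlternatingMap.compContinuousLinearMap (D.flat (D.Φ X)) D.Φ ![y] =
      D.flat (D.Φ X) ![D.Φ y] := by
    rw [ContinuousAlternatingMap.compContinuousLinearMap_apply]
    congr 1
    funext i
    rw [Subsingleton.elim i 0]
    rfl
  rw [this, flat_Φ_left, flat_apply, hX, zero_mul, add_zero]

theorem Ψ_L : D.Ψ * D.L = D.L * D.Ψ := by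
  have hΩ : D.Ω.compContinuousLinearMap D.Φ = D.Ω := by
    ext v
    obtain ⟨x, y, rfl⟩ : ∃ x y, v = ![x, y] := ⟨v 0, v 1, by
      funext i
      fin_cases i <;> rfl⟩
    rw [← D.Ω_Φ, ContinuousAlternatingMap.compContinuousLinearMap_apply]
    congr 1
    funext i
    fin_cases i <;> rfl
  refine LinearMap.ext fun α => ExtAlg.ext fun p => ?_
  match p with
  | 0 => rfl
  | 1 => rfl
  | p + 2 =>
    change (wedge (α p) D.Ω).compContinuousLinearMap D.Φ =
      wedge ((α p).compContinuousLinearMap D.Φ) D.Ω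
    rw [wedge_compContinuousLinearMap, hΩ]

/-- The frame `Φ eₖ` can replace `eₖ` in the definition of `Λ`, since they differ by terms with a
factor `Φ ξ = 0`. -/
theorem Λ_Ψ : D.Λ * D.Ψ = D.Ψ * D.Λ := by
  have h' : ∑ k, D.η ![D.e k] • iOp (D.Φ (D.e k)) = (0 : Module.End ℝ (ExtAlg V)) := by
    have h1 : ∀ k, D.η ![D.e k] • iOp (D.Φ (D.e k)) =
        (iOp ∘ₗ (D.Φ : V →ₗ[ℝ] V)) (D.flat (D.e k) ![D.ξ] • D.e k) := by
      intro k
      rw [D.flat_symm _ D.ξ, flat_ξ, map_smul]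
      rfl
    rw [Finset.sum_congr rfl fun k _ => h1 k, ← map_sum, ← D.frame D.ξ]
    change iOp (D.Φ D.ξ) = (0 : Module.End ℝ (ExtAlg V))
    rw [D.Φ_ξ, map_zero]
  have hk : ∀ k, iOp (D.Φ (D.e k)) * iOp (D.e k) * D.Ψ =
      D.Ψ * (iOp (D.Φ (D.Φ (D.e k))) * iOp (D.Φ (D.e k))) := by
    intro k
    rw [mul_assoc, iOp_Ψ, ← mul_assoc, iOp_Ψ, mul_assoc]
  have hs : ∑ k, iOp (D.Φ (D.Φ (D.e k))) * iOp (D.Φ (D.e k)) =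
      ∑ k, iOp (D.Φ (D.e k)) * (iOp (D.e k) : Module.End ℝ (ExtAlg V)) := by
    have e2 : ∑ k, D.η ![D.e k] • (iOp D.ξ * iOp (D.Φ (D.e k))) =
        (0 : Module.End ℝ (ExtAlg V)) := by
      have := congrArg (fun T => iOp D.ξ * T) h'
      simpa only [Finset.mul_sum, mul_smul_comm, mul_zero] using this
    simp only [D.Φ_sq, map_add, map_neg, map_smul, neg_mul, add_mul, smul_mul_assoc,
      Finset.sum_add_distrib, Finset.sum_neg_distrib]
    rw [e2, add_zero, ← Finset.sum_neg_distrib]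
    exact Finset.sum_congr rfl fun k _ => by rw [iOp_iOp (D.e k), neg_neg]
  rw [Λ, smul_mul_assoc, Finset.sum_mul, mul_smul_comm, Finset.sum_congr rfl fun k _ => hk k,
    ← Finset.mul_sum, hs]

/-! ### The Weyl element -/

/-- The sign operator, equal to `(-1)^p` on `p`-forms. -/
def signOp : Module.End ℝ (ExtAlg V) := gradeOp fun p => (-1) ^ p

/-- The sign `(-1)^(p (p - 1) / 2)` of the permutation that reverses `p` elements. -/
def reversalSign : ℕ → ℝ
  | 0 => 1
  | p + 1 => (-1) ^ p * reversalSign p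

/-- The operator equal to `(-1)^(p (p - 1) / 2)` on `p`-forms. -/
def revOp : Module.End ℝ (ExtAlg V) := gradeOp reversalSign

theorem signOp_apply (α : ExtAlg V) (p : ℕ) : signOp α p = (-1 : ℝ) ^ p • α p := rfl

theorem signOp_mul_signOp : (signOp * signOp : Module.End ℝ (ExtAlg V)) = 1 := by
  rw [signOp, gradeOp_mul, ← gradeOp_one]
  congr 1
  funext p
  simp [← mul_pow]

theorem signOp_signOp (α : ExtAlg V) : signOp (signOp α) = α := by
  rw [← Module.End.mul_apply, signOp_mul_signOp]
  rfl

theorem signOp_revOp : (signOp * revOp : Module.End ℝ (ExtAlg V)) = revOp * signOp := by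
  rw [signOp, revOp, gradeOp_mul, gradeOp_mul, mul_comm]

theorem iOp_signOp (X : V) : iOp X * signOp = -(signOp * iOp X) := by
  rw [signOp, iOp_gradeOp]
  refine LinearMap.ext fun α => ExtAlg.ext fun p => ?_
  simp only [Module.End.mul_apply, gradeOp_apply, LinearMap.neg_apply, ExtAlg.neg_apply, pow_succ]
  module

theorem signOp_wOp (θ : V [⋀^Fin 1]→L[ℝ] ℝ) : signOp * wOp θ = -(wOp θ * signOp) := by
  have h : (gradeOp fun p => (-1 : ℝ) ^ (p + 1)) = -(signOp : Module.End ℝ (ExtAlg V)) := by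
    refine LinearMap.ext fun α => ExtAlg.ext fun p => ?_
    simp only [gradeOp_apply, LinearMap.neg_apply, ExtAlg.neg_apply, pow_succ, signOp]
    module
  rw [signOp, gradeOp_wOp, h, mul_neg]
  rfl

theorem revOp_wOp (θ : V [⋀^Fin 1]→L[ℝ] ℝ) : revOp * wOp θ = wOp θ * (signOp * revOp) := by
  rw [revOp, gradeOp_wOp, signOp, gradeOp_mul]
  rfl

theorem revOp_iOp (X : V) : revOp * iOp X = -(iOp X * (signOp * revOp)) := by
  rw [revOp, signOp, gradeOp_mul, iOp_gradeOp]
  refine LinearMap.ext fun α => ExtAlg.ext fun p => ?_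
  simp only [Module.End.mul_apply, gradeOp_apply, LinearMap.neg_apply, ExtAlg.neg_apply,
    Pi.mul_apply, reversalSign]
  have h : ((-1 : ℝ) ^ p) * (-1) ^ p = 1 := by rw [← mul_pow]; simp
  have hc : reversalSign p = -((-1 : ℝ) ^ (p + 1) * ((-1) ^ p * reversalSign p)) := by
    rw [pow_succ]
    linear_combination (-reversalSign p) * h
  refine ContinuousAlternatingMap.ext fun v => ?_
  exact (congrArg (· * iOp X α p v) hc).trans (neg_mul _ _)

theorem L_signOp : D.L * signOp = signOp * D.L := by
  rw [L, signOp, gradeOp_lOp]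
  simp [pow_add]

theorem Λ_signOp : D.Λ * signOp = signOp * D.Λ := by
  rw [signOp, Λ_gradeOp]
  simp [pow_add]

/-- The Weyl element `exp(Λ) exp(-L) exp(Λ)` of the `sl₂`-action on forms. -/
def w : Module.End ℝ (ExtAlg V) := weylElement (n + 1) D.Λ D.L

/-- The Weyl element turns exterior into interior multiplication: `g(X, ·) ∧` and `ι_{ΦX}` span a
two-dimensional representation. -/
theorem w_wOp {X : V} (hX : D.η ![X] = 0) :
    D.w * wOp (D.flat X) = iOp (D.Φ X) * D.w := by
  refine weylElement_mul D.Λ_nilpotent D.L_nilpotent (D.L_wOp _) (D.Λ_wOp X) ?_ (D.Λ_iOp _)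
  rw [iOp_L, flat_ΦΦ, hX, zero_smul, add_zero, map_neg]
  abel

theorem w_iOp_Φ {X : V} (hX : D.η ![X] = 0) :
    D.w * iOp (D.Φ X) = -(wOp (D.flat X) * D.w) := by
  refine weylElement_mul' D.Λ_nilpotent D.L_nilpotent (D.L_wOp _) (D.Λ_wOp X) ?_ (D.Λ_iOp _)
  rw [iOp_L, flat_ΦΦ, hX, zero_smul, add_zero, map_neg]
  abel

theorem w_iOp {X : V} (hX : D.η ![X] = 0) : D.w * iOp X = wOp (D.flat (D.Φ X)) * D.w := by
  have h := D.w_iOp_Φ (D.η_Φ X)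
  rw [D.Φ_sq, hX, zero_smul, add_zero, map_neg, mul_neg, neg_inj] at h
  exact h

theorem w_signOp : D.w * signOp = signOp * D.w :=
  weylElement_commute D.Λ_signOp D.L_signOp

theorem Ψ_w : D.w * D.Ψ = D.Ψ * D.w := weylElement_commute D.Λ_Ψ D.Ψ_L.symm

theorem truncExp_mem {N : ℕ} {a : Module.End ℝ (ExtAlg V)} {S : Submodule ℝ (ExtAlg V)}
    (h : ∀ α ∈ S, a α ∈ S) {α : ExtAlg V} (hα : α ∈ S) : truncExp N a α ∈ S := by
  have hk : ∀ k, (a ^ k) α ∈ S := by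
    intro k
    induction k with
    | zero => exact hα
    | succ k ih => rw [pow_succ', Module.End.mul_apply]; exact h _ ih
  rw [truncExp, LinearMap.sum_apply]
  exact S.sum_mem fun k _ => S.smul_mem _ (hk k)

theorem w_mem_Hor {α : ExtAlg V} (h : α ∈ D.Hor) : D.w α ∈ D.Hor := by
  rw [w, weylElement, Module.End.mul_apply, Module.End.mul_apply]
  refine truncExp_mem (fun α h => D.Λ_mem_Hor h) (truncExp_mem (fun α h => ?_)
    (truncExp_mem (fun α h => D.Λ_mem_Hor h) h))
  rw [LinearMap.neg_apply]
  exact neg_mem (D.L_mem_Hor h)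

theorem L_pow_unitForm_mem_Hor (k : ℕ) : (D.L ^ k) (unitForm : ExtAlg V) ∈ D.Hor := by
  induction k with
  | zero => exact D.unitForm_mem_Hor
  | succ k ih => rw [pow_succ', Module.End.mul_apply]; exact D.L_mem_Hor ih

theorem L_pow_unitForm_apply (k : ℕ) :
    ∀ p, p ≠ 2 * k → (D.L ^ k) (unitForm : ExtAlg V) p = 0 := by
  induction k with
  | zero =>
    intro p hp
    cases p with
    | zero => exact absurd rfl hp
    | succ p => rfl
  | succ k ih =>
    intro p hp
    by_cases h : p < 2 * (k + 1)
    · exact D.L_pow_apply _ _ _ h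
    · obtain ⟨q, rfl⟩ : ∃ q, p = q + 2 := ⟨p - 2, by omega⟩
      rw [pow_succ', Module.End.mul_apply]
      change wedge ((D.L ^ k) unitForm q) D.Ω = 0
      rw [ih q (by omega)]
      simpa using wedge_smul_left (0 : ℝ) (0 : V [⋀^Fin q]→L[ℝ] ℝ) D.Ω

theorem truncExp_apply_of_killed {N : ℕ} {a : Module.End ℝ (ExtAlg V)} {α : ExtAlg V}
    (h : a α = 0) : truncExp N a α = α := by
  rw [truncExp, Finset.sum_range_succ', LinearMap.add_apply, LinearMap.sum_apply,
    Finset.sum_eq_zero fun k _ => by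
      rw [LinearMap.smul_apply, pow_succ, Module.End.mul_apply, h, map_zero, smul_zero]]
  simp

/-- The Weyl element sends the lowest weight vector `1` to the highest weight vector, the multiple
`(-1)ⁿ Ωⁿ / n!` of `Ωⁿ`. -/
theorem w_unitForm : D.w unitForm = ((-1) ^ n * (n.factorial : ℝ)⁻¹) • (D.L ^ n) unitForm := by
  set β : ExtAlg V := truncExp (n + 1) (-D.L) unitForm with hβ
  have hβH : β ∈ D.Hor := truncExp_mem (fun α h => by
    rw [LinearMap.neg_apply]; exact neg_mem (D.L_mem_Hor h)) D.unitForm_mem_Hor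
  have hw : D.w unitForm = truncExp (n + 1) D.Λ β := by
    rw [w, weylElement, Module.End.mul_apply, Module.End.mul_apply,
      truncExp_apply_of_killed D.Λ_unitForm]
  have hsign : ∀ k, ((-D.L) ^ k) (unitForm : ExtAlg V) = ((-1 : ℝ) ^ k) • (D.L ^ k) unitForm := by
    intro k
    rw [← neg_one_smul ℝ D.L, smul_pow, LinearMap.smul_apply]
  refine ExtAlg.ext fun p => ?_
  by_cases hp : p = 2 * n
  · subst hp
    have h1 : truncExp (n + 1) D.Λ β (2 * n) = β (2 * n) := by
      rw [truncExp, Finset.sum_range_succ', LinearMap.add_apply, LinearMap.sum_apply,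
        ExtAlg.add_apply, ExtAlg.sum_apply, Finset.sum_eq_zero fun k _ => by
          rw [LinearMap.smul_apply, ExtAlg.smul_apply,
            D.Λ_pow_apply _ _ _ fun q hq => D.apply_eq_zero_of_mem_Hor hβH (by omega), smul_zero]]
      simp
    rw [hw, h1, hβ, truncExp, LinearMap.sum_apply, ExtAlg.sum_apply,
      Finset.sum_eq_single_of_mem n (Finset.mem_range.mpr (by omega)) fun k _ hk => by
        rw [LinearMap.smul_apply, hsign, ExtAlg.smul_apply, ExtAlg.smul_apply,
          D.L_pow_unitForm_apply k _ (by omega), smul_zero, smul_zero]]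
    rw [LinearMap.smul_apply, hsign, smul_smul, mul_comm ((n.factorial : ℝ)⁻¹)]
  · rw [ExtAlg.smul_apply, D.L_pow_unitForm_apply n p hp, smul_zero]
    -- As `w` turns `ι_X 1 = 0` into `g(X, ·) ∧ w 1 = 0`, the form `w 1` is of top degree.
    refine D.apply_eq_zero_of_wOp_eq_zero (D.w_mem_Hor D.unitForm_mem_Hor) (fun X hX => ?_) hp
    have := congrArg (fun T => T unitForm) (D.w_iOp_Φ hX)
    simp only [Module.End.mul_apply, iOp_unitForm, map_zero, LinearMap.neg_apply] at this
    exact neg_eq_zero.mp this.symm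

theorem Λ_L_pow_unitForm (k : ℕ) : D.Λ ((D.L ^ (k + 1)) (unitForm : ExtAlg V)) =
    (((k : ℝ) + 1) * (n - k)) • (D.L ^ k) unitForm := by
  have hstep : ∀ k : ℕ, D.Λ ((D.L ^ (k + 1)) (unitForm : ExtAlg V)) =
      D.L (D.Λ ((D.L ^ k) unitForm)) - ((2 * k : ℝ) - n) • (D.L ^ k) unitForm := by
    intro k
    have h := D.L_Λ_apply (D.L_pow_unitForm_mem_Hor k)
    have hg : gradeOp (fun p => (p : ℝ) - n) ((D.L ^ k) (unitForm : ExtAlg V)) =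
        ((2 * k : ℝ) - n) • (D.L ^ k) unitForm := by
      refine ExtAlg.ext fun p => ?_
      rw [gradeOp_apply, ExtAlg.smul_apply]
      by_cases hp : p = 2 * k
      · subst hp
        push_cast
        rfl
      · rw [D.L_pow_unitForm_apply k p hp, smul_zero, smul_zero]
    rw [← hg, ← h, pow_succ', Module.End.mul_apply]
    abel
  induction k with
  | zero =>
    rw [hstep, pow_zero, Module.End.one_apply, Λ_unitForm, map_zero, zero_sub, ← neg_smul]
    congr 1
    push_cast
    ring
  | succ k ih =>
    rw [hstep, ih, map_smul, ← Module.End.mul_apply, ← pow_succ', ← sub_smul]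
    congr 1
    push_cast
    ring

theorem Λ_pow_L_pow_unitForm :
    (D.Λ ^ n) ((D.L ^ n) (unitForm : ExtAlg V)) = ((n.factorial : ℝ) ^ 2) • unitForm := by
  have h : ∀ k, (D.Λ ^ k) ((D.L ^ k) (unitForm : ExtAlg V)) =
      (∏ j ∈ Finset.range k, (((j : ℝ) + 1) * (n - j))) • unitForm := by
    intro k
    induction k with
    | zero => simp
    | succ k ih =>
      rw [pow_succ D.Λ, Module.End.mul_apply, Λ_L_pow_unitForm, map_smul, ih, smul_smul,
        Finset.prod_range_succ, mul_comm]
  rw [h]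
  congr 1
  have h1 : ∏ j ∈ Finset.range n, ((j : ℝ) + 1) = n.factorial := by
    rw [← Finset.prod_range_add_one_eq_factorial]
    push_cast
    rfl
  have h2 : ∏ j ∈ Finset.range n, ((n : ℝ) - j) = n.factorial := by
    rw [← h1, ← Finset.prod_range_reflect]
    refine Finset.prod_congr rfl fun j hj => ?_
    have hj' := Finset.mem_range.mp hj
    have : ((n - 1 - j : ℕ) : ℝ) = n - 1 - j := by
      rw [Nat.cast_sub (by omega), Nat.cast_sub (by omega)]
      push_cast
      rfl
    rw [this]
    ring
  rw [Finset.prod_mul_distrib, h1, h2, sq]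

/-! ### The transverse Hodge star as a Weyl element -/

/-- An operator that intertwines exterior and interior multiplication the way a Hodge star does,
`S(g(X, ·) ∧ α) = (-1)^{deg} ι_X S α`, intertwines `L` and `Λ`. -/
theorem intertwine_L {S : Module.End ℝ (ExtAlg V)}
    (hS : ∀ X, D.η ![X] = 0 → S * wOp (D.flat X) = iOp X * (signOp * S)) :
    S * D.L = D.Λ * S := by
  have hsum : ∑ k, D.η ![D.e k] • (wOp D.η * wOp (D.flat (D.Φ (D.e k)))) =
      (0 : Module.End ℝ (ExtAlg V)) := by
    have h1 : ∀ k, D.η ![D.e k] • (wOp D.η * wOp (D.flat (D.Φ (D.e k)))) =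
        wOp D.η * (wOp ∘ₗ D.flatLin ∘ₗ (D.Φ : V →ₗ[ℝ] V)) (D.flat (D.e k) ![D.ξ] • D.e k) := by
      intro k
      rw [D.flat_symm _ D.ξ, flat_ξ, map_smul, mul_smul_comm]
      rfl
    rw [Finset.sum_congr rfl fun k _ => h1 k, ← Finset.mul_sum, ← map_sum, ← D.frame D.ξ]
    change wOp D.η * wOp (D.flatLin (D.Φ D.ξ)) = (0 : Module.End ℝ (ExtAlg V))
    rw [D.Φ_ξ, map_zero, map_zero, mul_zero]
  have hsum' : ∑ k, D.η ![D.e k] • (iOp (D.Φ (D.e k)) * iOp D.ξ) =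
      (0 : Module.End ℝ (ExtAlg V)) := by
    have h1 : ∀ k, D.η ![D.e k] • (iOp (D.Φ (D.e k)) * iOp D.ξ) =
        (iOp ∘ₗ (D.Φ : V →ₗ[ℝ] V)) (D.flat (D.e k) ![D.ξ] • D.e k) * iOp D.ξ := by
      intro k
      rw [D.flat_symm _ D.ξ, flat_ξ, map_smul, smul_mul_assoc]
      rfl
    rw [Finset.sum_congr rfl fun k _ => h1 k, ← Finset.sum_mul, ← map_sum, ← D.frame D.ξ]
    change iOp (D.Φ D.ξ) * iOp D.ξ = (0 : Module.End ℝ (ExtAlg V))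
    rw [D.Φ_ξ, map_zero, zero_mul]
  have hk : ∀ k, S * (wOp (D.flat (D.e k)) * wOp (D.flat (D.Φ (D.e k)))) =
      iOp (D.Φ (D.e k)) * iOp (D.e k) * S - D.η ![D.e k] • (iOp (D.Φ (D.e k)) * iOp D.ξ) * S +
        S * D.η ![D.e k] • (wOp D.η * wOp (D.flat (D.Φ (D.e k)))) := by
    intro k
    have h1 : S * (wOp (D.flat (D.horProj (D.e k))) * wOp (D.flat (D.Φ (D.e k)))) =
        iOp (D.Φ (D.e k)) * iOp (D.horProj (D.e k)) * S := by
      rw [← mul_assoc, hS _ (D.η_horProj _), mul_assoc, mul_assoc, hS _ (D.η_Φ _),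
        ← mul_assoc signOp, ← neg_eq_iff_eq_neg.mpr (iOp_signOp (D.Φ (D.e k))), neg_mul, mul_neg,
        mul_assoc, ← mul_assoc signOp signOp, signOp_mul_signOp, one_mul, ← mul_assoc, iOp_iOp,
        neg_mul, neg_neg, mul_assoc]
    rw [flat_horProj, horProj, map_sub, map_smul, map_sub, map_smul] at h1
    simp only [sub_mul, mul_sub, smul_mul_assoc, mul_smul_comm] at h1 ⊢
    rw [← h1]
    abel
  rw [L_eq, mul_smul_comm, Finset.mul_sum, Finset.sum_congr rfl fun k _ => hk k,
    Finset.sum_add_distrib, Finset.sum_sub_distrib, ← Finset.sum_mul, ← Finset.sum_mul,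
    ← Finset.mul_sum, hsum, hsum', mul_zero, zero_mul, sub_zero, add_zero, Λ, smul_mul_assoc]

/-- The Weyl element twisted by `Φ` and by signs; it agrees with the transverse Hodge star on
horizontal forms, up to the sign `(-1)^n`. -/
def W : Module.End ℝ (ExtAlg V) := D.Ψ * D.w * revOp

/-- `W` satisfies the same relation with exterior multiplication as the Hodge star. -/
theorem W_wOp {X : V} (hX : D.η ![X] = 0) :
    D.W * wOp (D.flat X) = iOp X * (signOp * D.W) := by
  have h : signOp * D.W = D.Ψ * D.w * (signOp * revOp) := by
    rw [W, ← mul_assoc, ← mul_assoc, signOp, ← Ψ_gradeOp, mul_assoc D.Ψ]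
    change D.Ψ * (signOp * D.w) * revOp = _
    rw [← w_signOp]
    simp only [mul_assoc]
    rfl
  rw [h, W, mul_assoc, revOp_wOp, mul_assoc, ← mul_assoc D.w, w_wOp D hX, mul_assoc,
    ← mul_assoc D.Ψ, ← iOp_Ψ]
  simp only [mul_assoc]

theorem W_iOp {X : V} (hX : D.η ![X] = 0) :
    D.W * iOp X = -(wOp (D.flat X) * (D.W * signOp)) := by
  rw [W, mul_assoc, revOp_iOp, mul_neg, mul_assoc, ← mul_assoc D.w, w_iOp D hX, mul_assoc,
    ← mul_assoc D.Ψ, Ψ_wOp D hX, signOp_revOp]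
  simp only [mul_assoc]

theorem Ψ_L_pow_unitForm (k : ℕ) :
    D.Ψ ((D.L ^ k) (unitForm : ExtAlg V)) = (D.L ^ k) unitForm := by
  have h : D.Ψ * D.L ^ k = D.L ^ k * D.Ψ := (show Commute D.Ψ D.L from D.Ψ_L).pow_right k
  rw [← Module.End.mul_apply, h, Module.End.mul_apply, Ψ, pullOp_unitForm]

theorem W_unitForm :
    D.W unitForm = ((-1) ^ n * (n.factorial : ℝ)⁻¹) • (D.L ^ n) unitForm := by
  rw [W, Module.End.mul_apply, revOp, gradeOp_unitForm, Module.End.mul_apply]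
  simp only [reversalSign, one_smul]
  rw [w_unitForm, map_smul, Ψ_L_pow_unitForm]

theorem W_W_unitForm : D.W (D.W unitForm) = unitForm := by
  have h : D.W * D.L = D.Λ * D.W := D.intertwine_L fun X hX => D.W_wOp hX
  have hk : D.W * D.L ^ n = D.Λ ^ n * D.W := (show SemiconjBy D.W D.L D.Λ from h).pow_right n
  rw [W_unitForm, map_smul, ← Module.End.mul_apply, hk, Module.End.mul_apply, W_unitForm, map_smul,
    Λ_pow_L_pow_unitForm, smul_smul, smul_smul]
  have : (-1 : ℝ) ^ n * (-1) ^ n = 1 := by rw [← mul_pow]; simp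
  have h2 : (n.factorial : ℝ) ≠ 0 := by positivity
  have e : (-1 : ℝ) ^ n * (n.factorial : ℝ)⁻¹ * ((-1) ^ n * (n.factorial : ℝ)⁻¹ *
      (n.factorial : ℝ) ^ 2) = 1 := by
    field_simp
    linear_combination this
  rw [← mul_assoc] at e
  rw [mul_assoc, ← mul_assoc, e, one_smul]

theorem W_W {α : ExtAlg V} (hα : α ∈ D.Hor) : D.W (D.W α) = signOp α := by
  have h : D.Hor ≤ LinearMap.eqLocus (D.W * D.W) signOp := by
    refine D.Hor_le ?_ fun X hX α hα => ?_
    · rw [LinearMap.mem_eqLocus, Module.End.mul_apply, W_W_unitForm, signOp, gradeOp_unitForm]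
      simp
    · rw [LinearMap.mem_eqLocus] at *
      have e1 : D.W * D.W * wOp (D.flat X) = -(wOp (D.flat X) * (D.W * D.W)) := by
        rw [mul_assoc, W_wOp D hX, ← mul_assoc, W_iOp D hX, neg_mul, mul_assoc, mul_assoc,
          ← mul_assoc signOp signOp, signOp_mul_signOp, one_mul]
      have h2 := congrArg (fun T => T α) e1
      have h3 := congrArg (fun T => T α) (signOp_wOp (D.flat X))
      simp only [Module.End.mul_apply, LinearMap.neg_apply] at h2 h3 hα ⊢
      rw [h2, hα, h3]
  exact h hα

theorem Ψ_Ψ {α : ExtAlg V} (hα : α ∈ D.Hor) : D.Ψ (D.Ψ α) = signOp α := by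
  have h : D.Hor ≤ LinearMap.eqLocus (D.Ψ * D.Ψ) signOp := by
    refine D.Hor_le ?_ fun X hX α hα => ?_
    · rw [LinearMap.mem_eqLocus, Module.End.mul_apply, Ψ, pullOp_unitForm, pullOp_unitForm, signOp,
        gradeOp_unitForm]
      simp
    · rw [LinearMap.mem_eqLocus] at *
      have e1 : D.Ψ * D.Ψ * wOp (D.flat X) = -(wOp (D.flat X) * (D.Ψ * D.Ψ)) := by
        have h1 : wOp (D.flat X) = -wOp (D.flat (D.Φ (D.Φ X))) := by
          rw [flat_ΦΦ, hX, zero_smul, add_zero, map_neg, neg_neg]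
        conv_lhs => rw [h1]
        rw [mul_neg, mul_assoc, Ψ_wOp D (D.η_Φ X), ← mul_assoc, Ψ_wOp D hX, mul_assoc]
      have h2 := congrArg (fun T => T α) e1
      have h3 := congrArg (fun T => T α) (signOp_wOp (D.flat X))
      simp only [Module.End.mul_apply, LinearMap.neg_apply] at h2 h3 hα ⊢
      rw [h2, hα, h3]
  exact h hα

/-- The form of `W² = (-1)^p` that does not involve `Ψ`. -/
theorem w_revOp_w_revOp {α : ExtAlg V} (hα : α ∈ D.Hor) :
    D.w (revOp (D.w (revOp α))) = α := by
  have h1 := D.W_W hα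
  have e : (revOp : Module.End ℝ (ExtAlg V)) * D.Ψ = D.Ψ * revOp := (D.Ψ_gradeOp _).symm
  have e' : D.w * (revOp : Module.End ℝ (ExtAlg V)) * D.Ψ = D.Ψ * (D.w * revOp) := by
    rw [mul_assoc, e, ← mul_assoc, Ψ_w, mul_assoc]
  have h2 : D.W * D.W =
      D.Ψ * D.Ψ * (D.w * (revOp : Module.End ℝ (ExtAlg V)) * (D.w * revOp)) := by
    rw [W, mul_assoc D.Ψ D.w revOp, mul_assoc D.Ψ, ← mul_assoc (D.w * revOp), e', mul_assoc,
      ← mul_assoc D.Ψ D.Ψ]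
  have hH : D.w (revOp (D.w (revOp α))) ∈ D.Hor :=
    D.w_mem_Hor (D.gradeOp_mem_Hor (D.w_mem_Hor (D.gradeOp_mem_Hor hα _)) _)
  have h4 : D.W (D.W α) = D.Ψ (D.Ψ (D.w (revOp (D.w (revOp α))))) :=
    congrArg (fun T : Module.End ℝ (ExtAlg V) => T α) h2
  rw [h4, D.Ψ_Ψ hH] at h1
  have h3 := congrArg signOp h1
  rw [signOp_signOp, signOp_signOp] at h3
  exact h3

/-- An operator with the intertwining property of the Hodge star that sends `1` to a positive
multiple of `Ωⁿ` and back is determined on horizontal forms. -/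
theorem star_eq {S : Module.End ℝ (ExtAlg V)}
    (hS : ∀ X, D.η ![X] = 0 → S * wOp (D.flat X) = iOp X * (signOp * S))
    {c : ℝ} (hc : 0 < c)
    (h1 : S unitForm = c⁻¹ • (D.L ^ n) unitForm) (h2 : S ((D.L ^ n) unitForm) = c • unitForm)
    {α : ExtAlg V} (hα : α ∈ D.Hor) : S α = (-1 : ℝ) ^ n • D.W α := by
  have hk : S * D.L ^ n = D.Λ ^ n * S :=
    (show SemiconjBy S D.L D.Λ from D.intertwine_L hS).pow_right n
  have h3 : c • (unitForm : ExtAlg V) = (c⁻¹ * (n.factorial : ℝ) ^ 2) • unitForm := by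
    rw [← h2, ← Module.End.mul_apply, hk, Module.End.mul_apply, h1, map_smul,
      Λ_pow_L_pow_unitForm, smul_smul]
  have h4 : c = c⁻¹ * (n.factorial : ℝ) ^ 2 := by
    have := congrArg (fun β : ExtAlg V => β 0 ![]) h3
    have e : ∀ r : ℝ, (r • (unitForm : ExtAlg V)) 0 ![] = r := fun r => mul_one r
    simpa only [e] using this
  -- Computing `S (Lⁿ 1) = Λⁿ (S 1)` in two ways determines the constant `c`.
  have h5 : c = n.factorial := by
    have h6 : c ^ 2 = (n.factorial : ℝ) ^ 2 := by
      have h7 := congrArg (c * ·) h4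
      simp only [mul_inv_cancel_left₀ hc.ne'] at h7
      rw [sq, h7]
    exact (pow_left_inj₀ hc.le (by positivity) two_ne_zero).mp h6
  have h : D.Hor ≤ LinearMap.eqLocus S ((-1 : ℝ) ^ n • D.W) := by
    refine D.Hor_le ?_ fun X hX α hα => ?_
    · rw [LinearMap.mem_eqLocus, h1, LinearMap.smul_apply, W_unitForm, smul_smul, h5, ← mul_assoc,
        ← mul_pow]
      simp
    · rw [LinearMap.mem_eqLocus] at *
      rw [← Module.End.mul_apply, hS X hX, LinearMap.smul_apply, ← Module.End.mul_apply D.W,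
        W_wOp D hX, Module.End.mul_apply, Module.End.mul_apply, hα]
      simp only [LinearMap.smul_apply, map_smul, Module.End.mul_apply]
  exact h hα

end ContactModule

/-! ### The Hodge star of a frame -/

section

variable {V : Type*} [AddCommGroup V] [Module ℝ V] [TopologicalSpace V]

theorem append_eq_ite {X : Type*} {r q : ℕ} (u : Fin r → X) (v : Fin q → X) (k : Fin (r + q)) :
    Fin.append u v k =
      if h : k.val < r then u ⟨k, h⟩ else v ⟨k - r, by have := k.isLt; omega⟩ := by
  refine Fin.addCases (fun a => ?_) (fun b => ?_) k
  · simp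
  · simp

theorem vecCons_eq_ite {X : Type*} {r : ℕ} (x : X) (u : Fin r → X) (k : Fin (r + 1)) :
    (Matrix.vecCons x u : Fin (r + 1) → X) k =
      if h : k.val = 0 then x else u ⟨k - 1, by have := k.isLt; omega⟩ := by
  refine Fin.cases ?_ (fun a => ?_) k
  · simp
  · simp

theorem append_cast_update_left {X : Type*} {r q m : ℕ} (h : r + q = m) (u : Fin r → X)
    (v : Fin q → X) (i : Fin r) (x : X) :
    (fun k : Fin m => Fin.append (Function.update u i x) v (Fin.cast h.symm k)) =
      Function.update (fun k : Fin m => Fin.append u v (Fin.cast h.symm k))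
        (Fin.cast h (Fin.castAdd q i)) x := by
  subst h
  funext k
  simp only [append_eq_ite, Function.update_apply, Fin.ext_iff, Fin.val_cast, Fin.val_castAdd]
  have := i.isLt
  split_ifs <;> first | rfl | omega

/-- The form `u ↦ β(u₁, …, u_r, v₁, …, v_q)`. -/
def contractRight {r q m : ℕ} (h : r + q = m) (v : Fin q → V) (β : V [⋀^Fin m]→L[ℝ] ℝ) :
    V [⋀^Fin r]→ₗ[ℝ] ℝ where
  toFun u := contractLeft h u β v
  map_update_add' u i x y := by
    have hi := Subsingleton.elim ‹DecidableEq (Fin r)› (instDecidableEqFin r)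
    subst hi
    change β _ = β _ + β _
    rw [append_cast_update_left h, append_cast_update_left h, append_cast_update_left h,
      β.map_update_add]
  map_update_smul' u i c x := by
    have hi := Subsingleton.elim ‹DecidableEq (Fin r)› (instDecidableEqFin r)
    subst hi
    change β _ = c • β _
    rw [append_cast_update_left h, append_cast_update_left h, β.map_update_smul]
  map_eq_zero_of_eq' u i j hu hij := by
    refine β.map_eq_zero_of_eq (i := Fin.cast h (Fin.castAdd q i))
      (j := Fin.cast h (Fin.castAdd q j)) _ ?_ ?_
    · simpa using hu
    · intro hh
      exact hij (by simpa using hh)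

theorem contractRight_apply {r q m : ℕ} (h : r + q = m) (v : Fin q → V)
    (β : V [⋀^Fin m]→L[ℝ] ℝ) (u : Fin r → V) : contractRight h v β u = contractLeft h u β v := rfl

theorem contractLeft_cast {r r' q m : ℕ} (h : r + q = m) (hr : r' = r) (u : Fin r → V)
    (β : V [⋀^Fin m]→L[ℝ] ℝ) :
    contractLeft h u β = contractLeft (by omega) (u ∘ Fin.cast hr) β := by
  subst hr
  rfl

/-- Contracting first with `X` and then with `u` is contraction with `(X, u)`. -/
theorem contractLeft_cons {r q m : ℕ} (h : r + q = m) (X : V) (u : Fin r → V)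
    (β : V [⋀^Fin (1 + m)]→L[ℝ] ℝ) (v : Fin q → V) :
    contractLeft (r := r + 1) (by omega) (Matrix.vecCons X u) β v =
      contractLeft h u (contractLeft rfl ![X] β) v := by
  subst h
  refine congrArg β (funext fun k => ?_)
  simp only [append_eq_ite, vecCons_eq_ite, Fin.val_cast]
  split_ifs <;> first | rfl | omega | skip
  all_goals congr 2; omega

/-- Moving a vector past `r` others costs the sign `(-1)^r`. -/
theorem contractLeft_vecCons {r q m : ℕ} (h : r + (q + 1) = m) (X : V) (u : Fin r → V)
    (β : V [⋀^Fin m]→L[ℝ] ℝ) (v : Fin q → V) :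
    contractLeft h u β (Matrix.vecCons X v) =
      (-1) ^ r * contractLeft (r := r + 1) (by omega) (Matrix.vecCons X u) β v := by
  obtain rfl : m = r + q + 1 := by omega
  have e1 : (fun k => Fin.append u (Matrix.vecCons X v) (Fin.cast h.symm k)) =
      Fin.insertNth (α := fun _ => V) ⟨r, by omega⟩ X (Fin.append u v) := by
    rw [Fin.eq_insertNth_iff]
    refine ⟨?_, funext fun k => ?_⟩
    · simp [append_eq_ite]
    · simp only [Fin.removeNth, append_eq_ite, vecCons_eq_ite, Fin.val_cast, Fin.succAbove,
        Fin.lt_def, Fin.val_castSucc]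
      have hc : k.castSucc.val = k := rfl
      have hs : k.succ.val = k + 1 := rfl
      split_ifs <;> first | rfl | omega | skip
      exact congrArg v (Fin.ext (by dsimp only; omega))
  have e2 : (fun k => Fin.append (Matrix.vecCons X u) v (Fin.cast (by omega) k)) =
      Matrix.vecCons X (Fin.append u v) := by
    funext k
    simp only [append_eq_ite, vecCons_eq_ite, Fin.val_cast]
    split_ifs <;> first | rfl | omega | skip
    all_goals exact congrArg v (Fin.ext (by dsimp only; omega))
  have h1 := β.toAlternatingMap.map_insertNth ⟨r, by omega⟩ X (Fin.append u v)
  change β _ = _ * β _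
  rw [e1, e2]
  simpa using h1

/-- The frame sum that defines a Hodge star turns exterior multiplication by `θ` into contraction
with the vector dual to `θ`. -/
theorem sum_wedgeOne_mul {κ : Type*} [Fintype κ] {m : ℕ} (e : κ → V)
    (θ : V [⋀^Fin 1]→L[ℝ] ℝ) {X : V} (hX : ∑ k, θ ![e k] • e k = X) (α : V [⋀^Fin m]→L[ℝ] ℝ)
    (G : V [⋀^Fin (m + 1)]→ₗ[ℝ] ℝ) :
    ∑ i : Fin (m + 1) → κ, wedgeOne θ α (e ∘ i) * G (e ∘ i) =
      (m + 1) * ∑ j : Fin m → κ, α (e ∘ j) * G (Matrix.vecCons X (e ∘ j)) := by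
  have h1 : ∀ a : Fin (m + 1), ∑ i : Fin (m + 1) → κ, (-1 : ℝ) ^ (a : ℕ) *
      (θ ![e (i a)] * α (Fin.removeNth a (e ∘ i))) * G (e ∘ i) =
      ∑ j : Fin m → κ, α (e ∘ j) * G (Matrix.vecCons X (e ∘ j)) := by
    intro a
    rw [← (Fin.insertNthEquiv (fun _ => κ) a).sum_comp, Fintype.sum_prod_type_right]
    refine Finset.sum_congr rfl fun j _ => ?_
    have hG : G (Matrix.vecCons X (e ∘ j)) =
        ∑ k, θ ![e k] * G (Matrix.vecCons (e k) (e ∘ j)) := by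
      rw [← hX]
      change (G.toMultilinearMap.curryLeft (∑ k, θ ![e k] • e k)) (e ∘ j) = _
      rw [map_sum, sum_apply]
      refine Finset.sum_congr rfl fun k _ => ?_
      rw [map_smul]
      rfl
    rw [hG, Finset.mul_sum]
    refine Finset.sum_congr rfl fun k _ => ?_
    have e1 : e ∘ (Fin.insertNthEquiv (fun _ => κ) a (k, j)) =
        Fin.insertNth (α := fun _ => V) a (e k) (e ∘ j) := by
      rw [Fin.eq_insertNth_iff]
      refine ⟨by simp, funext fun l => by simp [Fin.removeNth]⟩
    have e2 : (Fin.insertNthEquiv (fun _ => κ) a (k, j)) a = k := by simp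
    have h2 := G.map_insertNth a (e k) (e ∘ j)
    rw [e1, e2, Fin.removeNth_insertNth, h2]
    have h3 : (-1 : ℝ) ^ (a : ℕ) * (-1) ^ (a : ℕ) = 1 := by rw [← mul_pow]; simp
    rw [zsmul_eq_mul]
    push_cast
    linear_combination (θ ![e k] * α (e ∘ j) * G (Matrix.vecCons (e k) (e ∘ j))) * h3
  simp only [wedgeOne_apply, Finset.sum_mul]
  rw [Finset.sum_comm]
  simp only [Function.comp_apply]
  rw [Finset.sum_congr rfl fun a _ => h1 a]
  simp

theorem hodgeOfFrame_apply {r q m : ℕ} (h : r + q = m) (e : Fin m → V)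
    (vol : V [⋀^Fin m]→L[ℝ] ℝ) (α : V [⋀^Fin r]→L[ℝ] ℝ) (v : Fin q → V) :
    hodgeOfFrame h e vol α v =
      (r.factorial : ℝ)⁻¹ * ∑ i : Fin r → Fin m, α (e ∘ i) * contractRight h v vol (e ∘ i) := by
  rw [hodgeOfFrame, ContinuousAlternatingMap.smul_apply, ContinuousAlternatingMap.sum_apply]
  rfl

/-- The Hodge star of `η ∧ α` is the Hodge star of `α` for the volume form contracted with the
vector dual to `η`. -/
theorem hodgeOfFrame_wedge {q m N : ℕ} (h : m + q = N) (e : Fin (1 + N) → V)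
    (vol : V [⋀^Fin (1 + N)]→L[ℝ] ℝ) (θ : V [⋀^Fin 1]→L[ℝ] ℝ) {X : V}
    (hX : ∑ k, θ ![e k] • e k = X) (α : V [⋀^Fin m]→L[ℝ] ℝ) (v : Fin q → V) :
    hodgeOfFrame (r := 1 + m) (by omega) e vol (wedge θ α) v =
      (m.factorial : ℝ)⁻¹ * ∑ j : Fin m → Fin (1 + N),
        α (e ∘ j) * contractRight h v (contractLeft rfl ![X] vol) (e ∘ j) := by
  have h1 := sum_wedgeOne_mul e θ hX α (contractRight (by omega) v vol)
  have h2 : ∑ i : Fin (1 + m) → Fin (1 + N), wedge θ α (e ∘ i) *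
      contractRight (by omega) v vol (e ∘ i) = ∑ i : Fin (m + 1) → Fin (1 + N),
        wedgeOne θ α (e ∘ i) * contractRight (by omega) v vol (e ∘ i) := by
    refine Fintype.sum_equiv (Equiv.arrowCongr (finCongr (Nat.add_comm 1 m)) (Equiv.refl _)) _ _
      fun i => ?_
    rw [wedge_oneForm_left, contractRight_apply, contractLeft_cast _ (Nat.add_comm m 1)]
    rfl
  rw [hodgeOfFrame_apply, h2, h1]
  have h3 : ((1 + m).factorial : ℝ) = (m + 1) * m.factorial := by
    rw [Nat.add_comm, Nat.factorial_succ]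
    push_cast
    ring
  have h4 : (m : ℝ) + 1 ≠ 0 := by positivity
  rw [h3, mul_inv, ← mul_assoc, mul_comm ((m : ℝ) + 1)⁻¹, mul_assoc ((m.factorial : ℝ)⁻¹),
    inv_mul_cancel₀ h4, mul_one]
  congr 1
  refine Finset.sum_congr rfl fun j _ => ?_
  rw [contractRight_apply, contractLeft_cons h]
  rfl

end

/-- Two forms of degree `m`, paired over all `m`-tuples from a family of `m` vectors: only the
permutations contribute, and they contribute equally. -/
theorem sum_mul_comp {V : Type*} [AddCommGroup V] [Module ℝ V] {m : ℕ} (e : Fin m → V)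
    (A B : V [⋀^Fin m]→ₗ[ℝ] ℝ) :
    ∑ i : Fin m → Fin m, A (e ∘ i) * B (e ∘ i) = m.factorial * (A e * B e) := by
  have h1 : ∀ i : Fin m → Fin m, ¬ Function.Bijective i → A (e ∘ i) * B (e ∘ i) = 0 := by
    intro i hi
    have : ¬ Function.Injective i := fun h => hi (Finite.injective_iff_bijective.mp h)
    obtain ⟨a, b, hab, hne⟩ := Function.not_injective_iff.mp this
    rw [A.map_eq_zero_of_eq (e ∘ i) (congrArg e hab) hne, zero_mul]
  have h2 : ∑ s : Equiv.Perm (Fin m), A (e ∘ s) * B (e ∘ s) =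
      ∑ i : Fin m → Fin m, A (e ∘ i) * B (e ∘ i) := by
    refine Finset.sum_of_injOn (fun s : Equiv.Perm (Fin m) => (s : Fin m → Fin m))
      (fun s _ t _ h => DFunLike.coe_injective h)
      (fun _ _ => Finset.mem_coe.mpr (Finset.mem_univ _))
      (fun i _ hi => h1 i fun hb => hi ⟨Equiv.ofBijective i hb, by simp, rfl⟩) fun _ _ => rfl
  have h3 : ∀ s : Equiv.Perm (Fin m), A (e ∘ s) * B (e ∘ s) = A e * B e := by
    intro s
    rw [A.map_perm, B.map_perm]
    rcases Int.units_eq_one_or (Equiv.Perm.sign s) with h | h <;> simp [h]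
  rw [← h2, Finset.sum_congr rfl fun s _ => h3 s]
  simp [Fintype.card_perm]

/-! ### The transverse Hodge star of a tangent space -/

namespace ContactModule

open KContactStructure

variable {n : ℕ} {V : Type*} [AddCommGroup V] [Module ℝ V] [TopologicalSpace V]
  (D : ContactModule n V)

/-- The form `η ∧ Ωⁿ` of top degree. -/
def contactForm : V [⋀^Fin (1 + 2 * n)]→L[ℝ] ℝ := wedge D.η (wedgePow D.Ω n)

/-- The positive multiple of `η ∧ Ωⁿ` with value `±1` on the frame. -/
def volForm : V [⋀^Fin (1 + 2 * n)]→L[ℝ] ℝ := |D.contactForm D.e|⁻¹ • D.contactForm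

theorem sum_flat_smul (X : V) : ∑ k, D.flat X ![D.e k] • D.e k = X := by
  conv_rhs => rw [D.frame X]
  exact Finset.sum_congr rfl fun k _ => by rw [flat_symm]

theorem linearIndependent_e : LinearIndependent ℝ D.e := by
  rw [Fintype.linearIndependent_iff]
  intro g hg i
  have h := congrArg (toFunctional (D.flat (D.e i))) hg
  rw [map_zero, map_sum] at h
  simpa [flat_e] using h

theorem span_e : ⊤ ≤ Submodule.span ℝ (Set.range D.e) := by
  intro v _
  rw [D.frame v]
  exact Submodule.sum_mem _ fun k _ => Submodule.smul_mem _ _ (Submodule.subset_span ⟨k, rfl⟩)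

theorem contactForm_e_ne_zero (h : D.contactForm ≠ 0) : D.contactForm D.e ≠ 0 := by
  have h1 := (D.contactForm.toAlternatingMap.map_basis_ne_zero_iff
    (Module.Basis.mk D.linearIndependent_e D.span_e)).mpr fun h0 => h (by
      ext v
      exact congrArg (fun f => f v) h0)
  rwa [Module.Basis.coe_mk] at h1

/-- The transverse Hodge star `*(η ∧ α)` of an `m`-form, as a form of degree `q = 2n - m`. -/
def starForm {m q : ℕ} (h : m + q = 2 * n) (α : V [⋀^Fin m]→L[ℝ] ℝ) : V [⋀^Fin q]→L[ℝ] ℝ :=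
  hodgeOfFrame (r := 1 + m) (by omega) D.e D.volForm (wedge D.η α)

theorem starForm_apply {m q : ℕ} (h : m + q = 2 * n) (α : V [⋀^Fin m]→L[ℝ] ℝ) (v : Fin q → V) :
    D.starForm h α v = (m.factorial : ℝ)⁻¹ * ∑ j : Fin m → Fin (1 + 2 * n),
      α (D.e ∘ j) * contractRight h v (contractLeft rfl ![D.ξ] D.volForm) (D.e ∘ j) := by
  have hX := D.sum_flat_smul D.ξ
  rw [flat_ξ] at hX
  exact hodgeOfFrame_wedge h D.e D.volForm D.η hX α v

/-- The transverse Hodge star of an inhomogeneous form. -/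
def starAux (α : ExtAlg V) : ExtAlg V := fun q =>
  if h : q ≤ 2 * n then D.starForm (m := 2 * n - q) (by omega) (α (2 * n - q)) else 0

theorem starAux_apply {m q : ℕ} (h : m + q = 2 * n) (α : ExtAlg V) :
    D.starAux α q = D.starForm h (α m) := by
  obtain rfl : m = 2 * n - q := by omega
  exact dif_pos (by omega)

theorem starAux_apply_of_lt {q : ℕ} (h : 2 * n < q) (α : ExtAlg V) : D.starAux α q = 0 :=
  dif_neg (by omega)

/-- The transverse Hodge star as an operator on inhomogeneous forms. -/
def starOp : Module.End ℝ (ExtAlg V) where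
  toFun := D.starAux
  map_add' α β := ExtAlg.ext fun q => by
    rw [ExtAlg.add_apply]
    by_cases h : q ≤ 2 * n
    · have hm : 2 * n - q + q = 2 * n := by omega
      rw [D.starAux_apply hm, D.starAux_apply hm, D.starAux_apply hm]
      ext v
      simp only [starForm_apply, ExtAlg.add_apply, ContinuousAlternatingMap.add_apply, add_mul,
        Finset.sum_add_distrib, mul_add]
    · have h' : 2 * n < q := by omega
      rw [D.starAux_apply_of_lt h', D.starAux_apply_of_lt h', D.starAux_apply_of_lt h', add_zero]
  map_smul' c α := ExtAlg.ext fun q => by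
    rw [ExtAlg.smul_apply]
    by_cases h : q ≤ 2 * n
    · have hm : 2 * n - q + q = 2 * n := by omega
      rw [D.starAux_apply hm, D.starAux_apply hm]
      ext v
      simp only [starForm_apply, ExtAlg.smul_apply, ContinuousAlternatingMap.smul_apply,
        smul_eq_mul, Finset.mul_sum, RingHom.id_apply]
      exact Finset.sum_congr rfl fun _ _ => by ring
    · have h' : 2 * n < q := by omega
      rw [D.starAux_apply_of_lt h', D.starAux_apply_of_lt h', smul_zero]

theorem starOp_apply {m q : ℕ} (h : m + q = 2 * n) (α : ExtAlg V) :
    D.starOp α q = D.starForm h (α m) := D.starAux_apply h α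

theorem starOp_apply_of_lt {q : ℕ} (h : 2 * n < q) (α : ExtAlg V) : D.starOp α q = 0 :=
  D.starAux_apply_of_lt h α

/-- The Hodge star turns exterior multiplication by `g(X, ·)` into interior multiplication
by `X`. -/
theorem starOp_wOp (X : V) :
    D.starOp * wOp (D.flat X) = iOp X * (signOp * D.starOp) := by
  refine LinearMap.ext fun α => ExtAlg.ext fun q => ?_
  simp only [Module.End.mul_apply, iOp_apply, signOp_apply]
  by_cases hq : q + 1 ≤ 2 * n
  · obtain ⟨m, hm⟩ : ∃ m, m + (q + 1) = 2 * n := ⟨2 * n - (q + 1), by omega⟩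
    rw [D.starOp_apply hm, D.starOp_apply (m := m + 1) (by omega), wOp_apply_succ]
    ext v
    rw [interior_apply, ContinuousAlternatingMap.smul_apply, starForm_apply, starForm_apply,
      sum_wedgeOne_mul D.e _ (D.sum_flat_smul X)]
    have h1 : ∀ j : Fin m → Fin (1 + 2 * n),
        contractRight hm (Matrix.vecCons X v) (contractLeft rfl ![D.ξ] D.volForm) (D.e ∘ j) =
        (-1) ^ m * contractRight (r := m + 1) (by omega) v (contractLeft rfl ![D.ξ] D.volForm)
          (Matrix.vecCons X (D.e ∘ j)) := by
      intro j
      rw [contractRight_apply, contractLeft_vecCons]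
      rfl
    have h2 : (-1 : ℝ) ^ (q + 1) * (-1) ^ m = 1 := by
      rw [← pow_add, add_comm, hm, pow_mul]
      simp
    have h3 : ((m + 1).factorial : ℝ)⁻¹ * (m + 1) = (m.factorial : ℝ)⁻¹ := by
      rw [Nat.factorial_succ]
      push_cast
      have : (m : ℝ) + 1 ≠ 0 := by positivity
      field_simp
    simp only [h1, smul_eq_mul]
    rw [← mul_assoc, h3, mul_left_comm]
    congr 1
    rw [Finset.mul_sum]
    refine Finset.sum_congr rfl fun j _ => ?_
    linear_combination (-(α m (D.e ∘ j) * contractRight (r := m + 1) (by omega) v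
      (contractLeft rfl ![D.ξ] D.volForm) (Matrix.vecCons X (D.e ∘ j)))) * h2
  · rw [D.starOp_apply_of_lt (q := q + 1) (by omega), smul_zero]
    have h0 : D.starOp (wOp (D.flat X) α) q = 0 := by
      by_cases h : q ≤ 2 * n
      · rw [D.starOp_apply (m := 0) (by omega), wOp_apply_zero]
        ext v
        rw [starForm_apply]
        simp
      · exact D.starOp_apply_of_lt (by omega) _
    rw [h0]
    rfl

theorem L_pow_unitForm_self (k : ℕ) :
    (D.L ^ k) (unitForm : ExtAlg V) (2 * k) = wedgePow D.Ω k := by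
  induction k with
  | zero => rfl
  | succ k ih =>
    rw [pow_succ', Module.End.mul_apply]
    change wedge ((D.L ^ k) unitForm (2 * k)) D.Ω = _
    rw [ih]
    rfl

theorem contractLeft_contactForm : contractLeft rfl ![D.ξ] D.contactForm = wedgePow D.Ω n := by
  have h1 := congrArg (fun T => T ((D.L ^ n) (unitForm : ExtAlg V)) (2 * n)) (iOp_wOp D.ξ D.η)
  simp only [Module.End.mul_apply, LinearMap.sub_apply, D.mem_Hor.mp (D.L_pow_unitForm_mem_Hor n),
    map_zero, sub_zero, D.η_ξ, one_smul, Module.End.one_apply, iOp_apply, wOp_apply_succ,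
    L_pow_unitForm_self] at h1
  rw [← h1]
  ext v
  rw [interior_apply]
  change wedge D.η (wedgePow D.Ω n) _ = _
  rw [wedge_oneForm_left]
  refine congrArg _ (funext fun k => ?_)
  simp only [Function.comp_apply, append_eq_ite, vecCons_eq_ite, Fin.val_cast]
  split_ifs <;> first | rfl | omega

theorem contractLeft_volForm : contractLeft rfl ![D.ξ] D.volForm =
    |D.contactForm D.e|⁻¹ • wedgePow D.Ω n := by
  rw [← contractLeft_contactForm]
  rfl

theorem starOp_unitForm :
    D.starOp unitForm = |D.contactForm D.e|⁻¹ • (D.L ^ n) (unitForm : ExtAlg V) := by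
  refine ExtAlg.ext fun q => ?_
  rw [ExtAlg.smul_apply]
  by_cases hq : q = 2 * n
  · subst hq
    rw [D.starOp_apply (m := 0) (by omega), L_pow_unitForm_self, ← contractLeft_volForm]
    ext v
    rw [starForm_apply]
    have h1 : ∀ u : Fin 0 → V, (unitForm : ExtAlg V) 0 u = 1 := fun u => rfl
    simp only [h1, Fintype.sum_unique, one_mul, Nat.factorial_zero, Nat.cast_one, inv_one]
    rw [contractRight_apply]
    refine congrArg (contractLeft rfl ![D.ξ] D.volForm) (funext fun k => ?_)
    simp only [append_eq_ite, Fin.val_cast]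
    split_ifs with h
    · exact absurd h (by omega)
    · rfl
  · rw [L_pow_unitForm_apply D n q hq, smul_zero]
    by_cases h : q ≤ 2 * n
    · obtain ⟨m, hm⟩ : ∃ m, (m + 1) + q = 2 * n := ⟨2 * n - q - 1, by omega⟩
      rw [D.starOp_apply hm]
      have h0 : (unitForm : ExtAlg V) (m + 1) = 0 := rfl
      rw [h0]
      ext v
      rw [starForm_apply]
      simp
    · exact D.starOp_apply_of_lt (by omega) _

theorem starOp_L_pow_unitForm (h : D.contactForm ≠ 0) :
    D.starOp ((D.L ^ n) (unitForm : ExtAlg V)) = |D.contactForm D.e| • unitForm := by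
  refine ExtAlg.ext fun q => ?_
  rw [ExtAlg.smul_apply]
  cases q with
  | zero =>
    rw [D.starOp_apply (m := 2 * n) (by omega), L_pow_unitForm_self]
    ext v
    rw [starForm, hodgeOfFrame_apply]
    have h1 : ∀ i : Fin (1 + 2 * n) → Fin (1 + 2 * n),
        contractRight (r := 1 + 2 * n) (q := 0) (by omega) v D.volForm (D.e ∘ i) =
          D.volForm (D.e ∘ i) := by
      intro i
      rw [contractRight_apply]
      refine congrArg D.volForm (funext fun k => ?_)
      simp only [append_eq_ite, Fin.val_cast]
      have := k.isLt
      rw [dif_pos (by omega)]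
    simp only [h1]
    have h2 := sum_mul_comp D.e D.contactForm.toAlternatingMap D.volForm.toAlternatingMap
    have h3 : ((1 + 2 * n).factorial : ℝ) ≠ 0 := by positivity
    have h4 : D.volForm D.e = |D.contactForm D.e|⁻¹ * D.contactForm D.e := rfl
    have h5 : D.contactForm D.e * D.contactForm D.e = |D.contactForm D.e| * |D.contactForm D.e| :=
      (abs_mul_abs_self _).symm
    have h6 : |D.contactForm D.e| ≠ 0 := abs_ne_zero.mpr (D.contactForm_e_ne_zero h)
    have h7 : (unitForm : ExtAlg V) 0 v = 1 := rfl
    refine (congrArg (((1 + 2 * n).factorial : ℝ)⁻¹ * ·) h2).trans ?_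
    rw [ContinuousAlternatingMap.smul_apply, h7, inv_mul_cancel_left₀ h3]
    change D.contactForm D.e * D.volForm D.e = _
    rw [h4, mul_left_comm, h5, inv_mul_cancel_left₀ h6, smul_eq_mul, mul_one]
  | succ q =>
    have h0 : (unitForm : ExtAlg V) (q + 1) = 0 := rfl
    rw [h0, smul_zero]
    by_cases hq : q + 1 ≤ 2 * n
    · obtain ⟨m, hm⟩ : ∃ m, m + (q + 1) = 2 * n := ⟨2 * n - (q + 1), by omega⟩
      rw [D.starOp_apply hm, L_pow_unitForm_apply D n m (by omega)]
      ext v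
      rw [starForm_apply]
      simp
    · exact D.starOp_apply_of_lt (by omega) _

/-- On horizontal forms, the transverse Hodge star is a twisted Weyl element. -/
theorem starOp_eq (h : D.contactForm ≠ 0) {α : ExtAlg V} (hα : α ∈ D.Hor) :
    D.starOp α = (-1 : ℝ) ^ n • D.W α :=
  D.star_eq (fun X _ => D.starOp_wOp X) (abs_pos.mpr (D.contactForm_e_ne_zero h))
    D.starOp_unitForm (D.starOp_L_pow_unitForm h) hα

end ContactModule

/-! ### Exterior multiplication by a closed `2`-form -/

section ClosedTwoForm

open KContactStructure

variable {V : Type*} [AddCommGroup V] [Module ℝ V] [TopologicalSpace V]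

theorem wedge_add_right {p q : ℕ} (α : V [⋀^Fin p]→L[ℝ] ℝ) (β γ : V [⋀^Fin q]→L[ℝ] ℝ) :
    wedge α (β + γ) = wedge α β + wedge α γ := by
  ext v
  simp only [wedge_apply, ContinuousAlternatingMap.add_apply, mul_add, altSum,
    Finset.sum_add_distrib]

theorem wedge_smul_right {p q : ℕ} (c : ℝ) (α : V [⋀^Fin p]→L[ℝ] ℝ) (β : V [⋀^Fin q]→L[ℝ] ℝ) :
    wedge α (c • β) = c • wedge α β := by
  ext v
  simp only [wedge_apply, ContinuousAlternatingMap.smul_apply, smul_eq_mul, mul_left_comm _ c,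
    altSum_const_mul]

/-- The operator `α ↦ α ∧ Ω` as a linear function of the `2`-form `Ω`. -/
def lOpLin : (V [⋀^Fin 2]→L[ℝ] ℝ) →ₗ[ℝ] Module.End ℝ (ExtAlg V) where
  toFun := lOp
  map_add' Ω Ω' := LinearMap.ext fun α => ExtAlg.ext fun p => by
    match p with
    | 0 => exact (add_zero 0).symm
    | 1 => exact (add_zero 0).symm
    | p + 2 => exact wedge_add_right (α p) Ω Ω'
  map_smul' c Ω := LinearMap.ext fun α => ExtAlg.ext fun p => by
    match p with
    | 0 => exact (smul_zero c).symm
    | 1 => exact (smul_zero c).symm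
    | p + 2 => exact wedge_smul_right c (α p) Ω

theorem lOpLin_apply (Ω : V [⋀^Fin 2]→L[ℝ] ℝ) : lOpLin Ω = lOp Ω := rfl

/-- If the `2`-form `Ω` with directional derivatives `Θ X` is closed, then
`∑ₖ θₖ ∧ α ∧ Θ(eₖ)`, which is `± α ∧ dΩ`, vanishes. -/
theorem sum_wOp_lOp_eq_zero {κ : Type*} [Fintype κ] (e : κ → V) (θ : κ → V [⋀^Fin 1]→L[ℝ] ℝ)
    (he : ∀ v, v = ∑ k, θ k ![v] • e k) (Θ : V →ₗ[ℝ] V [⋀^Fin 2]→L[ℝ] ℝ)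
    (hΘ : ∀ X Y Z, Θ X ![Y, Z] = Θ Y ![X, Z] - Θ Z ![X, Y]) :
    ∑ k, wOp (θ k) * lOp (Θ (e k)) = 0 := by
  refine eq_zero_of_contractions _ (-1) (fun α => ?_) fun X => ?_
  · simp [LinearMap.sum_apply, ExtAlg.sum_apply, wOp_apply_zero]
  set R := ∑ k, wOp (θ k) * wOp (interior X (Θ (e k))) with hR
  have hX : lOp (Θ X) = ∑ k, θ k ![X] • lOp (Θ (e k)) := by
    conv_lhs => rw [he X]
    simp only [← lOpLin_apply, map_sum, map_smul]
  have hi : ∀ k, interior (e k) (Θ X) = interior X (Θ (e k)) -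
      ∑ j, interior X (Θ (e j)) ![e k] • θ j := by
    intro k
    ext v
    obtain ⟨z, rfl⟩ : ∃ z, v = ![z] := ⟨v 0, by
      funext i
      rw [Subsingleton.elim i 0]
      rfl⟩
    have h1 : Θ z ![X, e k] = ∑ j, θ j ![z] * Θ (e j) ![X, e k] := by
      conv_lhs => rw [he z]
      simp only [map_sum, map_smul, ContinuousAlternatingMap.sum_apply,
        ContinuousAlternatingMap.smul_apply, smul_eq_mul]
    rw [ContinuousAlternatingMap.sub_apply, ContinuousAlternatingMap.sum_apply]
    change Θ X ![e k, z] = Θ (e k) ![X, z] - ∑ j, Θ (e j) ![X, e k] * θ j ![z]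
    rw [hΘ X, h1]
    exact congrArg _ (Finset.sum_congr rfl fun j _ => mul_comm _ _)
  have hL : lOp (Θ X) = R := by
    have h2 : ∑ k, wOp (θ k) * wOp (∑ j, interior X (Θ (e j)) ![e k] • θ j) = -R := by
      have h3 : ∀ j, wOp (interior X (Θ (e j))) =
          ∑ k, interior X (Θ (e j)) ![e k] • wOp (θ k) := fun j => by
        conv_lhs => rw [oneForm_eq_sum e θ he (interior X (Θ (e j)))]
        simp only [map_sum, map_smul]
      simp only [hR, map_sum, map_smul, Finset.mul_sum, ← Finset.sum_neg_distrib]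
      rw [Finset.sum_comm]
      refine Finset.sum_congr rfl fun j _ => ?_
      rw [wOp_wOp, neg_neg, h3, Finset.sum_mul]
      exact Finset.sum_congr rfl fun k _ => by rw [mul_smul_comm, smul_mul_assoc]
    rw [lOp_eq_sum e θ he]
    simp only [hi, map_sub, mul_sub, Finset.sum_sub_distrib]
    rw [h2, sub_neg_eq_add, ← hR, ← two_smul ℝ, smul_smul, inv_mul_cancel₀ two_ne_zero, one_smul]
  have hk : ∀ k, iOp X * (wOp (θ k) * lOp (Θ (e k))) = θ k ![X] • lOp (Θ (e k)) -
      wOp (θ k) * lOp (Θ (e k)) * iOp X - wOp (θ k) * wOp (interior X (Θ (e k))) := by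
    intro k
    rw [← mul_assoc, iOp_wOp, sub_mul, mul_assoc, iOp_lOp e θ he, mul_add, smul_mul_assoc, one_mul,
      mul_assoc, sub_sub]
  rw [Finset.mul_sum, Finset.sum_congr rfl fun k _ => hk k, Finset.sum_sub_distrib,
    Finset.sum_sub_distrib, ← hX, hL, ← hR, ← Finset.sum_mul, neg_one_smul]
  abel

end ClosedTwoForm

/-! ### Differential forms on a vector space -/

section VectorSpace

open KContactStructure

variable {E : Type*} [NormedAddCommGroup E] [NormedSpace ℝ E]

section

variable {D : Type*} [NormedAddCommGroup D] [NormedSpace ℝ D] {s : Set D}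

/-- A family of forms is smooth if its values on constant vectors are. -/
theorem contDiffOn_form [FiniteDimensional ℝ E] {p : ℕ} {f : D → E [⋀^Fin p]→L[ℝ] ℝ}
    (h : ∀ v, ContDiffOn ℝ ∞ (fun y => f y v) s) : ContDiffOn ℝ ∞ f s := by
  induction p with
  | zero =>
    have e : f = fun y => ContinuousAlternatingMap.constOfIsEmptyLIE ℝ E ℝ (Fin 0) (f y ![]) := by
      funext y
      ext v
      rw [Subsingleton.elim v ![]]
      rfl
    rw [e]
    exact (ContinuousAlternatingMap.constOfIsEmptyLIE ℝ E ℝ (Fin 0)).contDiff.comp_contDiffOn (h _)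
  | succ p ih =>
    have e : f = fun y => ((p : ℝ) + 1)⁻¹ •
        ContinuousAlternatingMap.alternatizeUncurryFinCLM ℝ E ℝ (f y).curryLeft := by
      funext y
      rw [ContinuousAlternatingMap.alternatizeUncurryFinCLM_apply,
        ContinuousAlternatingMap.alternatizeUncurryFin_curryLeft, ← Nat.cast_smul_eq_nsmul ℝ,
        smul_smul]
      push_cast
      rw [inv_mul_cancel₀ (by positivity), one_smul]
    rw [e]
    have h1 : ContDiffOn ℝ ∞ (fun y => (f y).curryLeft) s :=
      contDiffOn_clm_apply.mpr fun x => ih fun v => h (Matrix.vecCons x v)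
    have h2 : ContDiffOn ℝ ∞ (fun y =>
        ContinuousAlternatingMap.alternatizeUncurryFinCLM ℝ E ℝ (f y).curryLeft) s := by
      fun_prop
    exact h2.const_smul _

theorem ContDiffWithinAt.form_apply {p : ℕ} {f : D → E [⋀^Fin p]→L[ℝ] ℝ} {y : D}
    (hf : ContDiffWithinAt ℝ ∞ f s y) {g : Fin p → D → E}
    (hg : ∀ i, ContDiffWithinAt ℝ ∞ (g i) s y) :
    ContDiffWithinAt ℝ ∞ (fun y => f y fun i => g i y) s y := by
  induction p with
  | zero =>
    have e : (fun y => f y fun i => g i y) = fun y =>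
        (ContinuousAlternatingMap.constOfIsEmptyLIE ℝ E ℝ (Fin 0)).symm (f y) := by
      funext y
      exact congrArg (f y) (Subsingleton.elim _ _)
    rw [e]
    exact (ContinuousAlternatingMap.constOfIsEmptyLIE ℝ E ℝ
      (Fin 0)).symm.contDiff.comp_contDiffWithinAt hf
  | succ p ih =>
    have hc : ContDiff ℝ ∞ fun γ : E [⋀^Fin (p + 1)]→L[ℝ] ℝ =>
        (ContinuousAlternatingMap.curryLeftLI (𝕜 := ℝ) (E := E) (F := ℝ) (n := p)) γ := by
      fun_prop
    have h0 : ContDiffWithinAt ℝ ∞ (fun y => (f y).curryLeft) s y :=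
      hc.comp_contDiffWithinAt hf
    have h1 : ContDiffWithinAt ℝ ∞ (fun y => (f y).curryLeft (g 0 y)) s y := h0.clm_apply (hg 0)
    have e : (fun y => f y fun i => g i y) =
        fun y => (f y).curryLeft (g 0 y) fun i => g i.succ y := by
      funext y
      refine congrArg (f y) (funext fun i => ?_)
      cases i using Fin.cases <;> rfl
    rw [e]
    exact ih h1 fun i => hg i.succ

theorem ContDiffAt.form_apply {p : ℕ} {f : D → E [⋀^Fin p]→L[ℝ] ℝ} {y : D}
    (hf : ContDiffAt ℝ ∞ f y) {g : Fin p → D → E} (hg : ∀ i, ContDiffAt ℝ ∞ (g i) y) :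
    ContDiffAt ℝ ∞ (fun y => f y fun i => g i y) y :=
  ContDiffWithinAt.form_apply hf hg

theorem ContDiffOn.form_apply {p : ℕ} {f : D → E [⋀^Fin p]→L[ℝ] ℝ} (hf : ContDiffOn ℝ ∞ f s)
    {g : Fin p → D → E} (hg : ∀ i, ContDiffOn ℝ ∞ (g i) s) :
    ContDiffOn ℝ ∞ (fun y => f y fun i => g i y) s := fun y hy =>
  ContDiffWithinAt.form_apply (hf y hy) fun i => hg i y hy

/-- The Leibniz rule for the evaluation of a form on vector fields. -/
theorem fderiv_form_apply {p : ℕ} {f : D → E [⋀^Fin p]→L[ℝ] ℝ} {y : D}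
    (hf : DifferentiableAt ℝ f y) {g : Fin p → D → E} (hg : ∀ i, DifferentiableAt ℝ (g i) y)
    (u : D) :
    fderiv ℝ (fun y => f y fun i => g i y) y u = fderiv ℝ f y u (fun i => g i y) +
      ∑ i, f y (Function.update (fun j => g j y) i (fderiv ℝ (g i) y u)) := by
  let T : (E [⋀^Fin p]→L[ℝ] ℝ) →L[ℝ] ContinuousMultilinearMap ℝ (fun _ : Fin p => E) ℝ :=
    ContinuousAlternatingMap.toContinuousMultilinearMapCLM ℝ
  have h1 : HasFDerivAt (fun y => T (f y)) (T ∘L fderiv ℝ f y) y :=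
    T.hasFDerivAt.comp y hf.hasFDerivAt
  have h2 := (h1.continuousMultilinearMap_apply fun i => (hg i).hasFDerivAt).fderiv
  refine (congrArg (fun T => T u) h2).trans ?_
  simp only [add_apply, sum_apply, ContinuousLinearMap.comp_apply]
  rfl

end

/-- The constant `1`-forms dual to a basis of the vector space. -/
def coordForm [FiniteDimensional ℝ E] (k : Fin (Module.finrank ℝ E)) : E [⋀^Fin 1]→L[ℝ] ℝ :=
  ContinuousAlternatingMap.ofSubsingleton ℝ E ℝ (0 : Fin 1)
    (LinearMap.toContinuousLinearMap ((Module.finBasis ℝ E).coord k))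

theorem coordForm_apply [FiniteDimensional ℝ E] (k : Fin (Module.finrank ℝ E)) (v : E) :
    coordForm k ![v] = (Module.finBasis ℝ E).coord k v := rfl

theorem eq_sum_coordForm [FiniteDimensional ℝ E] (v : E) :
    v = ∑ k, coordForm k ![v] • Module.finBasis ℝ E k := by
  simp only [coordForm_apply]
  exact ((Module.finBasis ℝ E).sum_repr v).symm

/-- The exterior derivative is `∑ₖ θₖ ∧ ∂ₖ α`. -/
theorem extDeriv_eq_sum [FiniteDimensional ℝ E] {p : ℕ} (f : E → E [⋀^Fin p]→L[ℝ] ℝ) (y : E) :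
    extDeriv f y = ∑ k, wedgeOne (coordForm k) (fderiv ℝ f y (Module.finBasis ℝ E k)) := by
  ext v
  rw [extDeriv, ContinuousAlternatingMap.alternatizeUncurryFin_apply,
    ContinuousAlternatingMap.sum_apply]
  simp only [wedgeOne_apply]
  rw [Finset.sum_comm]
  refine Finset.sum_congr rfl fun i _ => ?_
  conv_lhs => rw [eq_sum_coordForm (v i)]
  rw [map_sum, ContinuousAlternatingMap.sum_apply, Finset.smul_sum]
  refine Finset.sum_congr rfl fun k _ => ?_
  rw [map_smul, ContinuousAlternatingMap.smul_apply, smul_eq_mul]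
  exact zsmul_eq_mul _ _ |>.trans (by push_cast; rfl)

theorem contDiffOn_wedge [FiniteDimensional ℝ E] {p q : ℕ} {s : Set E}
    {α : E → E [⋀^Fin p]→L[ℝ] ℝ} {β : E → E [⋀^Fin q]→L[ℝ] ℝ} (hα : ContDiffOn ℝ ∞ α s)
    (hβ : ContDiffOn ℝ ∞ β s) : ContDiffOn ℝ ∞ (fun y => wedge (α y) (β y)) s := by
  refine contDiffOn_form fun v => ?_
  simp only [wedge_apply, altSum]
  refine contDiffOn_const.mul (ContDiffOn.sum fun t _ => contDiffOn_const.mul ?_)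
  exact (ContDiffOn.form_apply hα fun _ => contDiffOn_const).mul
    (ContDiffOn.form_apply hβ fun _ => contDiffOn_const)

theorem fderiv_wedge [FiniteDimensional ℝ E] {p q : ℕ} {s : Set E} (hs : IsOpen s)
    {α : E → E [⋀^Fin p]→L[ℝ] ℝ} {β : E → E [⋀^Fin q]→L[ℝ] ℝ} (hα : ContDiffOn ℝ ∞ α s)
    (hβ : ContDiffOn ℝ ∞ β s) {y : E} (hy : y ∈ s) (u : E) :
    fderiv ℝ (fun y => wedge (α y) (β y)) y u =
      wedge (fderiv ℝ α y u) (β y) + wedge (α y) (fderiv ℝ β y u) := by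
  have hn : s ∈ 𝓝 y := hs.mem_nhds hy
  have hα' : DifferentiableAt ℝ α y := (hα.contDiffAt hn).differentiableAt (by simp)
  have hβ' : DifferentiableAt ℝ β y := (hβ.contDiffAt hn).differentiableAt (by simp)
  have hw : DifferentiableAt ℝ (fun y => wedge (α y) (β y)) y :=
    ((contDiffOn_wedge hα hβ).contDiffAt hn).differentiableAt (by simp)
  ext v
  rw [← fderiv_continuousAlternatingMap_apply_const_apply hw]
  simp only [wedge_apply, altSum]
  have hα1 : ∀ a, HasFDerivAt (fun y => α y a) (fderiv ℝ (fun y => α y a) y) y := fun a =>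
    (hα'.continuousAlternatingMap_apply_const a).hasFDerivAt
  have hβ1 : ∀ a, HasFDerivAt (fun y => β y a) (fderiv ℝ (fun y => β y a) y) y := fun a =>
    (hβ'.continuousAlternatingMap_apply_const a).hasFDerivAt
  have h1 := (HasFDerivAt.const_mul (HasFDerivAt.fun_sum (u := Finset.univ)
    fun (t : Equiv.Perm (Fin (p + q))) _ =>
    ((hα1 fun i => (v ∘ t) (Fin.castAdd q i)).fun_mul
      (hβ1 fun i => (v ∘ t) (Fin.natAdd p i))).const_mul ((Equiv.Perm.sign t : ℤ) : ℝ))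
        ((p.factorial * q.factorial : ℝ)⁻¹)).fderiv
  refine (congrArg (fun T => T u) h1).trans ?_
  rw [ContinuousAlternatingMap.add_apply, wedge_apply, wedge_apply, altSum, altSum, ← mul_add,
    ← Finset.sum_add_distrib]
  simp only [smul_apply, sum_apply, add_apply, smul_eq_mul,
    fderiv_continuousAlternatingMap_apply_const_apply hα',
    fderiv_continuousAlternatingMap_apply_const_apply hβ']
  congr 1
  exact Finset.sum_congr rfl fun t _ => by ring

/-- If `β` is a closed `2`-form then `d(α ∧ β) = dα ∧ β`. -/
theorem extDeriv_wedge_of_closed [FiniteDimensional ℝ E] {p : ℕ} {s : Set E} (hs : IsOpen s)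
    {α : E → E [⋀^Fin p]→L[ℝ] ℝ} {β : E → E [⋀^Fin 2]→L[ℝ] ℝ} (hα : ContDiffOn ℝ ∞ α s)
    (hβ : ContDiffOn ℝ ∞ β s) {y : E} (hy : y ∈ s) (hd : extDeriv β y = 0) :
    extDeriv (fun y => wedge (α y) (β y)) y = wedge (extDeriv α y) (β y) := by
  have hβ' : DifferentiableAt ℝ β y := (hβ.contDiffAt (hs.mem_nhds hy)).differentiableAt (by simp)
  have hΘ : ∀ X Y Z, fderiv ℝ β y X ![Y, Z] =
      fderiv ℝ β y Y ![X, Z] - fderiv ℝ β y Z ![X, Y] := by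
    intro X Y Z
    have h := congrArg (fun γ => γ ![X, Y, Z]) hd
    simp only [extDeriv_apply hβ', fderiv_continuousAlternatingMap_apply_const_apply hβ'] at h
    change ∑ x : Fin 3, _ = (0 : ℝ) at h
    rw [Fin.sum_univ_three] at h
    have e0 : Fin.removeNth 0 ![X, Y, Z] = ![Y, Z] := by
      funext i; fin_cases i <;> rfl
    have e1 : Fin.removeNth 1 ![X, Y, Z] = ![X, Z] := by
      funext i; fin_cases i <;> rfl
    have e2 : Fin.removeNth 2 ![X, Y, Z] = ![X, Y] := by
      funext i; fin_cases i <;> rfl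
    rw [e0, e1, e2] at h
    simp at h
    linarith
  have hz := sum_wOp_lOp_eq_zero (V := E) (Module.finBasis ℝ E) coordForm eq_sum_coordForm
    (fderiv ℝ β y : E →ₗ[ℝ] E [⋀^Fin 2]→L[ℝ] ℝ) hΘ
  -- Any `p`-form is the degree `p` part of an inhomogeneous form.
  have hp : ∀ γ : E [⋀^Fin p]→L[ℝ] ℝ, ∃ δ : ExtAlg E, δ p = γ := fun γ =>
    ⟨fun q => if h : p = q then h ▸ γ else 0, by simp⟩
  have h1 : ∑ k, wedgeOne (coordForm k)
      (wedge (α y) (fderiv ℝ β y (Module.finBasis ℝ E k))) = 0 := by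
    obtain ⟨δ, hδ⟩ := hp (α y)
    have h := congrArg (fun T => T δ (p + 3)) hz
    simp only [LinearMap.sum_apply, ExtAlg.sum_apply, Module.End.mul_apply] at h
    rw [← hδ]
    exact h
  have h2 : ∀ k, wedgeOne (coordForm k)
      (wedge (fderiv ℝ α y (Module.finBasis ℝ E k)) (β y)) =
      wedge (wedgeOne (coordForm k) (fderiv ℝ α y (Module.finBasis ℝ E k))) (β y) := by
    intro k
    obtain ⟨δ, hδ⟩ := hp (fderiv ℝ α y (Module.finBasis ℝ E k))
    have h := congrArg (fun T => T δ (p + 3))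
      (lOp_wOp (V := E) (Module.finBasis ℝ E) coordForm eq_sum_coordForm (β y) (coordForm k))
    rw [← hδ]
    exact h.symm
  have h3 : wedge (∑ k, wedgeOne (coordForm k) (fderiv ℝ α y (Module.finBasis ℝ E k))) (β y) =
      ∑ k, wedge (wedgeOne (coordForm k) (fderiv ℝ α y (Module.finBasis ℝ E k))) (β y) :=
    map_sum ({ toFun := fun γ => wedge γ (β y)
               map_zero' := by simpa using wedge_smul_left (0 : ℝ) 0 (β y)
               map_add' := fun γ δ => wedge_add_left γ δ (β y) } :
      (E [⋀^Fin (p + 1)]→L[ℝ] ℝ) →+ (E [⋀^Fin (p + 1 + 2)]→L[ℝ] ℝ)) _ _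
  rw [extDeriv_eq_sum, extDeriv_eq_sum α, h3, ← Finset.sum_congr rfl fun k _ => h2 k]
  simp only [fderiv_wedge hs hα hβ hy, wedgeOne_add_right, Finset.sum_add_distrib, h1, add_zero]

/-- Cartan's formula for a form with `ι_ξ α = 0`. -/
theorem extDeriv_vecCons_of_horizontal {p : ℕ} {s : Set E} (hs : IsOpen s)
    {α : E → E [⋀^Fin p]→L[ℝ] ℝ} {ξ : E → E} (hα : ContDiffOn ℝ ∞ α s) (hξ : ContDiffOn ℝ ∞ ξ s)
    (hz : ∀ y ∈ s, ∀ v : Fin p → E, (∃ i, v i = ξ y) → α y v = 0) {y : E} (hy : y ∈ s)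
    {X : Fin p → E → E} (hX : ∀ i, DifferentiableAt ℝ (X i) y) :
    extDeriv α y (Matrix.vecCons (ξ y) fun i => X i y) =
      fderiv ℝ (fun z => α z fun i => X i z) y (ξ y) -
        ∑ i, α y (Function.update (fun j => X j y) i (VectorField.lieBracket ℝ ξ (X i) y)) := by
  have hn : s ∈ 𝓝 y := hs.mem_nhds hy
  have hα' : DifferentiableAt ℝ α y := (hα.contDiffAt hn).differentiableAt (by simp)
  have hξ' : DifferentiableAt ℝ ξ y := (hξ.contDiffAt hn).differentiableAt (by simp)
  rw [fderiv_form_apply hα' hX, extDeriv, ContinuousAlternatingMap.alternatizeUncurryFin_apply,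
    Fin.sum_univ_succ]
  have h0 : ∀ (i : Fin p), (-1 : ℤ) ^ (i.succ : ℕ) • fderiv ℝ α y (X i y)
      (Fin.removeNth i.succ (Matrix.vecCons (ξ y) fun i => X i y)) =
      α y (Function.update (fun j => X j y) i (fderiv ℝ ξ y (X i y))) := by
    intro i
    obtain ⟨p, rfl⟩ : ∃ q, p = q + 1 := ⟨p - 1, by have := i.isLt; omega⟩
    have e1 : ∀ x : E, Fin.removeNth i.succ (Matrix.vecCons x fun i => X i y) =
        Matrix.vecCons x (Fin.removeNth i fun j => X j y) := by
      intro x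
      funext j
      cases j using Fin.cases <;> simp [Fin.removeNth]
    set r : Fin p → E := Fin.removeNth i fun j => X j y with hr
    -- `α(ξ, ·)` vanishes identically, and so does its derivative.
    have h1 := fderiv_form_apply hα'
      (g := Fin.cons ξ fun j _ => r j)
      (fun j => by cases j using Fin.cases <;> simp [hξ']) (X i y)
    have e2 : ∀ z, (fun j => (Fin.cons ξ fun j _ => r j : Fin (p + 1) → E → E) j z) =
        Matrix.vecCons (ξ z) r := by
      intro z
      funext j
      cases j using Fin.cases <;> rfl
    have h2 : (fun z => α z fun j => (Fin.cons ξ fun j _ => r j : Fin (p + 1) → E → E) j z) =ᶠ[𝓝 y]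
        fun _ => 0 := by
      filter_upwards [hn] with z hz'
      exact hz z hz' _ ⟨0, rfl⟩
    rw [h2.fderiv_eq, Fin.sum_univ_succ, Finset.sum_eq_zero fun j _ => by simp] at h1
    simp only [e2] at h1
    have e3 : Function.update (Matrix.vecCons (ξ y) r) 0 (fderiv ℝ ξ y (X i y)) =
        Matrix.vecCons (fderiv ℝ ξ y (X i y)) r := by
      funext j
      cases j using Fin.cases <;> simp
    simp only [Fin.cons_zero, e3, fderiv_fun_const, add_zero] at h1
    have h3 := (α y).toAlternatingMap.map_insertNth i (fderiv ℝ ξ y (X i y)) r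
    have e4 : Fin.insertNth (α := fun _ => E) i (fderiv ℝ ξ y (X i y)) r =
        Function.update (fun j => X j y) i (fderiv ℝ ξ y (X i y)) := by
      rw [hr, Fin.insertNth_removeNth]
    rw [e4] at h3
    refine Eq.trans ?_ h3.symm
    have h4 : fderiv ℝ α y (X i y) (Matrix.vecCons (ξ y) r) =
        -α y (Matrix.vecCons (fderiv ℝ ξ y (X i y)) r) :=
      eq_neg_of_add_eq_zero_left h1.symm
    rw [e1, h4, Fin.val_succ, pow_succ]
    simp
  have h5 : ∀ i, α y (Function.update (fun j => X j y) i (VectorField.lieBracket ℝ ξ (X i) y)) =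
      α y (Function.update (fun j => X j y) i (fderiv ℝ (X i) y (ξ y))) -
        α y (Function.update (fun j => X j y) i (fderiv ℝ ξ y (X i y))) := fun i =>
    (α y).map_update_sub _ i _ _
  simp only [Matrix.cons_val_succ, Matrix.cons_val_zero]
  rw [Finset.sum_congr rfl fun i _ => h0 i, Finset.sum_congr rfl fun i _ => h5 i,
    Finset.sum_sub_distrib]
  have e0 : Fin.removeNth 0 (Matrix.vecCons (ξ y) fun i => X i y) = fun i => X i y := by
    funext j
    rfl
  rw [e0]
  simp
  abel

end VectorSpace

/-! ### Forms and vector fields in charts -/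

section Charts

variable {E : Type*} [NormedAddCommGroup E] [NormedSpace ℝ E]
  {M : Type*} [TopologicalSpace M] [ChartedSpace E M] [IsManifold 𝓘(ℝ, E) ∞ M]

/-- The derivative at `x` of the preferred chart at `x₀`. -/
def toChart (x₀ x : M) : TangentSpace 𝓘(ℝ, E) x →L[ℝ] E :=
  mfderiv 𝓘(ℝ, E) 𝓘(ℝ, E) (extChartAt 𝓘(ℝ, E) x₀) x

/-- The derivative at `y` of the inverse of the preferred chart at `x₀`. -/
def fromChart (x₀ : M) (y : E) :
    E →L[ℝ] TangentSpace 𝓘(ℝ, E) ((extChartAt 𝓘(ℝ, E) x₀).symm y) :=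
  mfderiv 𝓘(ℝ, E) 𝓘(ℝ, E) (extChartAt 𝓘(ℝ, E) x₀).symm y

omit [IsManifold 𝓘(ℝ, E) ∞ M] in
theorem inChart_apply {p : ℕ} (α : Form E M p) (x₀ : M) (y : E) (v : Fin p → E) :
    α.inChart x₀ y v =
      α ((extChartAt 𝓘(ℝ, E) x₀).symm y) fun i => fromChart x₀ y (v i) := rfl

theorem fromChart_toChart {x₀ : M} {y : E} (hy : y ∈ (extChartAt 𝓘(ℝ, E) x₀).target)
    (v : TangentSpace 𝓘(ℝ, E) ((extChartAt 𝓘(ℝ, E) x₀).symm y)) :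
    fromChart x₀ y (toChart x₀ ((extChartAt 𝓘(ℝ, E) x₀).symm y) v) = v := by
  have : IsManifold 𝓘(ℝ, E) 1 M := IsManifold.of_le (n := ∞) (by simp)
  have h := mfderivWithin_extChartAt_symm_comp_mfderiv_extChartAt (I := 𝓘(ℝ, E)) hy
  rw [modelWithCornersSelf_coe, Set.range_id, mfderivWithin_univ] at h
  exact congrArg (fun T => T v) h

theorem inChart_toChart {p : ℕ} (α : Form E M p) {x₀ x : M} {y : E}
    (hy : y ∈ (extChartAt 𝓘(ℝ, E) x₀).target) (hx : (extChartAt 𝓘(ℝ, E) x₀).symm y = x)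
    (v : Fin p → TangentSpace 𝓘(ℝ, E) x) :
    α.inChart x₀ y (fun i => toChart x₀ x (v i)) = α x v := by
  subst hx
  rw [inChart_apply]
  exact congrArg _ (funext fun i => fromChart_toChart hy (v i))

/-- The expression of a vector field in the preferred chart at `x₀`. -/
def VField.inChart (X : VField E M) (x₀ : M) (y : E) : E :=
  toChart x₀ ((extChartAt 𝓘(ℝ, E) x₀).symm y) (X ((extChartAt 𝓘(ℝ, E) x₀).symm y))

theorem inChart_inChart {p : ℕ} (α : Form E M p) {x₀ : M} {y : E}
    (hy : y ∈ (extChartAt 𝓘(ℝ, E) x₀).target) (X : Fin p → VField E M) :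
    α.inChart x₀ y (fun i => (X i).inChart x₀ y) =
      α ((extChartAt 𝓘(ℝ, E) x₀).symm y) fun i => X i ((extChartAt 𝓘(ℝ, E) x₀).symm y) :=
  inChart_toChart α hy rfl _

omit [IsManifold 𝓘(ℝ, E) ∞ M] in
theorem mem_chart_source_of_mem {x₀ x : M} (hx : x ∈ (extChartAt 𝓘(ℝ, E) x₀).source) :
    x ∈ (chartAt E x₀).source := by rwa [extChartAt_source] at hx

/-- A vector field is smooth at `x` if and only if its expression in a chart around `x` is. -/
theorem VField.smoothAt_iff {X : VField E M} {x₀ x : M}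
    (hx : x ∈ (extChartAt 𝓘(ℝ, E) x₀).source) :
    X.SmoothAt x ↔ ContMDiffAt 𝓘(ℝ, E) 𝓘(ℝ, E) ∞ (fun y => toChart x₀ y (X y) : M → E) x := by
  have : IsManifold 𝓘(ℝ, E) 1 M := IsManifold.of_le (n := ∞) (by simp)
  have : ContMDiffVectorBundle ∞ E (TangentSpace 𝓘(ℝ, E) : M → Type _) 𝓘(ℝ, E) :=
    have : IsManifold 𝓘(ℝ, E) (∞ + 1) M := IsManifold.of_le (n := ∞) (by exact le_rfl)
    TangentBundle.contMDiffVectorBundle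
  rw [VField.SmoothAt]
  refine (Bundle.Trivialization.contMDiffAt_section_iff (n := ∞)
    (trivializationAt E (TangentSpace 𝓘(ℝ, E)) x₀) ?_).trans ?_
  · rw [TangentBundle.trivializationAt_baseSet]
    exact mem_chart_source_of_mem hx
  · refine Filter.EventuallyEq.contMDiffAt_iff ?_
    filter_upwards [(isOpen_extChartAt_source (I := 𝓘(ℝ, E)) x₀).mem_nhds hx] with y hy
    have h := TangentBundle.continuousLinearMapAt_trivializationAt (I := 𝓘(ℝ, E))
      (mem_chart_source_of_mem hy)
    refine Eq.trans ?_ (congrArg (fun T => T (X y)) h)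
    refine (congrFun (Bundle.Trivialization.coe_linearMapAt_of_mem
      (R := ℝ) (trivializationAt E (TangentSpace 𝓘(ℝ, E)) x₀) ?_) (X y)).symm
    rw [TangentBundle.trivializationAt_baseSet]
    exact mem_chart_source_of_mem hy

/-- A function is smooth at `x` if and only if its expression in a chart around `x` is. -/
theorem contMDiffAt_iff_inChart {F : Type*} [NormedAddCommGroup F] [NormedSpace ℝ F] {f : M → F}
    {x₀ : M} {y : E} (hy : y ∈ (extChartAt 𝓘(ℝ, E) x₀).target) :
    ContMDiffAt 𝓘(ℝ, E) 𝓘(ℝ, F) ∞ f ((extChartAt 𝓘(ℝ, E) x₀).symm y) ↔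
      ContDiffAt ℝ ∞ (fun z => f ((extChartAt 𝓘(ℝ, E) x₀).symm z)) y := by
  have hx := (extChartAt 𝓘(ℝ, E) x₀).map_target hy
  constructor
  · intro h
    rw [← contMDiffAt_iff_contDiffAt]
    exact ContMDiffAt.comp y h (((contMDiffOn_extChartAt_symm x₀).contMDiffAt
      ((isOpen_extChartAt_target x₀).mem_nhds hy)))
  · intro h
    rw [← contMDiffAt_iff_contDiffAt] at h
    have h1 : ContMDiffAt 𝓘(ℝ, E) 𝓘(ℝ, E) ∞ (extChartAt 𝓘(ℝ, E) x₀)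
        ((extChartAt 𝓘(ℝ, E) x₀).symm y) :=
      contMDiffAt_extChartAt' (mem_chart_source_of_mem hx)
    have h2 := ContMDiffAt.comp (g := fun z => f ((extChartAt 𝓘(ℝ, E) x₀).symm z))
      ((extChartAt 𝓘(ℝ, E) x₀).symm y)
      (by rw [(extChartAt 𝓘(ℝ, E) x₀).right_inv hy]; exact h) h1
    refine h2.congr_of_eventuallyEq ?_
    filter_upwards [(isOpen_extChartAt_source (I := 𝓘(ℝ, E)) x₀).mem_nhds hx] with z hz
    simp only [Function.comp_apply]
    rw [(extChartAt 𝓘(ℝ, E) x₀).left_inv hz]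

theorem VField.SmoothAt.inChart {X : VField E M} {x₀ : M} {y : E}
    (hy : y ∈ (extChartAt 𝓘(ℝ, E) x₀).target)
    (hX : X.SmoothAt ((extChartAt 𝓘(ℝ, E) x₀).symm y)) : ContDiffAt ℝ ∞ (X.inChart x₀) y :=
  (contMDiffAt_iff_inChart hy).mp
    ((VField.smoothAt_iff ((extChartAt 𝓘(ℝ, E) x₀).map_target hy)).mp hX)

/-- The vector field with the given expression in the preferred chart at `x₀`. -/
def VField.ofChart (x₀ : M) (f : E → E) : VField E M := fun x =>
  (toChart x₀ x).inverse (f (extChartAt 𝓘(ℝ, E) x₀ x))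

theorem toChart_ofChart {x₀ x : M} (hx : x ∈ (extChartAt 𝓘(ℝ, E) x₀).source) (f : E → E) :
    toChart x₀ x (VField.ofChart x₀ f x) = f (extChartAt 𝓘(ℝ, E) x₀ x) := by
  have : IsManifold 𝓘(ℝ, E) 1 M := IsManifold.of_le (n := ∞) (by simp)
  exact (isInvertible_mfderiv_extChartAt hx).self_apply_inverse _

theorem VField.inChart_ofChart {x₀ : M} {y : E} (hy : y ∈ (extChartAt 𝓘(ℝ, E) x₀).target)
    (f : E → E) : (VField.ofChart x₀ f : VField E M).inChart x₀ y = f y := by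
  rw [VField.inChart, toChart_ofChart ((extChartAt 𝓘(ℝ, E) x₀).map_target hy),
    (extChartAt 𝓘(ℝ, E) x₀).right_inv hy]

theorem VField.ofChart_smoothAt {x₀ : M} {y : E} (hy : y ∈ (extChartAt 𝓘(ℝ, E) x₀).target)
    {f : E → E} (hf : ContDiffAt ℝ ∞ f y) :
    (VField.ofChart x₀ f : VField E M).SmoothAt ((extChartAt 𝓘(ℝ, E) x₀).symm y) := by
  rw [VField.smoothAt_iff ((extChartAt 𝓘(ℝ, E) x₀).map_target hy), contMDiffAt_iff_inChart hy]
  refine hf.congr_of_eventuallyEq ?_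
  filter_upwards [(isOpen_extChartAt_target (I := 𝓘(ℝ, E)) x₀).mem_nhds hy] with z hz
  exact VField.inChart_ofChart hz f

/-- Every tangent vector extends to a smooth vector field. -/
theorem exists_smoothAt_extension (x : M) (v : TangentSpace 𝓘(ℝ, E) x) :
    ∃ X : VField E M, X.SmoothAt x ∧ X x = v := by
  have : IsManifold 𝓘(ℝ, E) 1 M := IsManifold.of_le (n := ∞) (by simp)
  refine ⟨VField.ofChart x fun _ => toChart x x v, ?_, ?_⟩
  · have h := VField.ofChart_smoothAt (mem_extChartAt_target (I := 𝓘(ℝ, E)) x)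
      (contDiffAt_const (c := toChart x x v))
    rwa [extChartAt_to_inv x] at h
  · exact (isInvertible_mfderiv_extChartAt (mem_extChartAt_source x)).inverse_apply_self _

/-- A form is smooth if and only if its values on smooth vector fields are. -/
theorem Form.smooth_iff [FiniteDimensional ℝ E] {p : ℕ} {α : Form E M p} :
    α.Smooth ↔ ∀ (x : M) (X : Fin p → VField E M), (∀ i, (X i).SmoothAt x) →
      ContMDiffAt 𝓘(ℝ, E) 𝓘(ℝ, ℝ) ∞ (fun y => α y fun i => X i y) x := by
  constructor
  · intro h x X hX
    have hy := mem_extChartAt_target (I := 𝓘(ℝ, E)) x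
    have hn := (isOpen_extChartAt_target (I := 𝓘(ℝ, E)) x).mem_nhds hy
    rw [← extChartAt_to_inv (I := 𝓘(ℝ, E)) x, contMDiffAt_iff_inChart hy]
    have h1 := ContDiffAt.form_apply ((h x).contDiffAt hn) fun i =>
      VField.SmoothAt.inChart hy (X := X i) (by rw [extChartAt_to_inv]; exact hX i)
    refine h1.congr_of_eventuallyEq ?_
    filter_upwards [hn] with z hz
    exact (inChart_inChart α hz X).symm
  · intro h x₀
    refine contDiffOn_form fun v y hy => ContDiffAt.contDiffWithinAt ?_
    have h1 := (contMDiffAt_iff_inChart hy).mp (h _ (fun i => VField.ofChart x₀ fun _ => v i)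
      fun i => VField.ofChart_smoothAt hy contDiffAt_const)
    refine h1.congr_of_eventuallyEq ?_
    filter_upwards [(isOpen_extChartAt_target (I := 𝓘(ℝ, E)) x₀).mem_nhds hy] with z hz
    rw [← inChart_inChart α hz]
    exact congrArg _ (funext fun i => (VField.inChart_ofChart hz fun _ => v i).symm)

end Charts

/-! ### The exterior derivative on a manifold -/

section ExteriorDerivative

variable {E : Type*} [NormedAddCommGroup E] [NormedSpace ℝ E]
  {M : Type*} [TopologicalSpace M] [ChartedSpace E M]

theorem toChart_compContinuousLinearMap_inChart [IsManifold 𝓘(ℝ, E) ∞ M] {p : ℕ} (α : Form E M p)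
    {x₀ x : M} (hx : x ∈ (extChartAt 𝓘(ℝ, E) x₀).source) :
    (α.inChart x₀ (extChartAt 𝓘(ℝ, E) x₀ x)).compContinuousLinearMap (toChart x₀ x) = α x := by
  ext v
  exact inChart_toChart α ((extChartAt 𝓘(ℝ, E) x₀).map_source hx)
    ((extChartAt 𝓘(ℝ, E) x₀).left_inv hx) v

theorem Form.Smooth.contDiffAt {p : ℕ} {α : Form E M p} (h : α.Smooth) {x₀ : M} {y : E}
    (hy : y ∈ (extChartAt 𝓘(ℝ, E) x₀).target) : ContDiffAt ℝ ∞ (α.inChart x₀) y :=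
  (h x₀).contDiffAt ((isOpen_extChartAt_target x₀).mem_nhds hy)

theorem Form.Smooth.differentiableAt {p : ℕ} {α : Form E M p} (h : α.Smooth) {x₀ : M} {y : E}
    (hy : y ∈ (extChartAt 𝓘(ℝ, E) x₀).target) : DifferentiableAt ℝ (α.inChart x₀) y :=
  (h.contDiffAt hy).differentiableAt (by simp)

theorem minSmoothness_two_le : minSmoothness ℝ 2 ≤ ∞ := by
  rw [minSmoothness_of_isRCLikeNormedField]
  exact WithTop.coe_le_coe.mpr le_top

section

variable [IsManifold 𝓘(ℝ, E) ∞ M]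

theorem contDiffAt_chart_change {x₀ x₁ : M} {y : E} (hy : y ∈ (extChartAt 𝓘(ℝ, E) x₀).target)
    (hx : (extChartAt 𝓘(ℝ, E) x₀).symm y ∈ (extChartAt 𝓘(ℝ, E) x₁).source) :
    ContDiffAt ℝ ∞ (extChartAt 𝓘(ℝ, E) x₁ ∘ (extChartAt 𝓘(ℝ, E) x₀).symm) y :=
  (contMDiffAt_iff_inChart hy).mp (contMDiffAt_extChartAt' (mem_chart_source_of_mem hx))

theorem fderiv_chart_change {x₀ x₁ : M} {y : E} (hy : y ∈ (extChartAt 𝓘(ℝ, E) x₀).target)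
    (hx : (extChartAt 𝓘(ℝ, E) x₀).symm y ∈ (extChartAt 𝓘(ℝ, E) x₁).source) (v : E) :
    fderiv ℝ (extChartAt 𝓘(ℝ, E) x₁ ∘ (extChartAt 𝓘(ℝ, E) x₀).symm) y v =
      toChart x₁ ((extChartAt 𝓘(ℝ, E) x₀).symm y) (fromChart x₀ y v) := by
  have : IsManifold 𝓘(ℝ, E) 1 M := IsManifold.of_le (n := ∞) (by simp)
  have h1 : MDifferentiableAt 𝓘(ℝ, E) 𝓘(ℝ, E) (extChartAt 𝓘(ℝ, E) x₀).symm y :=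
    ((contMDiffOn_extChartAt_symm (n := 1) x₀).contMDiffAt
      ((isOpen_extChartAt_target x₀).mem_nhds hy)).mdifferentiableAt (by simp)
  have h2 := mfderiv_comp y (mdifferentiableAt_extChartAt (mem_chart_source_of_mem hx)) h1
  rw [mfderiv_eq_fderiv] at h2
  exact congrArg (fun T => T v) h2

theorem inChart_change {p : ℕ} (α : Form E M p) {x₀ x₁ : M} {y : E}
    (hy : y ∈ (extChartAt 𝓘(ℝ, E) x₀).target)
    (hx : (extChartAt 𝓘(ℝ, E) x₀).symm y ∈ (extChartAt 𝓘(ℝ, E) x₁).source) :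
    α.inChart x₀ y =
      (α.inChart x₁ ((extChartAt 𝓘(ℝ, E) x₁ ∘ (extChartAt 𝓘(ℝ, E) x₀).symm) y)
        ).compContinuousLinearMap
        (fderiv ℝ (extChartAt 𝓘(ℝ, E) x₁ ∘ (extChartAt 𝓘(ℝ, E) x₀).symm) y) := by
  ext v
  rw [ContinuousAlternatingMap.compContinuousLinearMap_apply, inChart_apply,
    ← inChart_toChart α ((extChartAt 𝓘(ℝ, E) x₁).map_source hx)
      ((extChartAt 𝓘(ℝ, E) x₁).left_inv hx)]
  exact congrArg _ (funext fun i => (fderiv_chart_change hy hx (v i)).symm)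

/-- The exterior derivative can be computed in any chart. -/
theorem inChart_extD {p : ℕ} {α : Form E M p} (h : α.Smooth) {x₀ : M} {y : E}
    (hy : y ∈ (extChartAt 𝓘(ℝ, E) x₀).target) :
    (extD α).inChart x₀ y = extDeriv (α.inChart x₀) y := by
  set x := (extChartAt 𝓘(ℝ, E) x₀).symm y with hxy
  have hx : x ∈ (extChartAt 𝓘(ℝ, E) x).source := mem_extChartAt_source x
  -- `extD` is defined by means of the preferred chart at `x`; `α` is pulled back along the change
  -- of charts.
  have h1 : α.inChart x₀ =ᶠ[𝓝 y] fun z =>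
      (α.inChart x ((extChartAt 𝓘(ℝ, E) x ∘ (extChartAt 𝓘(ℝ, E) x₀).symm) z)
        ).compContinuousLinearMap
        (fderiv ℝ (extChartAt 𝓘(ℝ, E) x ∘ (extChartAt 𝓘(ℝ, E) x₀).symm) z) := by
    have hc : ContinuousAt (extChartAt 𝓘(ℝ, E) x₀).symm y := continuousAt_extChartAt_symm'' hy
    filter_upwards [(isOpen_extChartAt_target (I := 𝓘(ℝ, E)) x₀).mem_nhds hy,
      hc.preimage_mem_nhds ((isOpen_extChartAt_source (I := 𝓘(ℝ, E)) x).mem_nhds hx)] with z hz hz'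
    exact inChart_change α hz hz'
  have h2 : extDeriv (α.inChart x₀) y = _ :=
    congrArg ContinuousAlternatingMap.alternatizeUncurryFin h1.fderiv_eq
  rw [h2]
  have h3 := extDeriv_pullback (f := extChartAt 𝓘(ℝ, E) x ∘ (extChartAt 𝓘(ℝ, E) x₀).symm) (r := ∞)
    (h.differentiableAt (mem_extChartAt_target x)) (contDiffAt_chart_change hy hx)
    minSmoothness_two_le
  refine Eq.trans ?_ h3.symm
  ext v
  rw [ContinuousAlternatingMap.compContinuousLinearMap_apply, inChart_apply]
  exact congrArg _ (funext fun i => (fderiv_chart_change hy hx (v i)).symm)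

theorem Form.Smooth.extD {p : ℕ} {α : Form E M p} (h : α.Smooth) : (extD α).Smooth := by
  intro x₀
  have h1 : ContDiffOn ℝ ∞ (fderiv ℝ (α.inChart x₀)) (extChartAt 𝓘(ℝ, E) x₀).target :=
    (h x₀).fderiv_of_isOpen (isOpen_extChartAt_target x₀) (by simp)
  have h2 : ContDiffOn ℝ ∞ (fun y => ContinuousAlternatingMap.alternatizeUncurryFinCLM ℝ E ℝ
      (fderiv ℝ (α.inChart x₀) y)) (extChartAt 𝓘(ℝ, E) x₀).target := by
    fun_prop
  exact h2.congr fun y hy => inChart_extD h hy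

theorem extD_extD {p : ℕ} {α : Form E M p} (h : α.Smooth) : extD (extD α) = 0 := by
  funext x
  have hx := mem_extChartAt_target (I := 𝓘(ℝ, E)) x
  have h1 : (extD α).inChart x =ᶠ[𝓝 (extChartAt 𝓘(ℝ, E) x x)] extDeriv (α.inChart x) := by
    filter_upwards [(isOpen_extChartAt_target (I := 𝓘(ℝ, E)) x).mem_nhds hx] with z hz
    exact inChart_extD h hz
  have h2 : extDeriv ((extD α).inChart x) (extChartAt 𝓘(ℝ, E) x x) = 0 :=
    (congrArg ContinuousAlternatingMap.alternatizeUncurryFin h1.fderiv_eq).trans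
      (extDeriv_extDeriv_apply (h.contDiffAt hx) minSmoothness_two_le)
  ext v
  exact congrArg (fun γ => γ fun i => toChart x x (v i)) h2

end

theorem extD_add {p : ℕ} {α β : Form E M p} (hα : α.Smooth) (hβ : β.Smooth) :
    extD (α + β) = extD α + extD β := by
  funext x
  have hx := mem_extChartAt_target (I := 𝓘(ℝ, E)) x
  have h := extDeriv_add (hα.differentiableAt hx) (hβ.differentiableAt hx)
  ext v
  exact congrArg (fun γ => γ fun i => toChart x x (v i)) h

theorem extD_smul {p : ℕ} (c : ℝ) (α : Form E M p) : extD (c • α) = c • extD α := by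
  funext x
  have h := extDeriv_smul c (α.inChart x) (x := extChartAt 𝓘(ℝ, E) x x)
  ext v
  exact congrArg (fun γ => γ fun i => toChart x x (v i)) h

theorem extD_zero {p : ℕ} : extD (0 : Form E M p) = 0 := by
  have h := extD_smul (0 : ℝ) (0 : Form E M p)
  rwa [zero_smul, zero_smul] at h

theorem Form.smooth_zero {p : ℕ} : (0 : Form E M p).Smooth := fun _ =>
  (contDiffOn_const (c := 0)).congr fun _ _ => rfl

theorem Form.Smooth.add {p : ℕ} {α β : Form E M p} (hα : α.Smooth) (hβ : β.Smooth) :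
    (α + β).Smooth := fun x => (hα x).add (hβ x)

theorem Form.Smooth.const_smul {p : ℕ} {α : Form E M p} (hα : α.Smooth) (c : ℝ) :
    (c • α).Smooth := fun x => (hα x).const_smul c

theorem Form.Smooth.wedge [FiniteDimensional ℝ E] {p q : ℕ} {α : Form E M p} {β : Form E M q}
    (hα : α.Smooth) (hβ : β.Smooth) :
    Form.Smooth (E := E) (fun x : M => KContact.wedge (α x) (β x)) := fun x =>
  (contDiffOn_wedge (hα x) (hβ x)).congr fun _ _ => wedge_compContinuousLinearMap _ _ _

/-- Exterior multiplication by a closed `2`-form commutes with the exterior derivative. -/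
theorem extD_wedge_of_closed [FiniteDimensional ℝ E] [IsManifold 𝓘(ℝ, E) ∞ M] {p : ℕ}
    {α : Form E M p} {β : Form E M 2} (hα : α.Smooth) (hβ : β.Smooth) (hd : extD β = 0) :
    extD (fun x : M => wedge (α x) (β x)) = fun x => wedge (extD α x) (β x) := by
  funext x
  have hx := mem_extChartAt_target (I := 𝓘(ℝ, E)) x
  have h1 : extDeriv (β.inChart x) (extChartAt 𝓘(ℝ, E) x x) = 0 := by
    rw [← inChart_extD hβ hx, hd]
    rfl
  have h2 : Form.inChart (E := E) (fun x : M => wedge (α x) (β x)) x =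
      fun y => wedge (α.inChart x y) (β.inChart x y) := by
    funext y
    exact wedge_compContinuousLinearMap _ _ _
  have h3 := extDeriv_wedge_of_closed (isOpen_extChartAt_target x) (hα x) (hβ x) hx h1
  rw [← h2] at h3
  have h4 := congrArg (fun γ => ContinuousAlternatingMap.compContinuousLinearMap γ (toChart x x)) h3
  refine h4.trans ((wedge_compContinuousLinearMap _ _ _).trans ?_)
  rw [toChart_compContinuousLinearMap_inChart β (mem_extChartAt_source x)]
  rfl

/-- Cartan's formula for a form with `ι_ξ α = 0`. -/
theorem extD_vecCons_of_horizontal [CompleteSpace E] [IsManifold 𝓘(ℝ, E) ∞ M] {p : ℕ}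
    {α : Form E M p}
    {ξ : VField E M} (hα : α.Smooth) (hξ : ∀ x, ξ.SmoothAt x)
    (hz : ∀ (x : M) (v : Fin p → TangentSpace 𝓘(ℝ, E) x), (∃ i, v i = ξ x) → α x v = 0) {x : M}
    {X : Fin p → VField E M} (hX : ∀ i, (X i).SmoothAt x) :
    extD α x (Matrix.vecCons (ξ x) fun i => X i x) =
      dirDeriv (fun y => α y fun i => X i y) x (ξ x) -
        ∑ i, α x (Function.update (fun j => X j x) i
          (VectorField.mlieBracket 𝓘(ℝ, E) ξ (X i) x)) := by
  have : IsManifold 𝓘(ℝ, E) 1 M := IsManifold.of_le (n := ∞) (by simp)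
  have hx := mem_extChartAt_target (I := 𝓘(ℝ, E)) x
  have hs := mem_extChartAt_source (I := 𝓘(ℝ, E)) x
  have hn := (isOpen_extChartAt_target (I := 𝓘(ℝ, E)) x).mem_nhds hx
  have hi := extChartAt_to_inv (I := 𝓘(ℝ, E)) x
  have e : ∀ Y : VField E M, Y.inChart x (extChartAt 𝓘(ℝ, E) x x) = toChart x x (Y x) := by
    intro Y
    rw [VField.inChart, hi]
  have hX' : ∀ i, ContDiffAt ℝ ∞ ((X i).inChart x) (extChartAt 𝓘(ℝ, E) x x) := fun i =>
    VField.SmoothAt.inChart hx (by rw [hi]; exact hX i)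
  have h1 := extDeriv_vecCons_of_horizontal (isOpen_extChartAt_target (I := 𝓘(ℝ, E)) x) (hα x)
    (ξ := ξ.inChart x) (fun y hy => (VField.SmoothAt.inChart hy (hξ _)).contDiffWithinAt)
    (fun y hy v ⟨i, hv⟩ => by
      rw [inChart_apply]
      refine hz _ _ ⟨i, ?_⟩
      rw [hv]
      exact fromChart_toChart hy _) hx (X := fun i => (X i).inChart x)
    (fun i => (hX' i).differentiableAt (by simp))
  have h2 : extDeriv (α.inChart x) (extChartAt 𝓘(ℝ, E) x x)
      (Matrix.vecCons (ξ.inChart x (extChartAt 𝓘(ℝ, E) x x))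
        fun i => (X i).inChart x (extChartAt 𝓘(ℝ, E) x x)) =
      extD α x (Matrix.vecCons (ξ x) fun i => X i x) := by
    refine congrArg (extDeriv (α.inChart x) (extChartAt 𝓘(ℝ, E) x x)) (funext fun i => ?_)
    cases i using Fin.cases with
    | zero => exact e ξ
    | succ i => exact e (X i)
  have h3 : fderiv ℝ (fun z => α.inChart x z fun i => (X i).inChart x z)
      (extChartAt 𝓘(ℝ, E) x x) (ξ.inChart x (extChartAt 𝓘(ℝ, E) x x)) =
      dirDeriv (fun y => α y fun i => X i y) x (ξ x) := by
    have h4 : (fun z => α.inChart x z fun i => (X i).inChart x z) =ᶠ[𝓝 (extChartAt 𝓘(ℝ, E) x x)]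
        (fun y => α y fun i => X i y) ∘ (extChartAt 𝓘(ℝ, E) x).symm := by
      filter_upwards [hn] with z hz'
      exact inChart_inChart α hz' X
    have h5 : DifferentiableAt ℝ (fun z => α.inChart x z fun i => (X i).inChart x z)
        (extChartAt 𝓘(ℝ, E) x x) :=
      (ContDiffAt.form_apply (hα.contDiffAt hx) hX').differentiableAt (by simp)
    have h6 : MDifferentiableAt 𝓘(ℝ, E) 𝓘(ℝ, ℝ) (fun y => α y fun i => X i y) x := by
      refine ContMDiffAt.mdifferentiableAt (n := ∞) ?_ (by simp)
      rw [← hi, contMDiffAt_iff_inChart hx]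
      exact (ContDiffAt.form_apply (hα.contDiffAt hx) hX').congr_of_eventuallyEq h4.symm
    rw [dirDeriv, e, h4.fderiv_eq]
    have h7 : MDifferentiableAt 𝓘(ℝ, E) 𝓘(ℝ, E) (extChartAt 𝓘(ℝ, E) x).symm
        (extChartAt 𝓘(ℝ, E) x x) :=
      ((contMDiffOn_extChartAt_symm (n := 1) x).contMDiffAt hn).mdifferentiableAt (by simp)
    have h8 := mfderiv_comp (I'' := 𝓘(ℝ, ℝ)) (g := fun y => α y fun i => X i y)
      (extChartAt 𝓘(ℝ, E) x x) (by rw [hi]; exact h6) h7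
    rw [mfderiv_eq_fderiv] at h8
    refine (DFunLike.congr_fun h8 (toChart x x (ξ x))).trans ?_
    -- The base point is generalized, as the two tangent spaces are only propositionally equal.
    have h9 : ∀ (z : M) (hz : (extChartAt 𝓘(ℝ, E) x).symm (extChartAt 𝓘(ℝ, E) x x) = z)
        (v : TangentSpace 𝓘(ℝ, E) z),
        mfderiv 𝓘(ℝ, E) 𝓘(ℝ, ℝ) (fun y => α y fun i => X i y)
          ((extChartAt 𝓘(ℝ, E) x).symm (extChartAt 𝓘(ℝ, E) x x))
          (fromChart x (extChartAt 𝓘(ℝ, E) x x) (toChart x z v)) =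
        mfderiv 𝓘(ℝ, E) 𝓘(ℝ, ℝ) (fun y => α y fun i => X i y) z v := by
      intro z hz v
      subst hz
      exact congrArg _ (fromChart_toChart hx v)
    exact h9 x hi (ξ x)
  -- The bracket of vector fields on a manifold is defined by pullback to the preferred chart.
  have h4 : ∀ Y : VField E M, VectorField.mpullbackWithin 𝓘(ℝ, E) 𝓘(ℝ, E)
      (extChartAt 𝓘(ℝ, E) x).symm Y (Set.range 𝓘(ℝ, E)) =ᶠ[𝓝 (extChartAt 𝓘(ℝ, E) x x)]
      Y.inChart x := by
    intro Y
    filter_upwards [hn] with z hz'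
    rw [VectorField.mpullbackWithin_apply]
    refine (isInvertible_mfderivWithin_extChartAt_symm hz').inverse_apply_eq.mpr ?_
    rw [modelWithCornersSelf_coe, Set.range_id, mfderivWithin_univ]
    exact (fromChart_toChart hz' _).symm
  have h5 : ∀ i, toChart x x (VectorField.mlieBracket 𝓘(ℝ, E) ξ (X i) x) =
      VectorField.lieBracket ℝ (ξ.inChart x) ((X i).inChart x) (extChartAt 𝓘(ℝ, E) x x) := by
    intro i
    rw [← VectorField.mlieBracketWithin_univ, VectorField.mlieBracketWithin_apply]
    refine ((isInvertible_mfderiv_extChartAt hs).self_apply_inverse _).trans ?_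
    have h6 : (extChartAt 𝓘(ℝ, E) x).symm ⁻¹' Set.univ ∩ Set.range 𝓘(ℝ, E) = Set.univ := by simp
    rw [h6]
    have h7 : ∀ (V W V' W' : E → E) (y : E), V =ᶠ[𝓝 y] V' → W =ᶠ[𝓝 y] W' →
        VectorField.lieBracketWithin ℝ V W Set.univ y = VectorField.lieBracket ℝ V' W' y := by
      intro V W V' W' y hV hW
      rw [VectorField.lieBracketWithin_univ]
      exact Filter.EventuallyEq.lieBracket_vectorField_eq hV hW
    exact h7 _ _ _ _ _ (h4 ξ) (h4 (X i))
  rw [h2, h3] at h1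
  refine h1.trans (congrArg _ (Finset.sum_congr rfl fun i _ => ?_))
  rw [← h5 i, ← inChart_toChart α hx hi]
  refine congrArg _ (funext fun j => ?_)
  by_cases hj : j = i
  · subst hj
    simp
  · rw [Function.update_of_ne hj, Function.update_of_ne hj]
    exact e (X j)

end ExteriorDerivative

/-! ### Smoothness of the dual Lefschetz operator -/

/-- The trace of a bilinear map with respect to the metric, computed in an arbitrary basis. -/
theorem ContactModule.sum_frame_eq {n : ℕ} {V : Type*} [AddCommGroup V] [Module ℝ V]
    [TopologicalSpace V] (D : ContactModule n V) {ι N : Type*} [Fintype ι] [DecidableEq ι]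
    [AddCommGroup N] [Module ℝ N] (b : Module.Basis ι ℝ V) (B : V →ₗ[ℝ] V →ₗ[ℝ] N) :
    IsUnit (Matrix.of fun i j => D.flat (b i) ![b j]).det ∧
      ∑ k, B (D.e k) (D.e k) =
        ∑ i, ∑ j, (Matrix.of fun i j => D.flat (b i) ![b j])⁻¹ i j • B (b i) (b j) := by
  set G : Matrix ι ι ℝ := Matrix.of fun i j => D.flat (b i) ![b j] with hG
  -- `Q` is the matrix of the frame in the basis `b`, so that `G⁻¹ = Q Qᵀ`.
  set Q : Matrix ι (Fin (1 + 2 * n)) ℝ := Matrix.of fun i k => b.repr (D.e k) i with hQ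
  have he : ∀ k, D.e k = ∑ i, Q i k • b i := fun k => (b.sum_repr (D.e k)).symm
  have h1 : G * (Q * Q.transpose) = 1 := by
    rw [← Matrix.mul_assoc]
    have h2 : ∀ j k, (G * Q) j k = D.flat (D.e k) ![b j] := by
      intro j k
      rw [D.flat_symm]
      change ∑ i, D.flat (b j) ![b i] * Q i k = toFunctional (D.flat (b j)) (D.e k)
      rw [he k, map_sum]
      exact Finset.sum_congr rfl fun i _ => by
        rw [map_smul, smul_eq_mul, mul_comm, toFunctional_apply]
    ext j l
    rw [Matrix.mul_apply]
    have h3 := congrArg (fun v => b.repr v l) (D.frame (b j))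
    simp only [map_sum, map_smul, Finsupp.coe_finsetSum, Finset.sum_apply, Finsupp.smul_apply,
      smul_eq_mul] at h3
    simp only [h2, Matrix.transpose_apply]
    refine h3.symm.trans ?_
    rw [b.repr_self, Finsupp.single_apply, Matrix.one_apply]
  have h4 : G⁻¹ = Q * Q.transpose := Matrix.inv_eq_right_inv h1
  refine ⟨(Matrix.isUnit_iff_isUnit_det G).mp (IsUnit.of_mul_eq_one _ h1), ?_⟩
  rw [h4]
  have h5 : ∀ k, B (D.e k) (D.e k) = ∑ i, ∑ j, (Q i k * Q j k) • B (b i) (b j) := by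
    intro k
    rw [he k]
    simp only [map_sum, map_smul, LinearMap.sum_apply, LinearMap.smul_apply, Finset.smul_sum,
      smul_smul]
    rw [Finset.sum_comm]
    exact Finset.sum_congr rfl fun i _ => Finset.sum_congr rfl fun j _ => by rw [mul_comm]
  simp only [h5, Matrix.mul_apply, Matrix.transpose_apply, Finset.sum_smul]
  rw [Finset.sum_comm]
  exact Finset.sum_congr rfl fun i _ => Finset.sum_comm

/-- The formula `2 Λα = ∑ gⁱʲ α(bⱼ, Φ bᵢ, ·)` in an arbitrary basis `b`. -/
theorem ContactModule.Λ_apply_apply {n : ℕ} {V : Type*} [AddCommGroup V] [Module ℝ V]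
    [TopologicalSpace V] (D : ContactModule n V) {ι : Type*} [Fintype ι] [DecidableEq ι]
    (b : Module.Basis ι ℝ V) (α : ExtAlg V) (p : ℕ) (v : Fin p → V) :
    IsUnit (Matrix.of fun i j => D.flat (b i) ![b j]).det ∧
      D.Λ α p v = (2 : ℝ)⁻¹ * ∑ i, ∑ j, (Matrix.of fun i j => D.flat (b i) ![b j])⁻¹ i j *
        α (p + 2) (Matrix.vecCons (b j) (Matrix.vecCons (D.Φ (b i)) v)) := by
  have h1 := D.sum_frame_eq b ((LinearMap.mul ℝ (Module.End ℝ (ExtAlg V))).compl₁₂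
    (iOp ∘ₗ (D.Φ : V →ₗ[ℝ] V)) iOp)
  refine ⟨h1.1, ?_⟩
  have h2 := congrArg (fun T => T α p v) h1.2
  simp only [LinearMap.sum_apply, ExtAlg.sum_apply, ContinuousAlternatingMap.sum_apply] at h2
  rw [Λ_apply, ContinuousAlternatingMap.smul_apply, smul_eq_mul,
    ContinuousAlternatingMap.sum_apply]
  exact congrArg _ h2

theorem contDiffAt_det {D ι : Type*} [NormedAddCommGroup D] [NormedSpace ℝ D] [Fintype ι]
    [DecidableEq ι] {G : D → Matrix ι ι ℝ} {y : D}
    (hG : ∀ i j, ContDiffAt ℝ ∞ (fun z => G z i j) y) :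
    ContDiffAt ℝ ∞ (fun z => (G z).det) y := by
  simp only [Matrix.det_apply, Units.smul_def, zsmul_eq_mul]
  exact ContDiffAt.sum fun s _ => contDiffAt_const.mul (contDiffAt_prod fun i _ => hG _ _)

theorem contDiffAt_matrix_inv {D ι : Type*} [NormedAddCommGroup D] [NormedSpace ℝ D] [Fintype ι]
    [DecidableEq ι] {G : D → Matrix ι ι ℝ} {y : D}
    (hG : ∀ i j, ContDiffAt ℝ ∞ (fun z => G z i j) y) (hy : IsUnit (G y).det) (i j : ι) :
    ContDiffAt ℝ ∞ (fun z => (G z)⁻¹ i j) y := by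
  simp only [Matrix.inv_def, Matrix.smul_apply, smul_eq_mul, Ring.inverse_eq_inv',
    Matrix.adjugate_apply]
  refine ((contDiffAt_det hG).inv hy.ne_zero).mul (contDiffAt_det fun k l => ?_)
  by_cases hk : k = j
  · subst hk
    simpa using contDiffAt_const
  · simpa [Matrix.updateRow_ne hk] using hG k l

namespace KContactStructure

variable {n : ℕ} {M : Type*} [TopologicalSpace M] [ChartedSpace (Model n) M]
  [IsManifold 𝓘(ℝ, Model n) ∞ M] (K : KContactStructure n M)

theorem frame_orthonormal (x : M) (i j) :
    K.metric x (K.frame x i) (K.frame x j) = if i = j then 1 else 0 :=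
  Classical.choose_spec (K.exists_orthonormalFrame x) i j

/-- The metric as a linear functional of its second argument. -/
def metricFunctional (x : M) (X : TangentSpace 𝓘(ℝ, Model n) x) :
    TangentSpace 𝓘(ℝ, Model n) x →ₗ[ℝ] ℝ where
  toFun := K.metric x X
  map_add' Y Z := by
    simp only [metric, map_add, form1_add]
    rw [form2_add_right]
    ring
  map_smul' c Y := by
    simp only [metric, map_smul, form1_smul, smul_eq_mul, RingHom.id_apply]
    rw [form2_smul_right]
    ring

theorem eq_sum_frame (x : M) (v : TangentSpace 𝓘(ℝ, Model n) x) :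
    v = ∑ k, K.metric x (K.frame x k) v • K.frame x k := by
  have hf : ∀ (c : Fin (1 + 2 * n) → ℝ) (i),
      K.metric x (K.frame x i) (∑ k, c k • K.frame x k) = c i := by
    intro c i
    change K.metricFunctional x (K.frame x i) _ = _
    rw [map_sum]
    have h : ∀ k, K.metricFunctional x (K.frame x i) (c k • K.frame x k) =
        c k * if i = k then 1 else 0 := by
      intro k
      rw [map_smul, smul_eq_mul]
      exact congrArg _ (K.frame_orthonormal x i k)
    simp [h]
  have hli : LinearIndependent ℝ (K.frame x) := by
    rw [Fintype.linearIndependent_iff]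
    intro c hc i
    rw [← hf c i, hc]
    exact map_zero (K.metricFunctional x (K.frame x i))
  have : FiniteDimensional ℝ (TangentSpace 𝓘(ℝ, Model n) x) :=
    inferInstanceAs (FiniteDimensional ℝ (EuclideanSpace ℝ (Fin (2 * n + 1))))
  have hm : Fintype.card (Fin (1 + 2 * n)) = Module.finrank ℝ (TangentSpace 𝓘(ℝ, Model n) x) := by
    change _ = Module.finrank ℝ (EuclideanSpace ℝ (Fin (2 * n + 1)))
    rw [finrank_euclideanSpace, Fintype.card_fin, Fintype.card_fin, add_comm]
  have hs := hli.span_eq_top_of_card_eq_finrank' hm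
  obtain ⟨c, hc⟩ := (Submodule.mem_span_range_iff_exists_fun ℝ).mp
    (hs.symm ▸ Submodule.mem_top : v ∈ Submodule.span ℝ (Set.range (K.frame x)))
  rw [← hc]
  exact Finset.sum_congr rfl fun k _ => by rw [hf]

/-- The structure induced on the tangent space at `x`. -/
def tangent (x : M) : ContactModule n (TangentSpace 𝓘(ℝ, Model n) x) where
  η := K.η x
  ξ := K.ξ x
  Ω := extD K.η x
  Φ := K.Φ x
  e := K.frame x
  η_ξ := K.η_ξ x
  Ω_ξ := K.dη_ξ x
  Φ_sq := K.Φ_sq x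
  Φ_ξ := K.Φ_ξ x
  η_Φ := K.η_Φ x
  Ω_Φ := K.dη_Φ x
  orthonormal := K.frame_orthonormal x
  complete := K.eq_sum_frame x

theorem contactForm_tangent_ne_zero (x : M) : (K.tangent x).contactForm ≠ 0 := K.contact x

theorem dη_smooth : (extD K.η).Smooth := K.η_smooth.extD

theorem Φ_smoothAt {X : VField (Model n) M} {x : M} (hX : X.SmoothAt x) :
    VField.SmoothAt (fun y => K.Φ y (X y)) x :=
  ContMDiffAt.clm_bundle_apply (K.Φ_smooth x) hX

theorem smooth_pullback {p : ℕ} {α : Form (Model n) M p} (h : α.Smooth) :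
    Form.Smooth (E := Model n) fun x : M => (α x).compContinuousLinearMap (K.Φ x) := by
  rw [Form.smooth_iff] at *
  exact fun x X hX => h x (fun i y => K.Φ y (X i y)) fun i => K.Φ_smoothAt (hX i)

theorem smooth_interior {p : ℕ} {α : Form (Model n) M (p + 1)} (h : α.Smooth) :
    Form.Smooth (E := Model n) fun x : M => interior (K.ξ x) (α x) := by
  rw [Form.smooth_iff] at *
  intro x X hX
  have h1 := h x (Fin.cons K.ξ X) fun i => by
    cases i using Fin.cases with
    | zero => exact K.ξ_smooth x
    | succ i => exact hX i
  refine h1.congr_of_eventuallyEq (Filter.Eventually.of_forall fun y => ?_)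
  refine congrArg (α y) (funext fun i => ?_)
  cases i using Fin.cases <;> rfl

/-- Contraction with the bivector dual to `dη` preserves smoothness. The orthonormal frames that
enter its definition are chosen pointwise, so it is computed in a smooth local frame instead. -/
theorem smooth_Λ {α : Forms (Model n) M} (h : ∀ p, (α p).Smooth) (p : ℕ) :
    Form.Smooth (E := Model n) fun x : M => (K.tangent x).Λ (fun q => α q x) p := by
  have : IsManifold 𝓘(ℝ, Model n) 1 M := IsManifold.of_le (n := ∞) (by simp)
  rw [Form.smooth_iff]
  intro x X hX
  have hx := mem_extChartAt_target (I := 𝓘(ℝ, Model n)) x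
  have hi := extChartAt_to_inv (I := 𝓘(ℝ, Model n)) x
  let β := Module.finBasis ℝ (Model n)
  let b : Fin (Module.finrank ℝ (Model n)) → VField (Model n) M := fun i =>
    VField.ofChart x fun _ => β i
  have hb : ∀ i, (b i).SmoothAt x := fun i => by
    have := VField.ofChart_smoothAt (M := M) hx (contDiffAt_const (c := β i))
    rwa [hi] at this
  have hbasis : ∀ y ∈ (extChartAt 𝓘(ℝ, Model n) x).source,
      ∃ B : Module.Basis (Fin (Module.finrank ℝ (Model n))) ℝ (TangentSpace 𝓘(ℝ, Model n) y),
        ∀ i, B i = b i y := by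
    intro y hy
    obtain ⟨e, he⟩ : (toChart x y).IsInvertible := isInvertible_mfderiv_extChartAt hy
    refine ⟨β.map e.symm.toLinearEquiv, fun i => ?_⟩
    rw [Module.Basis.map_apply]
    change e.symm (β i) = (toChart x y).inverse (β i)
    rw [← he, ContinuousLinearMap.inverse_equiv]
    rfl
  let G : M → Matrix (Fin (Module.finrank ℝ (Model n))) (Fin (Module.finrank ℝ (Model n))) ℝ :=
    fun y => Matrix.of fun i j => (K.tangent y).flat (b i y) ![b j y]
  -- Near `x`, the form `Λα` is given by the entries of the inverse of the Gram matrix `G`.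
  have key : ∀ y ∈ (extChartAt 𝓘(ℝ, Model n) x).source, IsUnit (G y).det ∧
      (K.tangent y).Λ (fun q => α q y) p (fun k => X k y) =
        (2 : ℝ)⁻¹ * ∑ i, ∑ j, (G y)⁻¹ i j *
          α (p + 2) y (Matrix.vecCons (b j y) (Matrix.vecCons (K.Φ y (b i y)) fun k => X k y)) := by
    intro y hy
    obtain ⟨B, hB⟩ := hbasis y hy
    have h1 := (K.tangent y).Λ_apply_apply B (fun q => α q y) p fun k => X k y
    simp only [hB] at h1
    exact h1
  have hG : ∀ i j, ContMDiffAt 𝓘(ℝ, Model n) 𝓘(ℝ, ℝ) ∞ (fun y => G y i j) x := by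
    intro i j
    have h1 := Form.smooth_iff.mp K.dη_smooth x ![b i, fun y => K.Φ y (b j y)] (fun k => by
      fin_cases k
      exacts [hb i, K.Φ_smoothAt (hb j)])
    have h2 : ∀ i, ContMDiffAt 𝓘(ℝ, Model n) 𝓘(ℝ, ℝ) ∞ (fun y => K.η y ![b i y]) x := fun i => by
      refine (Form.smooth_iff.mp K.η_smooth x ![b i] (fun k => ?_)).congr_of_eventuallyEq
        (Filter.Eventually.of_forall fun y => congrArg (K.η y) (funext fun k => ?_))
      · fin_cases k
        exact hb i
      · fin_cases k
        rfl
    refine (h1.add ((h2 i).mul (h2 j))).congr_of_eventuallyEq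
      (Filter.Eventually.of_forall fun y => ?_)
    refine ((K.tangent y).flat_apply (b i y) (b j y)).trans
      (congrArg (· + _) (congrArg (extD K.η y) (funext fun k => ?_)))
    fin_cases k <;> rfl
  have hα : ∀ i j, ContMDiffAt 𝓘(ℝ, Model n) 𝓘(ℝ, ℝ) ∞ (fun y => α (p + 2) y
      (Matrix.vecCons (b j y) (Matrix.vecCons (K.Φ y (b i y)) fun k => X k y))) x := by
    intro i j
    have h1 := Form.smooth_iff.mp (h (p + 2)) x
      (Fin.cons (b j) (Fin.cons (fun y => K.Φ y (b i y)) X)) fun k => by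
        cases k using Fin.cases with
        | zero => exact hb j
        | succ k =>
          cases k using Fin.cases with
          | zero => exact K.Φ_smoothAt (hb i)
          | succ k => exact hX k
    refine h1.congr_of_eventuallyEq (Filter.Eventually.of_forall fun y => ?_)
    refine congrArg (α (p + 2) y) (funext fun k => ?_)
    cases k using Fin.cases with
    | zero => rfl
    | succ k => cases k using Fin.cases <;> rfl
  rw [← hi, contMDiffAt_iff_inChart hx]
  have hG' := fun i j => (contMDiffAt_iff_inChart hx).mp (hi.symm ▸ hG i j)
  have hα' := fun i j => (contMDiffAt_iff_inChart hx).mp (hi.symm ▸ hα i j)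
  have h3 := contDiffAt_matrix_inv hG' (by
    rw [hi]
    exact (key x (mem_extChartAt_source x)).1)
  refine (ContDiffAt.mul (contDiffAt_const (c := (2 : ℝ)⁻¹))
    (ContDiffAt.sum (s := Finset.univ) fun i _ => ContDiffAt.sum (s := Finset.univ) fun j _ =>
      (h3 i j).mul (hα' i j))).congr_of_eventuallyEq ?_
  filter_upwards [(isOpen_extChartAt_target (I := 𝓘(ℝ, Model n)) x).mem_nhds hx] with z hz
  exact (key _ ((extChartAt 𝓘(ℝ, Model n) x).map_target hz)).2

end KContactStructure

/-! ### The Kähler identities in an associative algebra -/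

section KaehlerAlgebra

variable {R : Type*} [Ring R] [Algebra ℝ R]

/-- The algebraic content of the Kähler identities. Here `d` commutes with `L` and has weight one
for the `sl₂`-triple `(L, [L, Λ], Λ)`, `ε` is the sign of the degree, `σ` the sign of the reversal
of the factors, `Ψ` the action of the complex structure, and the Hodge star `S` is up to sign the
Weyl element of the triple composed with `Ψ` and `σ`. -/
theorem kaehler_identities_of_relations {N : ℕ} {L Λ d ε σ Ψ S : R} {s : ℝ}
    (hLN : L ^ N = 0) (hΛN : Λ ^ N = 0)
    (hHΛ : (L * Λ - Λ * L) * Λ - Λ * (L * Λ - Λ * L) = (-2 : ℝ) • Λ)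
    (hLd : L * d = d * L) (hHd : (L * Λ - Λ * L) * d - d * (L * Λ - Λ * L) = d)
    (hεε : ε * ε = 1) (hεd : ε * d = -(d * ε)) (hLε : L * ε = ε * L) (hΛε : Λ * ε = ε * Λ)
    (hσd : σ * d = d * ε * σ) (hσε : σ * ε = ε * σ)
    (hΨL : Ψ * L = L * Ψ) (hΛΨ : Λ * Ψ = Ψ * Λ) (hΨε : Ψ * ε = ε * Ψ) (hΨσ : Ψ * σ = σ * Ψ)
    (hΨΨ : Ψ * Ψ = ε)
    (hw : weylElement N Λ L * σ * (weylElement N Λ L * σ) = 1)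
    (hs : s * s = 1) (hS : S = s • (Ψ * weylElement N Λ L * σ)) (hSL : S * L = Λ * S)
    {A dc Λ' : R} (hA : A = ε * Ψ) (hdc : dc = A * d * A * ε) (hΛ' : Λ' = S * L * S * ε) :
    L * -(S * dc * S) - -(S * dc * S) * L = -d ∧
      L * -(S * d * S) - -(S * d * S) * L = dc ∧
      Λ' * dc - dc * Λ' = -(S * d * S) ∧
      Λ' * d - d * Λ' = -(-(S * dc * S)) := by
  set w := weylElement N Λ L with hw_def
  obtain ⟨y, hy⟩ : ∃ y, y = Λ * d - d * Λ := ⟨_, rfl⟩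
  have hΛy : Λ * y = y * Λ := by
    rw [hy]
    exact commute_of_weight_one (e := L) ⟨N, hΛN⟩ rfl hHΛ hLd hHd
  have hLy : L * y = y * L + d := by
    have h1 : L * y - y * L = (L * Λ - Λ * L) * d - d * (L * Λ - Λ * L) +
        (Λ * (L * d - d * L) - (L * d - d * L) * Λ) := by
      rw [hy]
      noncomm_ring
    rw [hHd, hLd, sub_self, mul_zero, zero_mul, sub_self, add_zero] at h1
    rw [← h1]
    abel
  have hwd : w * d = y * w :=
    weylElement_mul hΛN hLN hLd (by rw [hy]; abel) hLy hΛy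
  have hwε : w * ε = ε * w := weylElement_commute hΛε hLε
  have hwΨ : w * Ψ = Ψ * w := weylElement_commute hΛΨ hΨL.symm
  have hεy : ε * y = -(y * ε) := by
    rw [hy, mul_sub, sub_mul, ← mul_assoc, ← hΛε, mul_assoc, hεd, ← mul_assoc, hεd, mul_neg,
      neg_mul, mul_assoc d ε, ← hΛε]
    noncomm_ring
  have hdc' : dc = Ψ * ε * d * Ψ := by
    rw [hdc, hA, ← hΨε]
    calc Ψ * ε * d * (Ψ * ε) * ε = Ψ * ε * d * Ψ * (ε * ε) := by noncomm_ring
      _ = Ψ * ε * d * Ψ := by rw [hεε, mul_one]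
  have hSS : S * S = ε := by
    rw [hS, smul_mul_smul_comm, hs, one_smul]
    calc Ψ * w * σ * (Ψ * w * σ) = Ψ * w * (σ * Ψ) * w * σ := by noncomm_ring
      _ = Ψ * (w * Ψ) * σ * w * σ := by rw [← hΨσ]; noncomm_ring
      _ = Ψ * Ψ * (w * σ * (w * σ)) := by rw [hwΨ]; noncomm_ring
      _ = ε := by rw [hw, hΨΨ, mul_one]
  have hSΨ : S * Ψ = Ψ * S := by
    rw [hS, smul_mul_assoc, mul_smul_comm, mul_assoc, ← hΨσ, ← mul_assoc, mul_assoc Ψ w, hwΨ]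
    simp only [mul_assoc]
  have hSε : S * ε = ε * S := by
    rw [hS, smul_mul_assoc, mul_smul_comm, mul_assoc, hσε, ← mul_assoc, mul_assoc Ψ w, hwε,
      ← mul_assoc, hΨε]
    simp only [mul_assoc]
  have hΛ'' : Λ' = Λ := by
    rw [hΛ', hSL, mul_assoc Λ, hSS, mul_assoc, hεε, mul_one]
  -- The Weyl element turns `d` into `[Λ, d]`.
  have hSdcS : S * dc * S = y := by
    have h1 : σ * Ψ = Ψ * σ := hΨσ.symm
    calc S * dc * S = (s * s) • (Ψ * w * σ * (Ψ * ε * d * Ψ) * (Ψ * w * σ)) := by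
          rw [hS, hdc']
          simp only [smul_mul_assoc, mul_smul_comm, smul_smul]
      _ = Ψ * w * (σ * Ψ) * (ε * d) * (Ψ * Ψ) * w * σ := by
          rw [hs, one_smul]
          noncomm_ring
      _ = -(Ψ * w * Ψ * σ * d * (ε * ε) * w * σ) := by
          rw [hΨΨ, h1, hεd]
          noncomm_ring
      _ = -(Ψ * (w * Ψ) * (σ * d) * w * σ) := by
          rw [hεε]
          noncomm_ring
      _ = -(Ψ * Ψ * (w * d) * ε * σ * w * σ) := by
          rw [hwΨ, hσd]
          noncomm_ring
      _ = -(ε * y * (w * ε) * σ * w * σ) := by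
          rw [hΨΨ, hwd]
          noncomm_ring
      _ = -(ε * y * ε * (w * σ * (w * σ))) := by
          rw [hwε]
          noncomm_ring
      _ = y * (ε * ε) := by
          rw [hw, hεy]
          noncomm_ring
      _ = y := by rw [hεε, mul_one]
  have h3 : Λ * dc - dc * Λ = -(S * d * S) := by
    calc Λ * dc - dc * Λ = (Λ * Ψ) * ε * d * Ψ - Ψ * ε * d * (Ψ * Λ) := by
          rw [hdc']
          noncomm_ring
      _ = Ψ * (Λ * ε) * d * Ψ - Ψ * ε * d * (Λ * Ψ) := by
          rw [hΛΨ]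
          noncomm_ring
      _ = Ψ * ε * y * Ψ := by
          rw [hΛε, hy]
          noncomm_ring
      _ = Ψ * ε * S * (Ψ * ε * d * Ψ) * (S * Ψ) := by
          rw [← hSdcS, hdc']
          noncomm_ring
      _ = Ψ * (ε * S) * Ψ * ε * d * (Ψ * Ψ) * S := by
          rw [hSΨ]
          noncomm_ring
      _ = Ψ * S * (ε * Ψ) * (ε * d) * ε * S := by
          rw [← hSε, hΨΨ]
          noncomm_ring
      _ = -(Ψ * (S * Ψ) * ε * d * (ε * ε) * S) := by
          rw [← hΨε, hεd]
          noncomm_ring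
      _ = -(Ψ * Ψ * (S * ε) * d * S) := by
          rw [hSΨ, hεε]
          noncomm_ring
      _ = -(ε * ε * S * d * S) := by
          rw [hΨΨ, hSε]
          noncomm_ring
      _ = -(S * d * S) := by rw [hεε, one_mul]
  have hLdc : L * dc = dc * L := by
    have hC : Commute L (Ψ * ε * d * Ψ) :=
      ((((show Commute L Ψ from hΨL.symm).mul_right hLε).mul_right hLd).mul_right hΨL.symm)
    rw [hdc']
    exact hC
  have hHdc : (L * Λ - Λ * L) * dc - dc * (L * Λ - Λ * L) = dc := by
    have hHΨ : (L * Λ - Λ * L) * Ψ = Ψ * (L * Λ - Λ * L) := by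
      have h1 : Commute L Ψ := hΨL.symm
      have h2 : Commute Λ Ψ := hΛΨ
      exact (h1.mul_left h2).sub_left (h2.mul_left h1)
    have hHε : (L * Λ - Λ * L) * ε = ε * (L * Λ - Λ * L) := by
      have h1 : Commute L ε := hLε
      have h2 : Commute Λ ε := hΛε
      exact (h1.mul_left h2).sub_left (h2.mul_left h1)
    set H := L * Λ - Λ * L
    calc H * dc - dc * H = (H * Ψ) * ε * d * Ψ - Ψ * ε * d * (Ψ * H) := by
          rw [hdc']
          noncomm_ring
      _ = Ψ * (H * ε) * d * Ψ - Ψ * ε * d * (H * Ψ) := by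
          rw [← hHΨ]
          rw [hHΨ]
          noncomm_ring
      _ = Ψ * ε * (H * d - d * H) * Ψ := by
          rw [hHε]
          noncomm_ring
      _ = dc := by rw [hHd, hdc']
  refine ⟨?_, ?_, by rw [hΛ'', h3], by rw [hΛ'', hSdcS, neg_neg, hy]⟩
  · rw [hSdcS, mul_neg, hLy]
    noncomm_ring
  · rw [← h3]
    have h1 : L * (Λ * dc - dc * Λ) - (Λ * dc - dc * Λ) * L =
        (L * Λ - Λ * L) * dc - dc * (L * Λ - Λ * L) +
        (Λ * (L * dc - dc * L) - (L * dc - dc * L) * Λ) := by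
      noncomm_ring
    rw [h1, hHdc, hLdc, sub_self, mul_zero, zero_mul, sub_self, add_zero]

end KaehlerAlgebra

/-! ### Horizontal and basic forms -/

namespace KContactStructure

variable {n : ℕ} {M : Type*} [TopologicalSpace M] [ChartedSpace (Model n) M]
  [IsManifold 𝓘(ℝ, Model n) ∞ M] (K : KContactStructure n M)

/-- The vector space of inhomogeneous differential forms. -/
def FormSpace (_ : KContactStructure n M) : Type _ := Forms (Model n) M

instance : AddCommGroup K.FormSpace := inferInstanceAs (AddCommGroup (Forms (Model n) M))

instance : Module ℝ K.FormSpace := inferInstanceAs (Module ℝ (Forms (Model n) M))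

/-- The value of an inhomogeneous form at a point. -/
def eval (x : M) : K.FormSpace →ₗ[ℝ] ExtAlg (TangentSpace 𝓘(ℝ, Model n) x) where
  toFun α p := α p x
  map_add' _ _ := rfl
  map_smul' _ _ := rfl

variable {K} in
theorem FormSpace.ext {α β : K.FormSpace} (h : ∀ x, K.eval x α = K.eval x β) : α = β :=
  funext fun p => funext fun x => congrArg (fun γ : ExtAlg _ => γ p) (h x)

/-- The operator on forms that is given by an operator on each tangent space. -/
def pointwise (T : ∀ x : M, Module.End ℝ (ExtAlg (TangentSpace 𝓘(ℝ, Model n) x))) :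
    Module.End ℝ K.FormSpace where
  toFun α := fun p x => T x (K.eval x α) p
  map_add' α β := FormSpace.ext fun x => ((congrArg (T x) (map_add (K.eval x) α β)).trans
    (map_add (T x) _ _))
  map_smul' c α := FormSpace.ext fun x => ((congrArg (T x) (map_smul (K.eval x) c α)).trans
    (map_smul (T x) _ _))

theorem eval_pointwise (T : ∀ x : M, Module.End ℝ (ExtAlg (TangentSpace 𝓘(ℝ, Model n) x)))
    (x : M) (α : K.FormSpace) : K.eval x (K.pointwise T α) = T x (K.eval x α) := rfl

/-- The smooth forms `α` with `ι_ξ α = 0`. -/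
def horizontalForms : Submodule ℝ K.FormSpace where
  carrier := {α | (∀ p, Form.Smooth (α p)) ∧ ∀ x, K.eval x α ∈ (K.tangent x).Hor}
  add_mem' hα hβ := ⟨fun p => (hα.1 p).add (hβ.1 p), fun x => add_mem (hα.2 x) (hβ.2 x)⟩
  zero_mem' := ⟨fun _ => Form.smooth_zero, fun _ => zero_mem _⟩
  smul_mem' c _ hα := ⟨fun p => (hα.1 p).const_smul c, fun x => Submodule.smul_mem _ c (hα.2 x)⟩

variable {K}

/-- The exterior derivative of an inhomogeneous form. -/
def dForm (α : K.FormSpace) : K.FormSpace := d (α : Forms (Model n) M)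

theorem smooth_dForm {α : K.FormSpace} (h : ∀ p, Form.Smooth (α p)) (p : ℕ) :
    Form.Smooth (dForm α p) := by
  cases p with
  | zero => exact Form.smooth_zero
  | succ p => exact (h p).extD

theorem dForm_add {α β : K.FormSpace} (hα : ∀ p, Form.Smooth (α p))
    (hβ : ∀ p, Form.Smooth (β p)) :
    dForm (α + β) = dForm α + dForm β := by
  funext p
  cases p with
  | zero => exact (add_zero (0 : Form (Model n) M 0)).symm
  | succ p => exact extD_add (hα p) (hβ p)

theorem dForm_smul (c : ℝ) (α : K.FormSpace) :
    dForm (c • α) = c • dForm α := by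
  funext p
  cases p with
  | zero => exact (smul_zero c : c • (0 : Form (Model n) M 0) = 0).symm
  | succ p => exact extD_smul c (α p)

theorem dForm_dForm {α : K.FormSpace} (hα : ∀ p, Form.Smooth (α p)) : dForm (dForm α) = 0 := by
  funext p
  match p with
  | 0 => rfl
  | 1 => exact extD_zero
  | p + 2 => exact extD_extD (hα p)

theorem smooth_L {α : K.FormSpace} (h : ∀ p, Form.Smooth (α p)) (p : ℕ) :
    Form.Smooth (K.pointwise (fun x => (K.tangent x).L) α p) := by
  match p with
  | 0 => exact Form.smooth_zero
  | 1 => exact Form.smooth_zero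
  | p + 2 => exact (h p).wedge K.dη_smooth

theorem smooth_gradeOp {α : K.FormSpace} (h : ∀ p, Form.Smooth (α p)) (c : ℕ → ℝ) (p : ℕ) :
    Form.Smooth (K.pointwise (fun _ => gradeOp c) α p) := (h p).const_smul (c p)

theorem dForm_gradeOp (c : ℕ → ℝ) (α : K.FormSpace) :
    dForm (K.pointwise (fun _ => gradeOp c) α) =
      K.pointwise (fun _ => gradeOp fun p => c (p - 1)) (dForm α) := by
  funext p
  cases p with
  | zero => exact (smul_zero (c 0) : c 0 • (0 : Form (Model n) M 0) = 0).symm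
  | succ p => exact extD_smul (c p) (α p)

/-- As `dη` is closed, `d` commutes with `L`. -/
theorem dForm_L {α : K.FormSpace} (h : ∀ p, Form.Smooth (α p)) :
    dForm (K.pointwise (fun x => (K.tangent x).L) α) =
      K.pointwise (fun x => (K.tangent x).L) (dForm α) := by
  funext p
  match p with
  | 0 => rfl
  | 1 => exact extD_zero
  | 2 =>
    refine extD_zero.trans (funext fun x => ?_)
    have h := wedge_smul_left (0 : ℝ) (0 : (TangentSpace 𝓘(ℝ, Model n) x) [⋀^Fin 0]→L[ℝ] ℝ)
      (extD K.η x)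
    rw [zero_smul, zero_smul] at h
    exact h.symm
  | p + 3 => exact extD_wedge_of_closed (h p) K.dη_smooth (extD_extD K.η_smooth)

variable (K) in
/-- The Lie derivative `ι_ξ d` along the Reeb field, on horizontal forms. -/
def lieReeb : Module.End ℝ K.horizontalForms where
  toFun α := ⟨K.pointwise (fun x => iOp (K.ξ x)) (dForm (α : K.FormSpace)), fun p =>
    K.smooth_interior (smooth_dForm α.2.1 (p + 1)), fun x => by
      rw [ContactModule.mem_Hor, eval_pointwise]
      have h := congrArg (fun T => T (K.eval x (dForm (α : K.FormSpace)))) (iOp_iOp (K.ξ x) (K.ξ x))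
      exact ExtAlg.ext fun q => ContinuousAlternatingMap.ext fun v =>
        self_eq_neg.mp (congrArg (fun γ : ExtAlg _ => γ q v) h)⟩
  map_add' α β := Subtype.ext <| by
    have h := congrArg (K.pointwise fun x => iOp (K.ξ x)) (dForm_add α.2.1 β.2.1)
    rw [map_add] at h
    exact h
  map_smul' c α := Subtype.ext <| by
    have h := congrArg (K.pointwise fun x => iOp (K.ξ x)) (dForm_smul c (α : K.FormSpace))
    rw [map_smul] at h
    exact h

theorem eval_lieReeb (x : M) (α : K.horizontalForms) :
    K.eval x (K.lieReeb α) = iOp (K.ξ x) (K.eval x (dForm (α : K.FormSpace))) := rfl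

variable (K) in
/-- The Lefschetz operator on horizontal forms. -/
def horL : Module.End ℝ K.horizontalForms :=
  (K.pointwise fun x => (K.tangent x).L).restrict fun _ hα =>
    ⟨smooth_L hα.1, fun x => (K.tangent x).L_mem_Hor (hα.2 x)⟩

variable (K) in
/-- The dual Lefschetz operator on horizontal forms. -/
def horΛ : Module.End ℝ K.horizontalForms :=
  (K.pointwise fun x => (K.tangent x).Λ).restrict fun _ hα =>
    ⟨K.smooth_Λ hα.1, fun x => (K.tangent x).Λ_mem_Hor (hα.2 x)⟩

theorem eval_horΛ (x : M) (α : K.horizontalForms) :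
    K.eval x (K.horΛ α) = (K.tangent x).Λ (K.eval x α) := rfl

theorem eval_horL_horΛ (x : M) (α : K.horizontalForms) :
    K.eval x ((K.horL * K.horΛ - K.horΛ * K.horL) α : K.horizontalForms) =
      gradeOp (fun p => (p : ℝ) - n) (K.eval x α) :=
  (K.tangent x).L_Λ_apply (α.2.2 x)

theorem horΛ_nilpotent : K.horΛ ^ (n + 1) = 0 := by
  refine LinearMap.ext fun α => Subtype.ext (FormSpace.ext fun x => ?_)
  have h : ∀ k, K.eval x ((K.horΛ ^ k) α : K.horizontalForms) =
      ((K.tangent x).Λ ^ k) (K.eval x α) := by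
    intro k
    induction k with
    | zero => rfl
    | succ k ih =>
      rw [pow_succ', pow_succ', Module.End.mul_apply, Module.End.mul_apply, ← ih]
      rfl
  rw [h, (K.tangent x).Λ_nilpotent]
  rfl

theorem lie_horL_horΛ_horΛ : (K.horL * K.horΛ - K.horΛ * K.horL) * K.horΛ -
    K.horΛ * (K.horL * K.horΛ - K.horΛ * K.horL) = (-2 : ℝ) • K.horΛ := by
  refine LinearMap.ext fun α => Subtype.ext (FormSpace.ext fun x => ?_)
  have h := (K.tangent x).gradeOp_Λ_apply (K.eval x α)
  rw [← eval_horL_horΛ, ← eval_horΛ, ← eval_horL_horΛ] at h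
  exact h

theorem horL_lieReeb : K.horL * K.lieReeb = K.lieReeb * K.horL := by
  refine LinearMap.ext fun α => Subtype.ext (FormSpace.ext fun x => ?_)
  have h1 := congrArg (fun T => T (K.eval x (dForm (α : K.FormSpace))))
    ((K.tangent x).iOp_L (K.ξ x))
  have h2 : (K.tangent x).flat ((K.tangent x).Φ (K.ξ x)) = 0 := by
    rw [show (K.tangent x).Φ (K.ξ x) = 0 from K.Φ_ξ x]
    exact map_zero (K.tangent x).flatLin
  rw [h2, map_zero, add_zero] at h1
  refine h1.symm.trans ?_
  exact congrArg (fun γ : K.FormSpace => iOp (K.ξ x) (K.eval x γ)) (dForm_L α.2.1).symm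

theorem lie_horL_horΛ_lieReeb : (K.horL * K.horΛ - K.horΛ * K.horL) * K.lieReeb =
    K.lieReeb * (K.horL * K.horΛ - K.horΛ * K.horL) := by
  refine LinearMap.ext fun α => Subtype.ext (FormSpace.ext fun x => ?_)
  rw [Module.End.mul_apply, eval_horL_horΛ, eval_lieReeb, Module.End.mul_apply, eval_lieReeb]
  have h1 : (((K.horL * K.horΛ - K.horΛ * K.horL) α : K.horizontalForms) : K.FormSpace) =
      K.pointwise (fun _ => gradeOp fun p => (p : ℝ) - n) (α : K.FormSpace) :=
    FormSpace.ext fun x => eval_horL_horΛ x α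
  rw [h1]
  have h2 := congrArg (fun γ : K.FormSpace => iOp (K.ξ x) (K.eval x γ))
    (dForm_gradeOp (fun p => (p : ℝ) - n) (α : K.FormSpace))
  refine Eq.trans ?_ h2.symm
  rw [eval_pointwise, ← Module.End.mul_apply (iOp _), iOp_gradeOp]
  rfl

/-- The Lie derivative along `ξ` commutes with `Λ`, since it commutes with `L` and with the
degree. -/
theorem horΛ_lieReeb : K.horΛ * K.lieReeb = K.lieReeb * K.horΛ :=
  commute_of_weight_zero (e := K.horL) ⟨_, horΛ_nilpotent⟩ rfl lie_horL_horΛ_horΛ horL_lieReeb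
    lie_horL_horΛ_lieReeb

variable (K) in
/-- The basic forms, described as the smooth forms `α` with `ι_ξ α = 0` and `ι_ξ dα = 0`. -/
def basicForms : Submodule ℝ K.FormSpace := (LinearMap.ker K.lieReeb).map K.horizontalForms.subtype

theorem mem_basicForms {α : K.FormSpace} :
    α ∈ K.basicForms ↔ ∃ h : α ∈ K.horizontalForms, K.lieReeb ⟨α, h⟩ = 0 := by
  rw [basicForms, Submodule.mem_map]
  constructor
  · rintro ⟨β, hβ, rfl⟩
    exact ⟨β.2, LinearMap.mem_ker.mp hβ⟩
  · rintro ⟨h, h'⟩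
    exact ⟨⟨α, h⟩, LinearMap.mem_ker.mpr h', rfl⟩

theorem mem_basicForms_iff {α : K.FormSpace} : α ∈ K.basicForms ↔ (∀ p, Form.Smooth (α p)) ∧
    (∀ x, iOp (K.ξ x) (K.eval x α) = 0) ∧
      ∀ x, iOp (K.ξ x) (K.eval x (dForm α)) = 0 := by
  rw [mem_basicForms]
  constructor
  · rintro ⟨h, h'⟩
    refine ⟨h.1, h.2, fun x => ?_⟩
    rw [← eval_lieReeb x ⟨α, h⟩, h']
    rfl
  · rintro ⟨h1, h2, h3⟩
    exact ⟨⟨h1, h2⟩, Subtype.ext (FormSpace.ext h3)⟩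

/-- By Cartan's formula, `ι_ξ dα` is the Lie derivative of a horizontal form. -/
theorem mem_basicForms_of_isBasic {α : Forms (Model n) M} (h : ∀ p, IsBasic K.ξ (α p)) :
    (α : K.FormSpace) ∈ K.basicForms := by
  refine mem_basicForms_iff.mpr ⟨fun p => (h p).smooth, fun x => ?_, fun x => ?_⟩
  · refine ExtAlg.ext fun p => ?_
    ext v
    exact (h (p + 1)).interior_eq_zero x _ ⟨0, rfl⟩
  · refine ExtAlg.ext fun p => ?_
    ext v
    choose X hX hXv using fun i => exists_smoothAt_extension x (v i)
    have h1 := extD_vecCons_of_horizontal (h p).smooth K.ξ_smooth (h p).interior_eq_zero hX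
    rw [(h p).lie_eq_zero x X hX] at h1
    simp only [hXv] at h1
    exact h1

theorem L_mem_basicForms {α : K.FormSpace} (hα : α ∈ K.basicForms) :
    K.pointwise (fun x => (K.tangent x).L) α ∈ K.basicForms := by
  obtain ⟨h, h'⟩ := mem_basicForms.mp hα
  refine mem_basicForms.mpr ⟨(K.horL ⟨α, h⟩).2, ?_⟩
  have h1 := congrArg (fun T => T ⟨α, h⟩) (horL_lieReeb (K := K))
  rw [Module.End.mul_apply, h', map_zero] at h1
  exact h1.symm

theorem Λ_mem_basicForms {α : K.FormSpace} (hα : α ∈ K.basicForms) :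
    K.pointwise (fun x => (K.tangent x).Λ) α ∈ K.basicForms := by
  obtain ⟨h, h'⟩ := mem_basicForms.mp hα
  refine mem_basicForms.mpr ⟨(K.horΛ ⟨α, h⟩).2, ?_⟩
  have h1 := congrArg (fun T => T ⟨α, h⟩) (horΛ_lieReeb (K := K))
  rw [Module.End.mul_apply, h', map_zero] at h1
  exact h1.symm

theorem gradeOp_mem_basicForms (c : ℕ → ℝ) {α : K.FormSpace} (hα : α ∈ K.basicForms) :
    K.pointwise (fun _ => gradeOp c) α ∈ K.basicForms := by
  obtain ⟨h1, h2, h3⟩ := mem_basicForms_iff.mp hα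
  refine mem_basicForms_iff.mpr ⟨smooth_gradeOp h1 c, fun x => ?_, fun x => ?_⟩
  · rw [eval_pointwise, ← Module.End.mul_apply, iOp_gradeOp, Module.End.mul_apply, h2, map_zero]
  · refine (congrArg (fun γ : K.FormSpace => iOp (K.ξ x) (K.eval x γ)) (dForm_gradeOp c α)).trans ?_
    rw [eval_pointwise, ← Module.End.mul_apply, iOp_gradeOp, Module.End.mul_apply, h3, map_zero]

theorem dForm_mem_basicForms {α : K.FormSpace} (hα : α ∈ K.basicForms) :
    dForm α ∈ K.basicForms := by
  obtain ⟨h1, h2, h3⟩ := mem_basicForms_iff.mp hα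
  refine mem_basicForms_iff.mpr ⟨smooth_dForm h1, h3, fun x => ?_⟩
  rw [dForm_dForm h1]
  exact map_zero _

/-- As `𝔏_ξ Φ = 0`, the action of `Φ` preserves basic forms. -/
theorem Ψ_mem_basicForms {α : K.FormSpace} (hα : α ∈ K.basicForms) :
    K.pointwise (fun x => (K.tangent x).Ψ) α ∈ K.basicForms := by
  obtain ⟨h1, h2, h3⟩ := mem_basicForms_iff.mp hα
  have hhor : ∀ (p : ℕ) (x : M) (v : Fin p → TangentSpace 𝓘(ℝ, Model n) x),
      (∃ i, v i = K.ξ x) → α p x v = 0 := by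
    rintro p x v ⟨i, hi⟩
    obtain ⟨p, rfl⟩ : ∃ q, p = q + 1 := ⟨p - 1, by have := i.isLt; omega⟩
    have h := (α (p + 1) x).toAlternatingMap.map_insertNth i (K.ξ x) (Fin.removeNth i v)
    rw [← hi, Fin.insertNth_self_removeNth, hi] at h
    refine h.trans ?_
    have h4 := congrArg (fun γ : ExtAlg _ => γ p (Fin.removeNth i v)) (h2 x)
    have h5 : α (p + 1) x (Matrix.vecCons (K.ξ x) (Fin.removeNth i v)) = 0 := h4
    exact (congrArg _ h5).trans (smul_zero _)
  refine mem_basicForms_iff.mpr ⟨fun p => K.smooth_pullback (h1 p), fun x =>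
    (K.tangent x).mem_Hor.mp ((K.tangent x).pullOp_mem_Hor _), fun x => ?_⟩
  refine ExtAlg.ext fun p => ?_
  ext v
  choose X hX hXv using fun i => exists_smoothAt_extension x (v i)
  have h4 := extD_vecCons_of_horizontal (α := fun x : M => (α p x).compContinuousLinearMap (K.Φ x))
    (K.smooth_pullback (h1 p)) K.ξ_smooth (fun x v ⟨i, hi⟩ =>
      (α p x).map_coord_zero i (by
        change K.Φ x (v i) = 0
        rw [hi, K.Φ_ξ])) hX
  have h5 := extD_vecCons_of_horizontal (h1 p) K.ξ_smooth (hhor p)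
    (X := fun i y => K.Φ y (X i y)) fun i => K.Φ_smoothAt (hX i)
  have h6 : extD (α p) x (Matrix.vecCons (K.ξ x) fun i => K.Φ x (X i x)) = 0 :=
    congrArg (fun γ : ExtAlg _ => γ p fun i => K.Φ x (X i x)) (h3 x)
  rw [h6] at h5
  have h7 : extD (fun x : M => (α p x).compContinuousLinearMap (K.Φ x)) x
      (Matrix.vecCons (K.ξ x) fun i => X i x) = 0 := by
    rw [h4, h5]
    refine congrArg _ (Finset.sum_congr rfl fun i _ => ?_)
    rw [ContinuousAlternatingMap.compContinuousLinearMap_apply]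
    refine congrArg (α p x) (funext fun j => ?_)
    rw [Function.comp_apply]
    by_cases hj : j = i
    · subst hj
      rw [Function.update_self, Function.update_self]
      exact (sub_eq_zero.mp (K.lie_Φ x (X j) (hX j))).symm
    · rw [Function.update_of_ne hj, Function.update_of_ne hj]
  simp only [hXv] at h7
  exact h7

/-! ### Operators on basic forms -/

variable (K)

/-- The value of a basic form at a point. -/
def basicEval (x : M) : K.basicForms →ₗ[ℝ] ExtAlg (TangentSpace 𝓘(ℝ, Model n) x) :=
  K.eval x ∘ₗ K.basicForms.subtype

variable {K} in
theorem basicForms_ext {a b : K.basicForms} (h : ∀ x, K.basicEval x a = K.basicEval x b) : a = b :=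
  Subtype.ext (FormSpace.ext h)

theorem smooth_of_basic (a : K.basicForms) (p : ℕ) : Form.Smooth ((a : K.FormSpace) p) :=
  (mem_basicForms_iff.mp a.2).1 p

theorem basicEval_mem_Hor (x : M) (a : K.basicForms) : K.basicEval x a ∈ (K.tangent x).Hor :=
  (mem_basicForms_iff.mp a.2).2.1 x

/-- The operator `L` on basic forms. -/
def basicL : Module.End ℝ K.basicForms :=
  (K.pointwise fun x => (K.tangent x).L).restrict fun _ => L_mem_basicForms

/-- The adjoint of `L`, given by contraction with the bivector dual to `dη`, on basic forms. -/
def basicΛ : Module.End ℝ K.basicForms :=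
  (K.pointwise fun x => (K.tangent x).Λ).restrict fun _ => Λ_mem_basicForms

/-- The operator on basic forms that is equal to `c p` in degree `p`. -/
def basicGrade (c : ℕ → ℝ) : Module.End ℝ K.basicForms :=
  (K.pointwise fun _ => gradeOp c).restrict fun _ => gradeOp_mem_basicForms c

/-- The pullback by `Φ` on basic forms. -/
def basicΨ : Module.End ℝ K.basicForms :=
  (K.pointwise fun x => (K.tangent x).Ψ).restrict fun _ => Ψ_mem_basicForms

/-- The exterior derivative on basic forms. -/
def basicD : Module.End ℝ K.basicForms where
  toFun a := ⟨dForm a, dForm_mem_basicForms a.2⟩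
  map_add' a b := Subtype.ext (dForm_add (K.smooth_of_basic a) (K.smooth_of_basic b))
  map_smul' c a := Subtype.ext (dForm_smul c (a : K.FormSpace))

/-- The Weyl element of the `sl₂`-action on basic forms. -/
def basicW : Module.End ℝ K.basicForms := weylElement (n + 1) K.basicΛ K.basicL

theorem basicEval_basicW (x : M) (a : K.basicForms) :
    K.basicEval x (K.basicW a) = (K.tangent x).w (K.basicEval x a) :=
  weylElement_intertwine (K.basicEval x) (fun _ => rfl) (fun _ => rfl) _ _

/-- The transverse Hodge star on basic forms, written by means of the Weyl element. In this form
it visibly preserves smoothness. -/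
def basicStar : Module.End ℝ K.basicForms :=
  (-1 : ℝ) ^ n • (K.basicΨ * K.basicW * K.basicGrade ContactModule.reversalSign)

theorem basicEval_basicStar (x : M) (a : K.basicForms) :
    K.basicEval x (K.basicStar a) = (-1 : ℝ) ^ n • (K.tangent x).W (K.basicEval x a) := by
  refine (map_smul (K.basicEval x) _ _).trans (congrArg _ ?_)
  exact congrArg (K.tangent x).Ψ (K.basicEval_basicW x _)

theorem basicGrade_mul (c c' : ℕ → ℝ) :
    K.basicGrade c * K.basicGrade c' = K.basicGrade (c * c') :=
  LinearMap.ext fun a => basicForms_ext fun x =>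
    congrArg (fun T => T (K.basicEval x a)) (gradeOp_mul c c')

theorem basicGrade_one : K.basicGrade 1 = 1 :=
  LinearMap.ext fun a => basicForms_ext fun x =>
    congrArg (fun T => T (K.basicEval x a)) gradeOp_one

/-- The exterior derivative raises the degree by one. -/
theorem basicGrade_basicD (c : ℕ → ℝ) :
    K.basicGrade c * K.basicD = K.basicD * K.basicGrade fun p => c (p + 1) := by
  refine LinearMap.ext fun a => Subtype.ext (funext fun p => ?_)
  cases p with
  | zero => exact (smul_zero (c 0) : c 0 • (0 : Form (Model n) M 0) = 0)
  | succ p => exact (extD_smul (c (p + 1)) ((a : K.FormSpace) p)).symm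

theorem basicL_basicΛ :
    K.basicL * K.basicΛ - K.basicΛ * K.basicL = K.basicGrade fun p => (p : ℝ) - n :=
  LinearMap.ext fun a => basicForms_ext fun x =>
    (K.tangent x).L_Λ_apply (K.basicEval_mem_Hor x a)

theorem basicEval_pow {T : Module.End ℝ K.basicForms} {x : M}
    {T' : Module.End ℝ (ExtAlg (TangentSpace 𝓘(ℝ, Model n) x))}
    (h : ∀ a, K.basicEval x (T a) = T' (K.basicEval x a)) (k : ℕ) (a : K.basicForms) :
    K.basicEval x ((T ^ k) a) = (T' ^ k) (K.basicEval x a) := by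
  induction k with
  | zero => rfl
  | succ k ih =>
    rw [pow_succ', pow_succ', Module.End.mul_apply, Module.End.mul_apply, ← ih, h]

theorem basicΛ_nilpotent : K.basicΛ ^ (n + 1) = 0 := by
  refine LinearMap.ext fun a => basicForms_ext fun x => ?_
  rw [K.basicEval_pow (T' := (K.tangent x).Λ) (fun _ => rfl), (K.tangent x).Λ_nilpotent,
    LinearMap.zero_apply, LinearMap.zero_apply, map_zero]

theorem basicL_nilpotent : K.basicL ^ (n + 1) = 0 := by
  refine LinearMap.ext fun a => basicForms_ext fun x => ?_
  rw [K.basicEval_pow (T' := (K.tangent x).L) (fun _ => rfl), (K.tangent x).L_nilpotent,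
    LinearMap.zero_apply, LinearMap.zero_apply, map_zero]

theorem basicStar_basicL : K.basicStar * K.basicL = K.basicΛ * K.basicStar := by
  refine LinearMap.ext fun a => basicForms_ext fun x => ?_
  have h := congrArg (fun T => T (K.basicEval x a))
    ((K.tangent x).intertwine_L fun X hX => (K.tangent x).W_wOp hX)
  refine (K.basicEval_basicStar x (K.basicL a)).trans ?_
  refine (congrArg ((-1 : ℝ) ^ n • ·) h).trans ?_
  refine (map_smul (K.tangent x).Λ _ _).symm.trans ?_
  exact congrArg (K.tangent x).Λ (K.basicEval_basicStar x a).symm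

/-- The sign operator on basic forms, equal to `(-1)^p` in degree `p`. -/
def basicSign : Module.End ℝ K.basicForms := K.basicGrade fun p => (-1) ^ p

theorem basic_kaehler_identities {A dc Λ' : Module.End ℝ K.basicForms}
    (hA : A = K.basicSign * K.basicΨ) (hdc : dc = A * K.basicD * A * K.basicSign)
    (hΛ' : Λ' = K.basicStar * K.basicL * K.basicStar * K.basicSign) :
    K.basicL * -(K.basicStar * dc * K.basicStar) - -(K.basicStar * dc * K.basicStar) * K.basicL =
        -K.basicD ∧
      K.basicL * -(K.basicStar * K.basicD * K.basicStar) -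
        -(K.basicStar * K.basicD * K.basicStar) * K.basicL = dc ∧
      Λ' * dc - dc * Λ' = -(K.basicStar * K.basicD * K.basicStar) ∧
      Λ' * K.basicD - K.basicD * Λ' = -(-(K.basicStar * dc * K.basicStar)) := by
  refine kaehler_identities_of_relations (N := n + 1) (Λ := K.basicΛ) (ε := K.basicSign)
    (σ := K.basicGrade ContactModule.reversalSign) (Ψ := K.basicΨ) (s := (-1) ^ n)
    K.basicL_nilpotent K.basicΛ_nilpotent ?_ ?_ ?_ ?_ ?_ ?_ ?_ ?_ ?_ ?_ ?_ ?_ ?_ ?_ ?_ ?_ rfl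
    K.basicStar_basicL hA hdc hΛ'
  · rw [basicL_basicΛ]
    exact LinearMap.ext fun a => basicForms_ext fun x =>
      (K.tangent x).gradeOp_Λ_apply (K.basicEval x a)
  · exact LinearMap.ext fun a => Subtype.ext (dForm_L (K.smooth_of_basic a)).symm
  · rw [basicL_basicΛ, basicGrade_basicD, ← mul_sub]
    have h : (K.basicGrade fun p => ((p + 1 : ℕ) : ℝ) - n) - (K.basicGrade fun p => (p : ℝ) - n) =
        1 := by
      refine LinearMap.ext fun a => basicForms_ext fun x => ExtAlg.ext fun p => ?_
      change (((p + 1 : ℕ) : ℝ) - n) • K.basicEval x a p - ((p : ℝ) - n) • K.basicEval x a p =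
        K.basicEval x a p
      push_cast
      module
    rw [h, mul_one]
  · rw [basicSign, basicGrade_mul, ← basicGrade_one]
    congr 1
    funext p
    simp [← mul_pow]
  · rw [basicSign, basicGrade_basicD]
    refine Eq.trans (congrArg (K.basicD * ·) (?_ : _ = -K.basicGrade fun p => (-1) ^ p))
      (LinearMap.ext fun a => map_neg K.basicD _)
    refine LinearMap.ext fun a => basicForms_ext fun x => ExtAlg.ext fun p => ?_
    change ((-1 : ℝ) ^ (p + 1)) • K.basicEval x a p = -((-1 : ℝ) ^ p • K.basicEval x a p)
    rw [pow_succ]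
    module
  · exact LinearMap.ext fun a => basicForms_ext fun x =>
      congrArg (fun T => T (K.basicEval x a)) (K.tangent x).L_signOp
  · exact LinearMap.ext fun a => basicForms_ext fun x =>
      congrArg (fun T => T (K.basicEval x a)) (K.tangent x).Λ_signOp
  · rw [basicGrade_basicD, mul_assoc, basicSign, basicGrade_mul]
    rfl
  · rw [basicSign, basicGrade_mul, basicGrade_mul, mul_comm]
  · exact LinearMap.ext fun a => basicForms_ext fun x =>
      congrArg (fun T => T (K.basicEval x a)) (K.tangent x).Ψ_L
  · exact LinearMap.ext fun a => basicForms_ext fun x =>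
      congrArg (fun T => T (K.basicEval x a)) (K.tangent x).Λ_Ψ
  · exact LinearMap.ext fun a => basicForms_ext fun x =>
      congrArg (fun T => T (K.basicEval x a)) ((K.tangent x).Ψ_gradeOp _)
  · exact LinearMap.ext fun a => basicForms_ext fun x =>
      congrArg (fun T => T (K.basicEval x a)) ((K.tangent x).Ψ_gradeOp _)
  · exact LinearMap.ext fun a => basicForms_ext fun x =>
      (K.tangent x).Ψ_Ψ (K.basicEval_mem_Hor x a)
  · refine LinearMap.ext fun a => basicForms_ext fun x => ?_
    refine (K.basicEval_basicW x _).trans ?_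
    refine (congrArg (fun γ => (K.tangent x).w (ContactModule.revOp γ))
      (K.basicEval_basicW x _)).trans ?_
    exact (K.tangent x).w_revOp_w_revOp (K.basicEval_mem_Hor x a)
  · rw [← mul_pow]
    simp

/-! ### Comparison with the operators on inhomogeneous forms -/

/-- A basic form, as an inhomogeneous form. -/
def toForms (a : K.basicForms) : Forms (Model n) M := (a : K.FormSpace)

theorem toForms_sub (a b : K.basicForms) : K.toForms (a - b) = K.toForms a - K.toForms b := rfl

theorem toForms_neg (a : K.basicForms) : K.toForms (-a) = -K.toForms a := rfl

theorem d_toForms (a : K.basicForms) : d (K.toForms a) = K.toForms (K.basicD a) := rfl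

theorem sgn_toForms (a : K.basicForms) : sgn (K.toForms a) = K.toForms (K.basicSign a) := rfl

theorem act_toForms (a : K.basicForms) :
    K.act (K.toForms a) = K.toForms (K.basicSign (K.basicΨ a)) := rfl

theorem L_toForms (a : K.basicForms) : K.L (K.toForms a) = K.toForms (K.basicL a) := by
  funext p
  match p with
  | 0 => rfl
  | 1 => rfl
  | p + 2 => rfl

theorem star_apply (α : K.FormSpace) (p : ℕ) (x : M) :
    K.star (α : Forms (Model n) M) p x = (K.tangent x).starOp (K.eval x α) p := by
  by_cases h : p ≤ 2 * n
  · have h1 : K.star (α : Forms (Model n) M) p = K.hodge (r := 1 + (2 * n - p)) (by omega)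
        fun x => wedge (K.η x) (α (2 * n - p) x) := dif_pos h
    rw [h1, ContactModule.starOp_apply (m := 2 * n - p) _ (by omega)]
    rfl
  · have h1 : K.star (α : Forms (Model n) M) p = 0 := dif_neg h
    rw [h1, ContactModule.starOp_apply_of_lt _ (by omega)]
    rfl

theorem star_toForms (a : K.basicForms) : K.star (K.toForms a) = K.toForms (K.basicStar a) := by
  funext p x
  have h := ContactModule.starOp_eq _ (K.contactForm_tangent_ne_zero x) (K.basicEval_mem_Hor x a)
  rw [← basicEval_basicStar] at h
  exact (K.star_apply _ p x).trans (congrArg (fun γ : ExtAlg _ => γ p) h)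

end KContactStructure

end KContact

end

theorem mainTheorem11 (n : ℕ) {M : Type*} [TopologicalSpace M]
    [ChartedSpace (EuclideanSpace ℝ (Fin (2 * n + 1))) M]
    [IsManifold 𝓘(ℝ, EuclideanSpace ℝ (Fin (2 * n + 1))) ∞ M]
    (K : KContact.KContactStructure n M)
    (α : KContact.Forms (EuclideanSpace ℝ (Fin (2 * n + 1))) M)
    (hα : ∀ p : ℕ, KContact.IsBasic K.ξ (α p)) :
    K.L (K.δc α) - K.δc (K.L α) = -KContact.d α ∧
    K.L (K.δ α) - K.δ (K.L α) = K.dc α ∧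
    K.Λ (K.dc α) - K.dc (K.Λ α) = K.δ α ∧
    K.Λ (KContact.d α) - KContact.d (K.Λ α) = -K.δc α := by
  obtain ⟨a, rfl⟩ : ∃ a : K.basicForms, α = K.toForms a :=
    ⟨⟨α, KContact.KContactStructure.mem_basicForms_of_isBasic hα⟩, rfl⟩
  obtain ⟨h1, h2, h3, h4⟩ := K.basic_kaehler_identities rfl rfl rfl
  simp only [KContact.KContactStructure.δc, KContact.KContactStructure.δ,
    KContact.KContactStructure.dc, KContact.KContactStructure.Λ, K.sgn_toForms, K.act_toForms,
    K.star_toForms, K.d_toForms, K.L_toForms, ← K.toForms_neg, ← K.toForms_sub]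
  exact ⟨congrArg (fun T => K.toForms (T a)) h1, congrArg (fun T => K.toForms (T a)) h2,
    congrArg (fun T => K.toForms (T a)) h3, congrArg (fun T => K.toForms (T a)) h4⟩
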